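/- \textbf{Theorem (Meromorphic continuation of Dirichlet series).} Let $d\ge 1$ and let $\Lambda=M\mathbb Z^d\subset\mathbb R^d$ ($\det M\ne 0$) be a lattice with covolume $V_\Lambda=|\det M|$. Let $\chi\in C_0^\infty(B_1)$ be nonnegative, rotationally invariant, with $\int\chi=1$. For $\beta>0$ put $\chi_\beta=\beta^{-d}\chi(\cdot/\beta)$ and $\hat\chi_\beta(\xi)=\int_{\mathbb R^d}e^{-2\pi i\langle\xi,x\rangle}\chi_\beta(x)\,dx$. Let $P:\mathbb R^d\to\mathbb C$ be a polynomial of degree $m$. For $\nu\in\mathbb C$ and a Schwartz function $g:\mathbb R^d\to\mathbb C$, the Hadamard finite-part integral is $$\mathrm{f.p.}\!\int_{\mathbb R^d}\frac{g(y)}{|y|^\nu}\,dy=\lim_{\varepsilon\downarrow0}\Big(\int_{|y|\ge\varepsilon}\frac{g(y)}{|y|^{\nu}}\,dy-\sum_{0\le k\le\lfloor\operatorname{Re}\nu-d\rfloor}\frac1{k!}\int_{|y|\ge\varepsilon}\frac{\langle y,\nabla\rangle^kg(0)}{|y|^{\nu}}\,dy\Big).$$ If $\nu=d+k$, the domain of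 the $k$-th integral in the sum is replaced by $\varepsilon\le|y|<1$. If $\operatorname{Re}\nu=d+k$ and $\operatorname{Im}\nu\neq0$, the $k$-th integral in the sum is read as $\lim_{s\downarrow0}\int_{|y|\ge\varepsilon}\langle y,\nabla\rangle^kg(0)\,|y|^{-\nu-s}\,dy$. For $\nu\notin d+2\mathbb N$ this is the action on $g$ of the homogeneous distribution $|\cdot|^{-\nu}$. The Hadamard sum-integral of $g/|\cdot|^\nu$ is $$\sum_{z\in\Lambda\setminus\{0\}}\frac{g(z)}{|z|^\nu}-\frac1{V_\Lambda}\,\mathrm{f.p.}\!\int_{\mathbb R^d}\frac{g(y)}{|y|^\nu}\,dy .$$ For every $\nu\in\mathbb C$ and $\beta>0$ the Hadamard sum-integral of $\hat\chi_\beta P/|\cdot|^\nu$ is well defined (the sum converges absolutely, the integrals over $|y|\ge\varepsilon$ of $\hat\chi_\beta P/|\cdot|^\nu$ converge absolutely, and the limit $\varepsilon\downarrow 0$ exists), and it has a limit $F(\nu)\in\mathbb C$ as $\beta\downarrow0$. (i) If $\operatorname{Re}\nu>d+m$, the Dirichlet series converges absolutely and $$F(\nu)=\sum_{z\in\Lambda\setminus\{0\}}\frac{P(z)}{|z|^\nu}.$$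 (ii) $F$ is meromorphic on $\mathbb C$, and so it is the meromorphic continuation of the Dirichlet series. It is holomorphic at every $\nu$ that is not of the form $d+2k$ with $k\in\mathbb N=\{0,1,2,\dots\}$ and $\Delta^kP(0)\ne0$. If $\Delta^kP(0)\neq0$, then $F$ has a simple pole at $\nu=d+2k$. For every $k\in\mathbb N$, $$\lim_{\substack{\nu\to d+2k\\ \nu\ne d+2k}}\big(\nu-(d+2k)\big)F(\nu)=\frac{\omega_d}{V_\Lambda}\,\frac{(1/2)_k}{(2k)!\,(d/2)_k}\,\Delta^kP(0),$$ where $\omega_d$ is the surface area of the unit sphere in $\mathbb R^d$ and $(x)_k=x(x+1)\cdots(x+k-1)$. -/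

import Mathlib

open MeasureTheory Filter Topology
open scoped ContDiff

noncomputable section

/-- The function `z ↦ P(z)` on `ℝ^d` given by a complex polynomial in `d` variables. -/
def polyFun {d : ℕ} (P : MvPolynomial (Fin d) ℂ) (z : EuclideanSpace ℝ (Fin d)) : ℂ :=
  MvPolynomial.eval (fun i => (z i : ℂ)) P

/-- `Δ^k P (0)`, with `Δ` the Laplacian of functions on `ℝ^d`. -/
def polyLaplaceAtZero {d : ℕ} (P : MvPolynomial (Fin d) ℂ) (k : ℕ) : ℂ :=
  ((Laplacian.laplacian :
    (EuclideanSpace ℝ (Fin d) → ℂ) → (EuclideanSpace ℝ (Fin d) → ℂ))^[k] (polyFun P)) 0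

/-- The profile of a family of mollifiers: a nonnegative rotationally invariant function
in `C_0^∞(B_1)` of unit mass. -/
structure IsMollifierProfile {d : ℕ} (χ : EuclideanSpace ℝ (Fin d) → ℝ) : Prop where
  smooth : ContDiff ℝ ∞ χ
  tsupport_subset : tsupport χ ⊆ Metric.ball 0 1
  rotation_invariant :
    ∀ (A : EuclideanSpace ℝ (Fin d) ≃ₗᵢ[ℝ] EuclideanSpace ℝ (Fin d)) x, χ (A x) = χ x
  nonneg : ∀ x, 0 ≤ χ x
  integral_eq_one : ∫ x, χ x = 1

/-- The mollifier `χ_β = β^{-d} χ(· / β)`. -/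
def mollifier {d : ℕ} (χ : EuclideanSpace ℝ (Fin d) → ℝ) (β : ℝ)
    (x : EuclideanSpace ℝ (Fin d)) : ℝ :=
  (β ^ d)⁻¹ * χ (β⁻¹ • x)

/-- The smooth cutoff function: the Fourier transform
`ξ ↦ ∫ exp(-2πi⟨ξ, x⟩) χ_β(x) dx` of the mollifier `χ_β`. -/
def smoothCutoff {d : ℕ} (χ : EuclideanSpace ℝ (Fin d) → ℝ) (β : ℝ) :
    EuclideanSpace ℝ (Fin d) → ℂ :=
  FourierTransform.fourier (fun x => (mollifier χ β x : ℂ))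

/-- The quotient `g(z) / |z|^ν`. -/
def quotPow {d : ℕ} (ν : ℂ) (g : EuclideanSpace ℝ (Fin d) → ℂ)
    (z : EuclideanSpace ℝ (Fin d)) : ℂ :=
  g z / (‖z‖ : ℂ) ^ ν

/-- The Taylor term `y ↦ ⟨y, ∇⟩^k g(0) / k!`. -/
def taylorTerm {d : ℕ} (k : ℕ) (g : EuclideanSpace ℝ (Fin d) → ℂ)
    (y : EuclideanSpace ℝ (Fin d)) : ℂ :=
  iteratedFDeriv ℝ k g 0 (fun _ => y) / (k.factorial : ℂ)

/-- The integral of `q(y) / |y|^ν` over the exterior `ℝ^d \ B_ε`, in the Abel sense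
`lim_{s ↓ 0} ∫_{|y| ≥ ε} q(y) / |y|^{ν+s} dy`. It is used for `q` a homogeneous polynomial of
degree `k ≤ Re ν - d`, `ν ≠ d + k`. If `k < Re ν - d`, the integral at `s = 0` converges absolutely
and the limit is equal to it. If `k = Re ν - d` and `ν` is not real, the integral at `s = 0` is not
convergent (its truncations oscillate boundedly), and the limit is the value that belongs to the
homogeneous distribution `|·|^{-ν}`. -/
def exteriorIntegral {d : ℕ} (ν : ℂ) (ε : ℝ) (q : EuclideanSpace ℝ (Fin d) → ℂ) : ℂ :=
  limUnder (𝓝[>] (0 : ℝ))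
    (fun s : ℝ => ∫ y in {y : EuclideanSpace ℝ (Fin d) | ε ≤ ‖y‖}, quotPow (ν + s) q y)

/-- The Hadamard counterterm `(H_{ν,ε} g)(0)`, a sum over `0 ≤ k ≤ ⌊Re ν - d⌋` (empty if
`Re ν < d`) of the exterior integrals of the Taylor terms of `g`. In the exceptional case
`ν = d + k`, the integral over `ℝ^d \ B_ε` is replaced by the one over `B_1 \ B_ε`. -/
def hadamardCounterterm {d : ℕ} (ν : ℂ) (ε : ℝ) (g : EuclideanSpace ℝ (Fin d) → ℂ) : ℂ :=
  open Classical in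
  ∑ k ∈ Finset.range (⌊ν.re - d⌋ + 1).toNat,
    if ν = d + k then
      ∫ y in {y : EuclideanSpace ℝ (Fin d) | ε ≤ ‖y‖ ∧ ‖y‖ < 1}, quotPow ν (taylorTerm k g) y
    else exteriorIntegral ν ε (taylorTerm k g)

/-- The expression `∫_{ℝ^d \ B_ε} g(y) / |y|^ν dy - (H_{ν,ε} g)(0)`. -/
def hadamardTruncated {d : ℕ} (ν : ℂ) (g : EuclideanSpace ℝ (Fin d) → ℂ) (ε : ℝ) : ℂ :=
  (∫ y in {y : EuclideanSpace ℝ (Fin d) | ε ≤ ‖y‖}, quotPow ν g y) - hadamardCounterterm ν ε g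

/-- The Hadamard finite-part integral of `g(y) / |y|^ν` over `ℝ^d`. -/
def hadamardIntegral {d : ℕ} (ν : ℂ) (g : EuclideanSpace ℝ (Fin d) → ℂ) : ℂ :=
  limUnder (𝓝[>] (0 : ℝ)) (hadamardTruncated ν g)

/-- The Hadamard sum-integral of `g(z) / |z|^ν` over `ℝ^d` and the lattice `Λ`: the sum over
the nonzero lattice points minus the Hadamard integral per covolume. -/
def hadamardSumIntegral {d : ℕ} (Λ : Submodule ℤ (EuclideanSpace ℝ (Fin d))) (ν : ℂ)
    (g : EuclideanSpace ℝ (Fin d) → ℂ) : ℂ :=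
  (∑' z : {z : EuclideanSpace ℝ (Fin d) // z ∈ Λ ∧ z ≠ 0}, quotPow ν g z)
    - (1 / (ZLattice.covolume Λ : ℂ)) * hadamardIntegral ν g

/-- The regularised Hadamard sum-integral of `P(z) / |z|^ν`: the limit as `β ↓ 0` of the Hadamard
sum-integrals of `χ̂_β(z) P(z) / |z|^ν`. -/
def regularisedSumIntegral {d : ℕ} (Λ : Submodule ℤ (EuclideanSpace ℝ (Fin d)))
    (χ : EuclideanSpace ℝ (Fin d) → ℝ) (P : MvPolynomial (Fin d) ℂ) (ν : ℂ) : ℂ :=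
  limUnder (𝓝[>] (0 : ℝ))
    (fun β : ℝ => hadamardSumIntegral Λ ν (fun z => smoothCutoff χ β z * polyFun P z))

/-- The number `(ω_d / V_Λ) (1/2)_k / ((2k)! (d/2)_k) Δ^k P(0)`, where `ω_d` is the surface area of
the unit sphere in `ℝ^d` and `(x)_k` is the rising factorial. -/
def sumIntegralResidue {d : ℕ} (Λ : Submodule ℤ (EuclideanSpace ℝ (Fin d)))
    (P : MvPolynomial (Fin d) ℂ) (k : ℕ) : ℂ :=
  (((volume : Measure (EuclideanSpace ℝ (Fin d))).toSphere.real Set.univ : ℝ) : ℂ)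
      / (ZLattice.covolume Λ : ℂ)
    * ((ascPochhammer ℂ k).eval (1 / 2)
        / (((2 * k).factorial : ℂ) * (ascPochhammer ℂ k).eval ((d : ℂ) / 2)))
    * polyLaplaceAtZero P k

end

/-!
The theorem is proved by real-variable means, without Poisson summation. Three ingredients carry it.

*The defect gains decay.* For a smooth decaying `f`, the difference between the sum of `f` over
`x + Λ` and the integral of `f` per covolume has mean zero in `x` over a fundamental cell, so it is
bounded, through the mean value inequality, by the supremum of the defect of the derivative of
`f`. Iterated, this bounds the defect by the decay of a derivative of any order alone
(`exists_norm_latticeDefect_le_of_iteratedFDeriv`). Away from a ball of radius `c` which contains no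
nonzero lattice point, `|y|^{-ν}` is `w(y)^{-ν/2}` for a smooth positive weight `w`. Each derivative
of the symbol `P w^{-ν/2}` gains a power of `1 + |y|`, and `χ̂_β(y) = U(βy)` for a single Schwartz
function `U` with `U(0) = 1`, so that `U(β·) - 1` is a symbol of order one whose constants
are of size `β`. Hence the defects of `U(β·) P w^{-ν/2}` converge as
`β ↓ 0`, locally uniformly in `ν`, to an entire function
(`exists_differentiable_tendsto_latticeDefect`).

*The ball carries the poles.* What the finite-part integral adds on the ball of radius `c` is, for
`β ↓ 0`, its value at `P`. In polar coordinates it is the finite sum over `k` of the surface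
integral of the homogeneous component of degree `k` of `P`, times the radial primitive
`c^{k+d-ν} / (k+d-ν)`, which has a simple pole at `ν = d + k` and is analytic elsewhere
(`exists_differentiable_tendsto_hadamardSumIntegral`). If `Re ν > d + m`, the integral over the
exterior of the ball cancels these terms, and the limit is the Dirichlet series
(`tendsto_hadamardSumIntegral_of_lt_re`).

*Pizzetti's formula.* The surface integrals are zero in odd degree. In degree `2j` they are
multiples of `Δ^j P(0)` (`polySphereIntegral_two_mul`): by Euler's identity and integration by parts
against a Gaussian, the surface integral of `ΔQ` is `k (k + d - 2)` times that of `Q`, for `Q`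
homogeneous of degree `k ≥ 2`.
-/

noncomputable section

/-! ### Sums minus integrals over a lattice -/

section LatticeBound

variable {d : ℕ} (Λ : Submodule ℤ (EuclideanSpace ℝ (Fin d))) [DiscreteTopology Λ]

/-- Peetre's inequality: translating by `x` changes the weight by a bounded factor. -/
lemma one_add_norm_rpow_neg_le_translate {E : Type*} [NormedAddCommGroup E] {r : ℝ} (hr : 0 ≤ r)
    (x z : E) : (1 + ‖x + z‖) ^ (-r) ≤ (1 + ‖x‖) ^ r * (1 + ‖z‖) ^ (-r) := by
  have hx := norm_nonneg x
  have hz := norm_nonneg z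
  have hxz := norm_nonneg (x + z)
  have h1 : 1 + ‖z‖ ≤ (1 + ‖x‖) * (1 + ‖x + z‖) := by
    have : ‖z‖ ≤ ‖x + z‖ + ‖x‖ := by simpa using norm_sub_le (x + z) x
    nlinarith
  have h2 : (1 + ‖z‖) ^ r ≤ (1 + ‖x‖) ^ r * (1 + ‖x + z‖) ^ r := by
    rw [← Real.mul_rpow (by positivity) (by positivity)]
    exact Real.rpow_le_rpow (by positivity) h1 hr
  rw [Real.rpow_neg (by positivity), Real.rpow_neg (by positivity)]
  have h3 : 0 < (1 + ‖x + z‖) ^ r := by positivity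
  have h4 : 0 < (1 + ‖z‖) ^ r := by positivity
  rw [inv_le_iff_one_le_mul₀ h3]
  calc (1 : ℝ) = (1 + ‖z‖) ^ r * ((1 + ‖z‖) ^ r)⁻¹ := (mul_inv_cancel₀ h4.ne').symm
    _ ≤ ((1 + ‖x‖) ^ r * (1 + ‖x + z‖) ^ r) * ((1 + ‖z‖) ^ r)⁻¹ := by gcongr
    _ = _ := by ring

lemma summable_one_add_norm_rpow [IsZLattice ℝ Λ] {r : ℝ} (hr : (d : ℝ) < r) :
    Summable fun z : Λ => (1 + ‖(z : EuclideanSpace ℝ (Fin d))‖) ^ (-r) := by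
  have hrank : Module.finrank ℤ Λ = d := by
    rw [ZLattice.rank ℝ Λ]; simp
  have h := ZLattice.summable_norm_rpow Λ (-r) (by rw [hrank]; linarith)
  refine Summable.of_norm_bounded_eventually h ?_
  rw [Filter.eventually_cofinite]
  refine (Set.finite_singleton (0 : Λ)).subset ?_
  intro z hz
  by_contra hne
  apply hz
  have hpos : 0 < ‖z‖ := norm_pos_iff.2 hne
  have hd : 0 ≤ (d : ℝ) := Nat.cast_nonneg d
  rw [Real.norm_of_nonneg (by positivity)]
  exact Real.rpow_le_rpow_of_nonpos hpos (by simp) (by linarith)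

lemma summable_one_add_norm_add_rpow [IsZLattice ℝ Λ] {r : ℝ} (hr : (d : ℝ) < r)
    (x : EuclideanSpace ℝ (Fin d)) :
    Summable fun z : Λ => (1 + ‖x + (z : EuclideanSpace ℝ (Fin d))‖) ^ (-r) := by
  have hd : 0 ≤ (d : ℝ) := Nat.cast_nonneg d
  refine Summable.of_nonneg_of_le (fun z => by positivity) (fun z => ?_)
    ((summable_one_add_norm_rpow Λ hr).mul_left ((1 + ‖x‖) ^ r))
  exact one_add_norm_rpow_neg_le_translate (by linarith) x _

/-- A bounded fundamental domain of the lattice. -/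
lemma exists_bounded_fundamentalDomain [IsZLattice ℝ Λ] :
    ∃ (D : Set (EuclideanSpace ℝ (Fin d))) (R : ℝ), 0 < R ∧ (∀ x ∈ D, ‖x‖ ≤ R) ∧
      IsAddFundamentalDomain Λ D (volume : Measure (EuclideanSpace ℝ (Fin d))) ∧
      MeasurableSet D ∧ ∀ x : EuclideanSpace ℝ (Fin d),
        ∃ z : Λ, x + (z : EuclideanSpace ℝ (Fin d)) ∈ D := by
  have : Module.Free ℤ Λ := ZLattice.module_free ℝ Λ
  have : Module.Finite ℤ Λ := ZLattice.module_finite ℝ Λ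
  let b := Module.Free.chooseBasis ℤ Λ
  let B := Module.Basis.ofZLatticeBasis ℝ Λ b
  obtain ⟨R, hR⟩ := (ZSpan.fundamentalDomain_isBounded B).exists_norm_le
  refine ⟨ZSpan.fundamentalDomain B, max R 1, by positivity,
    fun x hx => (hR x hx).trans (le_max_left _ _),
    ZLattice.isAddFundamentalDomain b volume, ZSpan.fundamentalDomain_measurableSet B, fun x => ?_⟩
  obtain ⟨v, hv, -⟩ := ZSpan.exist_unique_vadd_mem_fundamentalDomain B x
  have hv2 : (v : EuclideanSpace ℝ (Fin d)) ∈ Λ := by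
    exact (Module.Basis.ofZLatticeBasis_span ℝ Λ b).le v.2
  refine ⟨⟨v, hv2⟩, ?_⟩
  have h2 : v +ᵥ x = (v : EuclideanSpace ℝ (Fin d)) + x := rfl
  rw [h2, add_comm] at hv
  exact hv

/-- Lattice sums of the weight are bounded uniformly in the shift of the lattice. -/
lemma exists_tsum_one_add_norm_add_rpow_le [IsZLattice ℝ Λ] {r : ℝ} (hr : (d : ℝ) < r) :
    ∃ K : ℝ, 0 ≤ K ∧ ∀ x : EuclideanSpace ℝ (Fin d),
      ∑' z : Λ, (1 + ‖x + (z : EuclideanSpace ℝ (Fin d))‖) ^ (-r) ≤ K := by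
  have hd : 0 ≤ (d : ℝ) := Nat.cast_nonneg d
  -- Translating by a lattice point, the shift may be taken in a bounded fundamental domain.
  obtain ⟨D, R, hR, hD, -, -, hmem⟩ := exists_bounded_fundamentalDomain Λ
  refine ⟨(1 + R) ^ r * ∑' z : Λ, (1 + ‖(z : EuclideanSpace ℝ (Fin d))‖) ^ (-r),
    mul_nonneg (by positivity) (tsum_nonneg fun z => by positivity), fun x => ?_⟩
  obtain ⟨z₀, hz₀⟩ := hmem x
  rw [← (Equiv.addLeft z₀).tsum_eq, ← tsum_mul_left]
  have hs := (summable_one_add_norm_add_rpow Λ hr (x + z₀))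
  refine Summable.tsum_le_tsum (fun z => ?_) (by simpa [add_assoc] using hs)
    ((summable_one_add_norm_rpow Λ hr).mul_left _)
  have := one_add_norm_rpow_neg_le_translate (r := r) (by linarith) (x + z₀)
    (z : EuclideanSpace ℝ (Fin d))
  simp only [Equiv.coe_addLeft, Submodule.coe_add, ← add_assoc]
  refine this.trans ?_
  have := hD _ hz₀
  gcongr
  linarith

/-- The sum of `f` over the shifted lattice `x + Λ` minus the integral of `f` per covolume. -/
def latticeDefect {F : Type*} [NormedAddCommGroup F] [NormedSpace ℝ F]
    (f : EuclideanSpace ℝ (Fin d) → F) (x : EuclideanSpace ℝ (Fin d)) : F :=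
  (∑' z : Λ, f (x + z)) - (ZLattice.covolume Λ)⁻¹ • ∫ y, f y

/-- All derivatives of `f` decay like `(1 + |y|)^{-(d+1)}`, an integrable and lattice summable
rate. -/
def HasDecay {F : Type*} [NormedAddCommGroup F] [NormedSpace ℝ F]
    (f : EuclideanSpace ℝ (Fin d) → F) : Prop :=
  ContDiff ℝ ∞ f ∧ ∀ j : ℕ, ∃ C : ℝ, ∀ y, ‖iteratedFDeriv ℝ j f y‖ ≤ C * (1 + ‖y‖) ^ (-(d + 1 : ℝ))

section

variable {F : Type*} [NormedAddCommGroup F] [NormedSpace ℝ F] {f : EuclideanSpace ℝ (Fin d) → F}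

lemma HasDecay.fderiv (hf : HasDecay f) : HasDecay (fderiv ℝ f) := by
  refine ⟨hf.1.fderiv_right (by simp), fun j => ?_⟩
  obtain ⟨C, hC⟩ := hf.2 (j + 1)
  exact ⟨C, fun y => by rw [norm_iteratedFDeriv_fderiv]; exact hC y⟩

lemma HasDecay.exists_norm_le (hf : HasDecay f) :
    ∃ C : ℝ, ∀ y, ‖f y‖ ≤ C * (1 + ‖y‖) ^ (-(d + 1 : ℝ)) := by
  obtain ⟨C, hC⟩ := hf.2 0
  exact ⟨C, fun y => by simpa using hC y⟩

lemma integrable_decay_weight :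
    Integrable (fun y : EuclideanSpace ℝ (Fin d) => (1 + ‖y‖) ^ (-(d + 1 : ℝ))) :=
  integrable_one_add_norm (by simp)

lemma HasDecay.integrable (hf : HasDecay f) : Integrable f := by
  obtain ⟨C, hC⟩ := hf.exists_norm_le
  exact (integrable_decay_weight.const_mul C).mono' hf.1.continuous.aestronglyMeasurable
    (ae_of_all _ hC)

lemma HasDecay.summable [CompleteSpace F] [IsZLattice ℝ Λ] (hf : HasDecay f)
    (x : EuclideanSpace ℝ (Fin d)) : Summable fun z : Λ => f (x + z) := by
  obtain ⟨C, hC⟩ := hf.exists_norm_le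
  exact Summable.of_norm_bounded
    ((summable_one_add_norm_add_rpow Λ (r := d + 1) (by simp) x).mul_left C) (fun z => hC _)

lemma HasDecay.integral_fderiv [CompleteSpace F] (hf : HasDecay f) :
    ∫ y, _root_.fderiv ℝ f y = 0 := by
  ext v
  rw [ContinuousLinearMap.integral_apply hf.fderiv.integrable]
  have h1 : Integrable fun y => _root_.fderiv ℝ f y v :=
    hf.fderiv.integrable.apply_continuousLinearMap v
  have := integral_bilinear_hasFDerivAt_right_eq_neg_left_of_integrable
    (μ := (volume : Measure (EuclideanSpace ℝ (Fin d)))) (f := fun _ => (1 : ℝ)) (f' := fun _ => 0)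
    (g := f) (g' := _root_.fderiv ℝ f) (v := v) (B := ContinuousLinearMap.lsmul ℝ ℝ)
    (by simp) (by simpa using h1) (by simpa using hf.integrable)
    (fun x _ => hasFDerivAt_const _ _)
    (fun x _ => (hf.1.differentiable (by simp)).differentiableAt.hasFDerivAt)
  simpa using this

/-- The integral of the derivative is zero, so the derivative of the defect is the defect of the
derivative. -/
lemma HasDecay.hasFDerivAt_latticeDefect [CompleteSpace F] [IsZLattice ℝ Λ] (hf : HasDecay f)
    (x : EuclideanSpace ℝ (Fin d)) :
    HasFDerivAt (latticeDefect Λ f) (latticeDefect Λ (_root_.fderiv ℝ f) x) x := by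
  obtain ⟨C, hC⟩ := hf.fderiv.exists_norm_le
  have hC0 : 0 ≤ C := by
    have := (norm_nonneg _).trans (hC 0)
    simpa using this
  have hd : 0 ≤ (d : ℝ) := Nat.cast_nonneg d
  have key : ∀ y ∈ Metric.ball x 1,
      HasFDerivAt (fun y => ∑' z : Λ, f (y + z)) (∑' z : Λ, _root_.fderiv ℝ f (y + z)) y := by
    intro y hy
    refine hasFDerivAt_tsum_of_isPreconnected (𝕜 := ℝ) (x₀ := x) (s := Metric.ball x 1)
      (f := fun (z : Λ) y => f (y + z)) (f' := fun (z : Λ) y => _root_.fderiv ℝ f (y + z))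
      (u := fun z : Λ => C * ((2 : ℝ) ^ (d + 1 : ℝ) *
        (1 + ‖x + (z : EuclideanSpace ℝ (Fin d))‖) ^ (-(d + 1 : ℝ))))
      (((summable_one_add_norm_add_rpow Λ (r := d + 1) (by simp) x).mul_left _).mul_left _)
      Metric.isOpen_ball (convex_ball x 1).isPreconnected ?_ ?_ (Metric.mem_ball_self one_pos)
      (hf.summable Λ x) hy
    · intro z w _
      exact (hasFDerivAt_comp_add_right _).2
        ((hf.1.differentiable (by simp)).differentiableAt.hasFDerivAt)
    · intro z w hw
      refine (hC _).trans ?_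
      have h := one_add_norm_rpow_neg_le_translate (r := (d : ℝ) + 1) (by linarith) (w - x)
        (x + (z : EuclideanSpace ℝ (Fin d)))
      rw [show w - x + (x + (z : EuclideanSpace ℝ (Fin d))) = w + z by abel] at h
      have h2 : ‖w - x‖ ≤ 1 := by
        rw [← dist_eq_norm]; exact (Metric.mem_ball.1 hw).le
      refine mul_le_mul_of_nonneg_left (h.trans ?_) hC0
      gcongr
      linarith
  have h := (key x (Metric.mem_ball_self one_pos)).sub_const
    ((ZLattice.covolume Λ)⁻¹ • ∫ y, f y)
  have h2 : latticeDefect Λ (_root_.fderiv ℝ f) x = ∑' z : Λ, _root_.fderiv ℝ f (x + z) := by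
    simp [latticeDefect, hf.integral_fderiv]
  rw [h2]
  exact h

omit [DiscreteTopology Λ] in
lemma latticeDefect_add_mem (f : EuclideanSpace ℝ (Fin d) → F) (x : EuclideanSpace ℝ (Fin d))
    (z₀ : Λ) : latticeDefect Λ f (x + z₀) = latticeDefect Λ f x := by
  unfold latticeDefect
  rw [← (Equiv.addLeft z₀).tsum_eq (fun z : Λ => f (x + z))]
  simp [add_assoc]

/-- The defect has mean zero over a fundamental domain. -/
lemma HasDecay.integral_latticeDefect [CompleteSpace F] [IsZLattice ℝ Λ] (hf : HasDecay f)
    {D : Set (EuclideanSpace ℝ (Fin d))} {R : ℝ} (hDR : ∀ x ∈ D, ‖x‖ ≤ R)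
    (hD : IsAddFundamentalDomain Λ D (volume : Measure (EuclideanSpace ℝ (Fin d))))
    (hDm : MeasurableSet D) :
    ∫ x in D, latticeDefect Λ f x = 0 := by
  have hfin : volume D ≠ ⊤ := by
    refine ne_top_of_le_ne_top (measure_closedBall_lt_top (x := (0 : EuclideanSpace ℝ (Fin d)))
      (r := R)).ne (measure_mono fun x hx => ?_)
    simpa using hDR x hx
  have : IsFiniteMeasure (volume.restrict D) := ⟨by simpa using hfin.lt_top⟩
  have : Countable Λ := countable_of_Lindelof_of_discrete
  have : VAddInvariantMeasure Λ (EuclideanSpace ℝ (Fin d)) volume :=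
    ⟨fun c s _ => measure_preimage_add _ _ _⟩
  obtain ⟨C, hC⟩ := hf.exists_norm_le
  have hd : 0 ≤ (d : ℝ) := Nat.cast_nonneg d
  have hC0 : 0 ≤ C := by
    have := (norm_nonneg _).trans (hC 0)
    simpa using this
  have hint : ∀ z : Λ, IntegrableOn (fun x => f (x + z)) D := fun z =>
    (hf.integrable.comp_add_right _).integrableOn
  have hbd : ∀ z : Λ, ∀ x ∈ D, ‖f (x + z)‖ ≤
      C * ((1 + |R|) ^ (d + 1 : ℝ) * (1 + ‖(z : EuclideanSpace ℝ (Fin d))‖) ^ (-(d + 1 : ℝ))) := by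
    intro z x hx
    refine (hC _).trans ?_
    have h := one_add_norm_rpow_neg_le_translate (r := (d : ℝ) + 1) (by linarith) x
        (z : EuclideanSpace ℝ (Fin d))
    refine mul_le_mul_of_nonneg_left (h.trans ?_) hC0
    have := (hDR x hx).trans (le_abs_self R)
    gcongr
  have hsum : HasSum (fun z : Λ => ∫ x in D, f (x + z)) (∫ x in D, ∑' z : Λ, f (x + z)) := by
    refine hasSum_integral_of_summable_integral_norm hint ?_
    refine Summable.of_nonneg_of_le (fun z => integral_nonneg fun x => norm_nonneg _) (fun z => ?_)
      (((summable_one_add_norm_rpow Λ (r := d + 1) (by simp)).mul_left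
        ((1 + |R|) ^ (d + 1 : ℝ))).mul_left (volume.real D * C))
    · have := setIntegral_mono_on (hint z).norm (integrableOn_const hfin) hDm (hbd z)
      refine this.trans (le_of_eq ?_)
      rw [setIntegral_const]
      simp only [smul_eq_mul]; ring
  have hcont : Continuous (latticeDefect Λ f) := by
    have : Differentiable ℝ (latticeDefect Λ f) :=
      fun x => (hf.hasFDerivAt_latticeDefect Λ x).differentiableAt
    exact this.continuous
  have hcont2 : Continuous fun x => ∑' z : Λ, f (x + z) := by
    have := hcont.add (continuous_const (y := (ZLattice.covolume Λ)⁻¹ • ∫ y, f y))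
    refine this.congr fun x => ?_
    simp [latticeDefect]
  have hS : IntegrableOn (fun x => ∑' z : Λ, f (x + z)) D := by
    refine IntegrableOn.mono_set (t := Metric.closedBall 0 R) ?_
      (fun x hx => by simpa using hDR x hx)
    exact hcont2.continuousOn.integrableOn_compact (isCompact_closedBall _ _)
  have hfund := hD.integral_eq_tsum'' f hf.integrable
  have hvol := ZLattice.covolume_eq_measure_fundamentalDomain Λ volume hD
  have hne := ZLattice.covolume_ne_zero Λ (volume : Measure (EuclideanSpace ℝ (Fin d)))
  unfold latticeDefect
  rw [integral_sub hS (integrableOn_const hfin), setIntegral_const, ← hsum.tsum_eq, hfund, ← hvol,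
    smul_smul, mul_inv_cancel₀ hne, one_smul, sub_eq_zero]
  refine tsum_congr fun z => ?_
  refine integral_congr_ae (ae_of_all _ fun x => ?_)
  simp only
  rw [add_comm]; rfl

/-- One derivative is gained: the defect has mean zero over a cell, so it is bounded by the
oscillation over a cell, that is by the defect of the derivative. -/
lemma HasDecay.norm_latticeDefect_le_of_fderiv [CompleteSpace F] [IsZLattice ℝ Λ] (hf : HasDecay f)
    {D : Set (EuclideanSpace ℝ (Fin d))} {R : ℝ} (hDR : ∀ x ∈ D, ‖x‖ ≤ R)
    (hD : IsAddFundamentalDomain Λ D (volume : Measure (EuclideanSpace ℝ (Fin d))))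
    (hDm : MeasurableSet D)
    (hmem : ∀ x : EuclideanSpace ℝ (Fin d), ∃ z : Λ, x + (z : EuclideanSpace ℝ (Fin d)) ∈ D) {B : ℝ}
    (hB : ∀ x, ‖latticeDefect Λ (_root_.fderiv ℝ f) x‖ ≤ B) (x : EuclideanSpace ℝ (Fin d)) :
    ‖latticeDefect Λ f x‖ ≤ 2 * R * B := by
  wlog hx : x ∈ D generalizing x
  · obtain ⟨z, hz⟩ := hmem x
    rw [← latticeDefect_add_mem Λ f x z]
    exact this _ hz
  have hB0 : 0 ≤ B := (norm_nonneg _).trans (hB 0)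
  have hosc : ∀ y ∈ D, ‖latticeDefect Λ f x - latticeDefect Λ f y‖ ≤ 2 * R * B := by
    intro y hy
    have := Convex.norm_image_sub_le_of_norm_hasFDerivWithin_le (𝕜 := ℝ) (s := Set.univ)
      (f := latticeDefect Λ f) (x := y) (y := x)
      (fun w _ => (hf.hasFDerivAt_latticeDefect Λ w).hasFDerivWithinAt)
      (fun w _ => hB w) convex_univ trivial trivial
    refine this.trans ?_
    have h1 : ‖x - y‖ ≤ 2 * R := (norm_sub_le x y).trans (by linarith [hDR x hx, hDR y hy])
    nlinarith
  have hfin : volume D ≠ ⊤ := by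
    refine ne_top_of_le_ne_top (measure_closedBall_lt_top (x := (0 : EuclideanSpace ℝ (Fin d)))
      (r := R)).ne (measure_mono fun x hx => ?_)
    simpa using hDR x hx
  have hcont : Continuous (latticeDefect Λ f) := by
    have : Differentiable ℝ (latticeDefect Λ f) :=
      fun x => (hf.hasFDerivAt_latticeDefect Λ x).differentiableAt
    exact this.continuous
  have hI : IntegrableOn (latticeDefect Λ f) D := by
    refine IntegrableOn.mono_set (t := Metric.closedBall 0 R) ?_
      (fun x hx => by simpa using hDR x hx)
    exact hcont.continuousOn.integrableOn_compact (isCompact_closedBall _ _)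
  have hvol := ZLattice.covolume_eq_measure_fundamentalDomain Λ volume hD
  have hpos : 0 < volume.real D := hvol ▸ ZLattice.covolume_pos Λ volume
  have hconst : IntegrableOn (fun _ => latticeDefect Λ f x) D :=
    integrableOn_const hfin enorm_ne_top
  have h1 : volume.real D • latticeDefect Λ f x =
      ∫ y in D, (latticeDefect Λ f x - latticeDefect Λ f y) := by
    rw [integral_sub hconst hI, setIntegral_const,
      hf.integral_latticeDefect Λ hDR hD hDm, sub_zero]
  have h2 : ‖volume.real D • latticeDefect Λ f x‖ ≤ (2 * R * B) * volume.real D := by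
    rw [h1]
    exact norm_setIntegral_le_of_norm_le_const hfin.lt_top hosc
  rw [norm_smul, Real.norm_of_nonneg hpos.le] at h2
  nlinarith

end

/-- The defect is controlled by the derivative of any fixed order. The target space is quantified
inside, since the induction passes from `f` to its derivative. -/
lemma exists_norm_latticeDefect_le_of_iteratedFDeriv [IsZLattice ℝ Λ] (N : ℕ) :
    ∃ K : ℝ, 0 ≤ K ∧ ∀ (F : Type) [NormedAddCommGroup F] [NormedSpace ℝ F] [CompleteSpace F]
      (f : EuclideanSpace ℝ (Fin d) → F), HasDecay f → ∀ A : ℝ,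
      (∀ y, ‖iteratedFDeriv ℝ N f y‖ ≤ A * (1 + ‖y‖) ^ (-(d + 1 : ℝ))) →
      ∀ x, ‖latticeDefect Λ f x‖ ≤ K * A := by
  obtain ⟨D, R, hR, hDR, hD, hDm, hmem⟩ := exists_bounded_fundamentalDomain Λ
  induction N with
  | zero =>
    obtain ⟨K, hK0, hK⟩ := exists_tsum_one_add_norm_add_rpow_le Λ (r := (d : ℝ) + 1) (by simp)
    have hcov := ZLattice.covolume_pos Λ (volume : Measure (EuclideanSpace ℝ (Fin d)))
    have hI0 : 0 ≤ ∫ y : EuclideanSpace ℝ (Fin d), (1 + ‖y‖) ^ (-(d + 1 : ℝ)) :=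
      integral_nonneg fun y => by positivity
    refine ⟨K + (ZLattice.covolume Λ)⁻¹ *
      ∫ y : EuclideanSpace ℝ (Fin d), (1 + ‖y‖) ^ (-(d + 1 : ℝ)), by positivity, ?_⟩
    intro F _ _ _ f hf A hA x
    simp only [norm_iteratedFDeriv_zero] at hA
    have hA0 : 0 ≤ A := by
      have := (norm_nonneg _).trans (hA 0)
      simpa using this
    have hs := (summable_one_add_norm_add_rpow Λ (r := (d : ℝ) + 1) (by simp) x)
    have h1 : ‖∑' z : Λ, f (x + z)‖ ≤ A * K := by
      refine (tsum_of_norm_bounded (hs.mul_left A).hasSum (fun z => hA _)).trans ?_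
      rw [tsum_mul_left]
      exact mul_le_mul_of_nonneg_left (hK x) hA0
    have h2 : ‖∫ y, f y‖ ≤ A * ∫ y : EuclideanSpace ℝ (Fin d), (1 + ‖y‖) ^ (-(d + 1 : ℝ)) := by
      rw [← integral_const_mul]
      exact norm_integral_le_of_norm_le (integrable_decay_weight.const_mul A) (ae_of_all _ hA)
    unfold latticeDefect
    refine (norm_sub_le _ _).trans ?_
    rw [norm_smul, Real.norm_of_nonneg (by positivity)]
    have h3 := mul_le_mul_of_nonneg_left h2 (inv_nonneg.2 hcov.le)
    calc _ ≤ A * K + (ZLattice.covolume Λ)⁻¹ *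
          (A * ∫ y : EuclideanSpace ℝ (Fin d), (1 + ‖y‖) ^ (-(d + 1 : ℝ))) := add_le_add h1 h3
      _ = _ := by ring
  | succ N ih =>
    obtain ⟨K, hK0, hK⟩ := ih
    refine ⟨2 * R * K, by positivity, ?_⟩
    intro F _ _ _ f hf A hA x
    have h := hK _ (fderiv ℝ f) hf.fderiv A
      (fun y => by rw [norm_iteratedFDeriv_fderiv]; exact hA y)
    have := hf.norm_latticeDefect_le_of_fderiv Λ hDR hD hDm hmem h x
    linarith [this]

end LatticeBound

/-! ### Symbol estimates -/

section Symbols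

variable {E F : Type*} [NormedAddCommGroup E] [NormedSpace ℝ E]
  [NormedAddCommGroup F] [NormedSpace ℝ F]

/-- `f` is a symbol of order `a`, with explicit constants: every derivative gains one power of
`1 + |y|`. -/
def IsSymbol (f : E → F) (a : ℝ) (C : ℕ → ℝ) : Prop :=
  ContDiff ℝ ∞ f ∧ ∀ (j : ℕ) (y : E), ‖iteratedFDeriv ℝ j f y‖ ≤ C j * (1 + ‖y‖) ^ (a - j)

/-- The constants that Leibniz' rule gives for a product of symbols. -/
def leibnizConst (C D : ℕ → ℝ) (n : ℕ) : ℝ :=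
  ∑ i ∈ Finset.range (n + 1), (n.choose i : ℝ) * C i * D (n - i)

lemma leibnizConst_mul_left (t : ℝ) (C D : ℕ → ℝ) :
    leibnizConst (fun j => t * C j) D = fun j => t * leibnizConst C D j := by
  funext n
  simp only [leibnizConst, Finset.mul_sum]
  exact Finset.sum_congr rfl fun i _ => by ring

namespace IsSymbol

lemma const_nonneg {f : E → F} {a : ℝ} {C : ℕ → ℝ} (hf : IsSymbol f a C) (j : ℕ) : 0 ≤ C j := by
  have := (norm_nonneg _).trans (hf.2 j 0)
  simpa using this

lemma norm_le {f : E → F} {a : ℝ} {C : ℕ → ℝ} (hf : IsSymbol f a C) (y : E) :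
    ‖f y‖ ≤ C 0 * (1 + ‖y‖) ^ a := by
  simpa using hf.2 0 y

lemma mono {f : E → F} {a b : ℝ} {C D : ℕ → ℝ} (hf : IsSymbol f a C) (hab : a ≤ b)
    (hCD : ∀ j, C j ≤ D j) : IsSymbol f b D := by
  refine ⟨hf.1, fun j y => (hf.2 j y).trans ?_⟩
  refine mul_le_mul (hCD j) ?_ (by positivity) ((hf.const_nonneg j).trans (hCD j))
  exact Real.rpow_le_rpow_of_exponent_le (by simp) (by linarith)

lemma add {f g : E → F} {a : ℝ} {C D : ℕ → ℝ} (hf : IsSymbol f a C) (hg : IsSymbol g a D) :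
    IsSymbol (fun y => f y + g y) a (fun j => C j + D j) := by
  refine ⟨hf.1.add hg.1, fun j y => ?_⟩
  have h := fun_iteratedFDeriv_add_apply (𝕜 := ℝ) (i := j) (x := y)
    (hf.1.of_le (mod_cast le_top)).contDiffAt (hg.1.of_le (mod_cast le_top)).contDiffAt
  rw [h, add_mul]
  exact (norm_add_le _ _).trans (add_le_add (hf.2 j y) (hg.2 j y))

lemma neg {f : E → F} {a : ℝ} {C : ℕ → ℝ} (hf : IsSymbol f a C) :
    IsSymbol (fun y => -f y) a C := by
  refine ⟨hf.1.neg, fun j y => ?_⟩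
  have h : iteratedFDeriv ℝ j (fun y => -f y) y = - iteratedFDeriv ℝ j f y :=
    iteratedFDeriv_neg_apply
  rw [h, norm_neg]
  exact hf.2 j y

lemma smul {f : E → ℂ} {g : E → F} [NormedSpace ℂ F] [IsScalarTower ℝ ℂ F] {a b : ℝ}
    {C D : ℕ → ℝ} (hf : IsSymbol f a C) (hg : IsSymbol g b D) :
    IsSymbol (fun y => f y • g y) (a + b) (leibnizConst C D) := by
  refine ⟨hf.1.smul hg.1, fun n y => ?_⟩
  refine (norm_iteratedFDeriv_smul_le (hf.1.of_le (m := (n : ℕ∞ω)) (mod_cast le_top))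
    (hg.1.of_le (mod_cast le_top)) y le_rfl).trans ?_
  rw [leibnizConst, Finset.sum_mul]
  refine Finset.sum_le_sum fun i hi => ?_
  have hin : i ≤ n := Nat.lt_succ_iff.1 (Finset.mem_range.1 hi)
  have hy : 0 < 1 + ‖y‖ := by positivity
  have h1 := hf.2 i y
  have h2 := hg.2 (n - i) y
  have h3 := hf.const_nonneg i
  have h4 := hg.const_nonneg (n - i)
  calc _ ≤ (n.choose i : ℝ) * (C i * (1 + ‖y‖) ^ (a - i)) *
        (D (n - i) * (1 + ‖y‖) ^ (b - (n - i : ℕ))) := by gcongr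
    _ = (n.choose i : ℝ) * C i * D (n - i) *
        ((1 + ‖y‖) ^ (a - i) * (1 + ‖y‖) ^ (b - (n - i : ℕ))) := by ring
    _ = _ := by
        rw [← Real.rpow_add hy, Nat.cast_sub hin]
        congr 2; ring

lemma mul {f g : E → ℂ} {a b : ℝ} {C D : ℕ → ℝ} (hf : IsSymbol f a C) (hg : IsSymbol g b D) :
    IsSymbol (fun y => f y * g y) (a + b) (leibnizConst C D) :=
  hf.smul hg

lemma const (c : F) : IsSymbol (fun _ : E => c) 0 (fun _ => ‖c‖) := by
  refine ⟨contDiff_const, fun j y => ?_⟩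
  cases j with
  | zero => simp
  | succ j =>
    rw [iteratedFDeriv_succ_const]
    simp only [Pi.zero_apply, norm_zero]
    positivity

lemma fderiv {f : E → F} {a : ℝ} {C : ℕ → ℝ} (hf : IsSymbol f a C) :
    IsSymbol (fderiv ℝ f) (a - 1) (fun j => C (j + 1)) := by
  refine ⟨hf.1.fderiv_right (by simp), fun j y => ?_⟩
  rw [norm_iteratedFDeriv_fderiv]
  refine (hf.2 (j + 1) y).trans (le_of_eq ?_)
  push_cast
  congr 2; ring

lemma continuousLinearMap (L : E →L[ℝ] F) : IsSymbol L 1 (fun _ => ‖L‖) := by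
  refine ⟨L.contDiff, fun j y => ?_⟩
  match j with
  | 0 =>
    rw [norm_iteratedFDeriv_zero]
    refine (L.le_opNorm y).trans ?_
    simp only [Nat.cast_zero, sub_zero, Real.rpow_one]
    gcongr
    linarith
  | 1 =>
    rw [← norm_fderiv_iteratedFDeriv, ← zero_add 1]
    rw [norm_fderiv_iteratedFDeriv, ← norm_iteratedFDeriv_fderiv, norm_iteratedFDeriv_zero]
    simp
  | j + 2 =>
    rw [← norm_iteratedFDeriv_fderiv, show _root_.fderiv ℝ L = fun _ => L from
      funext fun x => L.fderiv, iteratedFDeriv_succ_const]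
    simp only [Pi.zero_apply, norm_zero]
    positivity

end IsSymbol

/-- A Schwartz function is a symbol of every order. -/
lemma SchwartzMap.exists_isSymbol (f : SchwartzMap E F) (a : ℝ) : ∃ C, IsSymbol f a C := by
  have h : ∀ j : ℕ, ∃ C : ℝ, ∀ y, ‖iteratedFDeriv ℝ j f y‖ ≤ C * (1 + ‖y‖) ^ (a - j) := by
    intro j
    -- An exponent large enough to absorb the weight `(1 + ‖y‖) ^ (j - a)`.
    set k : ℕ := ⌈|a|⌉₊ + j
    refine ⟨2 ^ k * (Finset.Iic (k, j)).sup (fun m => SchwartzMap.seminorm ℝ m.1 m.2) f,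
      fun y => ?_⟩
    have h := SchwartzMap.one_add_le_sup_seminorm_apply (𝕜 := ℝ) (m := (k, j)) (k := k) (n := j)
      le_rfl le_rfl f y
    have hy : 0 < 1 + ‖y‖ := by positivity
    have h2 : (1 + ‖y‖) ^ ((j : ℝ) - a) ≤ (1 + ‖y‖) ^ k := by
      rw [← Real.rpow_natCast]
      refine Real.rpow_le_rpow_of_exponent_le (by simp) ?_
      simp only [k]
      push_cast
      linarith [Nat.le_ceil |a|, neg_abs_le a]
    have h3 : (1 + ‖y‖) ^ ((j : ℝ) - a) * ‖iteratedFDeriv ℝ j f y‖ ≤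
        2 ^ k * (Finset.Iic (k, j)).sup (fun m => SchwartzMap.seminorm ℝ m.1 m.2) f :=
      (mul_le_mul_of_nonneg_right h2 (norm_nonneg _)).trans h
    rw [show a - (j : ℝ) = -((j : ℝ) - a) by ring, Real.rpow_neg hy.le, ← div_eq_mul_inv,
      le_div_iff₀ (by positivity), mul_comm]
    exact h3
  choose C hC using h
  exact ⟨C, f.smooth ⊤, hC⟩

lemma exists_isSymbol_of_hasCompactSupport {f : E → F} (hf : ContDiff ℝ ∞ f)
    (hs : HasCompactSupport f) (a : ℝ) : ∃ C, IsSymbol f a C :=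
  (hs.toSchwartzMap hf).exists_isSymbol a

section Dilation

variable (U : SchwartzMap E ℂ)

lemma exists_isSymbol_dilation {β : ℝ} (hβ : 0 < β) (a : ℝ) :
    ∃ C, IsSymbol (fun y => U (β • y)) a C := by
  obtain ⟨C, hC⟩ := (SchwartzMap.compCLMOfContinuousLinearEquiv ℝ
    (ContinuousLinearEquiv.smulLeft (R₁ := ℝ) (M₁ := E) (Units.mk0 β hβ.ne')) U).exists_isSymbol a
  exact ⟨C, hC⟩

/-- Dilations `U(β ·)` converge to `U(0)` as symbols of order one, at rate `β`. -/
lemma exists_isSymbol_dilation_sub :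
    ∃ C : ℕ → ℝ, ∀ β : ℝ, 0 < β → β ≤ 1 →
      IsSymbol (fun y => U (β • y) - U 0) 1 (fun j => β * C j) := by
  have hzero : ∃ L : ℝ, ∀ y, ‖U y - U 0‖ ≤ L * ‖y‖ := by
    obtain ⟨C, hC⟩ := U.exists_isSymbol 1
    refine ⟨C 1, fun y => ?_⟩
    have := Convex.norm_image_sub_le_of_norm_hasFDerivWithin_le (𝕜 := ℝ) (s := Set.univ)
      (f := U) (x := 0) (y := y) (C := C 1) (f' := _root_.fderiv ℝ U)
      (fun w _ => (U.differentiable.differentiableAt.hasFDerivAt).hasFDerivWithinAt)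
      (fun w _ => by
        have := hC.2 1 w
        rw [← zero_add 1, ← norm_iteratedFDeriv_fderiv] at this
        simpa using this) convex_univ trivial trivial
    simpa using this
  obtain ⟨L, hL⟩ := hzero
  obtain ⟨C, hC⟩ := U.exists_isSymbol 1
  refine ⟨fun j => if j = 0 then |L| else C j, fun β hβ hβ1 => ⟨?_, fun j y => ?_⟩⟩
  · exact ((U.smooth ⊤).comp (contDiff_const_smul β)).sub contDiff_const
  cases j with
  | zero =>
    simp only [norm_iteratedFDeriv_zero, if_true, Nat.cast_zero, sub_zero, Real.rpow_one]
    refine (hL _).trans ?_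
    rw [norm_smul, Real.norm_of_nonneg hβ.le]
    calc L * (β * ‖y‖) ≤ |L| * (β * (1 + ‖y‖)) := by
          gcongr
          · exact le_abs_self L
          · linarith
      _ = _ := by ring
  | succ j =>
    have hsm : ContDiff ℝ (j + 1 : ℕ) U := (U.smooth ⊤).of_le (mod_cast le_top)
    have h1 : iteratedFDeriv ℝ (j + 1) (fun y => U (β • y) - U 0) y =
        β ^ (j + 1) • iteratedFDeriv ℝ (j + 1) U (β • y) := by
      have hsm2 : ContDiff ℝ (j + 1 : ℕ) fun y => U (β • y) := hsm.comp (contDiff_const_smul β)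
      rw [fun_iteratedFDeriv_sub_apply hsm2.contDiffAt contDiff_const.contDiffAt,
        iteratedFDeriv_succ_const, iteratedFDeriv_comp_const_smul β hsm]
      simp
    rw [h1, norm_smul, Real.norm_of_nonneg (by positivity)]
    simp only [Nat.add_eq_zero_iff, one_ne_zero, and_false, if_false]
    have h2 := hC.2 (j + 1) (β • y)
    have hCn := hC.const_nonneg (j + 1)
    -- `β ≤ 1` gives `β (1 + ‖y‖) ≤ 1 + ‖β y‖`: of the `j + 1` factors `β`, one remains.
    have h3 : (1 + ‖β • y‖) ^ ((1 : ℝ) - (j + 1 : ℕ)) ≤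
        (β ^ j)⁻¹ * (1 + ‖y‖) ^ ((1 : ℝ) - (j + 1 : ℕ)) := by
      have hexp : (1 : ℝ) - (j + 1 : ℕ) = -(j : ℝ) := by push_cast; ring
      rw [hexp, Real.rpow_neg (by positivity), Real.rpow_neg (by positivity), Real.rpow_natCast,
        Real.rpow_natCast, ← mul_inv, ← mul_pow]
      rw [norm_smul, Real.norm_of_nonneg hβ.le]
      gcongr
      nlinarith
    calc β ^ (j + 1) * ‖iteratedFDeriv ℝ (j + 1) U (β • y)‖
        ≤ β ^ (j + 1) * (C (j + 1) * ((β ^ j)⁻¹ * (1 + ‖y‖) ^ ((1 : ℝ) - (j + 1 : ℕ)))) := by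
          gcongr
          exact h2.trans (mul_le_mul_of_nonneg_left h3 hCn)
      _ = _ := by
          field_simp
          ring

end Dilation

end Symbols

section PolySymbol

variable {d : ℕ}

lemma polyFun_C (a : ℂ) : polyFun (d := d) (MvPolynomial.C a) = fun _ => a := by
  funext y; simp [polyFun]

lemma polyFun_add (p q : MvPolynomial (Fin d) ℂ) :
    polyFun (p + q) = fun y => polyFun p y + polyFun q y := by
  funext y; simp [polyFun]

lemma polyFun_mul (p q : MvPolynomial (Fin d) ℂ) :
    polyFun (p * q) = fun y => polyFun p y * polyFun q y := by
  funext y; simp [polyFun]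

lemma polyFun_X (i : Fin d) : polyFun (MvPolynomial.X i) = fun y => (y i : ℂ) := by
  funext y; simp [polyFun]

lemma contDiff_polyFun (P : MvPolynomial (Fin d) ℂ) {n : ℕ∞ω} : ContDiff ℝ n (polyFun P) := by
  have hX : ∀ i : Fin d, ContDiff ℝ n (fun y : EuclideanSpace ℝ (Fin d) => (y i : ℂ)) := fun i =>
    (Complex.ofRealCLM.comp (EuclideanSpace.proj (𝕜 := ℝ) i)).contDiff
  induction P using MvPolynomial.induction_on with
  | C a => rw [polyFun_C]; exact contDiff_const
  | add p q hp hq => rw [polyFun_add]; exact hp.add hq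
  | mul_X p i hp => rw [polyFun_mul, polyFun_X]; exact hp.mul (hX i)

lemma isSymbol_coord (i : Fin d) : ∃ C,
    IsSymbol (fun y : EuclideanSpace ℝ (Fin d) => (y i : ℂ)) 1 C :=
  ⟨_, IsSymbol.continuousLinearMap (Complex.ofRealCLM.comp (EuclideanSpace.proj (𝕜 := ℝ) i))⟩

lemma exists_isSymbol_polyFun (P : MvPolynomial (Fin d) ℂ) :
    ∃ (a : ℝ) (C : ℕ → ℝ), IsSymbol (polyFun P) a C := by
  induction P using MvPolynomial.induction_on with
  | C a => exact ⟨0, _, by rw [polyFun_C]; exact IsSymbol.const a⟩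
  | add p q hp hq =>
    obtain ⟨a, C, hC⟩ := hp
    obtain ⟨b, D, hD⟩ := hq
    refine ⟨max a b, fun j => C j + D j, ?_⟩
    have := (hC.mono (le_max_left a b) fun _ => le_rfl).add
      (hD.mono (le_max_right a b) fun _ => le_rfl)
    rw [polyFun_add]; exact this
  | mul_X p i hp =>
    obtain ⟨a, C, hC⟩ := hp
    obtain ⟨D, hD⟩ := isSymbol_coord i
    exact ⟨a + 1, _, by rw [polyFun_mul, polyFun_X]; exact hC.mul hD⟩

lemma exists_norm_polyFun_le (P : MvPolynomial (Fin d) ℂ) :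
    ∃ C : ℝ, 0 ≤ C ∧ ∀ y, ‖polyFun P y‖ ≤ C * (1 + ‖y‖) ^ P.totalDegree := by
  refine ⟨∑ s ∈ P.support, ‖P.coeff s‖, Finset.sum_nonneg fun _ _ => norm_nonneg _, fun y => ?_⟩
  rw [polyFun, MvPolynomial.eval_eq, Finset.sum_mul]
  refine (norm_sum_le _ _).trans (Finset.sum_le_sum fun s hs => ?_)
  rw [norm_mul, norm_prod]
  refine mul_le_mul_of_nonneg_left ?_ (norm_nonneg _)
  calc ∏ i ∈ s.support, ‖((y i : ℝ) : ℂ) ^ s i‖ ≤ ∏ i ∈ s.support, (1 + ‖y‖) ^ s i := by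
        refine Finset.prod_le_prod (fun _ _ => norm_nonneg _) fun i _ => ?_
        rw [norm_pow, Complex.norm_real]
        gcongr
        have := PiLp.norm_apply_le y i
        linarith
    _ = (1 + ‖y‖) ^ (∑ i ∈ s.support, s i) := by rw [Finset.prod_pow_eq_pow_sum]
    _ ≤ _ := pow_le_pow_right₀ (by simp) (MvPolynomial.le_totalDegree hs)

end PolySymbol

/-! ### The regularised weight and its complex powers -/

section Weight

variable {d : ℕ}

/-- `w` is a smooth positive function that agrees with `|y|²` for `|y| ≥ c`, and is a symbol of
order `2`, bounded below by a multiple of `(1 + |y|)²`, normalised at the origin. Its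
power `w ^ (-ν / 2)` is `|y|^{-ν}` with the singularity at the origin removed. -/
structure IsWeight (c : ℝ) (w : EuclideanSpace ℝ (Fin d) → ℝ) : Prop where
  map_zero : w 0 = 1
  eq_norm_sq : ∀ y, c ≤ ‖y‖ → w y = ‖y‖ ^ 2
  lower : ∃ κ : ℝ, 0 < κ ∧ ∀ y, κ * (1 + ‖y‖) ^ 2 ≤ w y
  symbol : ∃ C, IsSymbol (fun y => (w y : ℂ)) 2 C

lemma exists_isSymbol_norm_sq :
    ∃ C, IsSymbol (fun y : EuclideanSpace ℝ (Fin d) => ((‖y‖ ^ 2 : ℝ) : ℂ)) 2 C := by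
  have h : ∀ s : Finset (Fin d), ∃ C,
      IsSymbol (fun y : EuclideanSpace ℝ (Fin d) => ∑ i ∈ s, (y i : ℂ) * (y i : ℂ)) 2 C := by
    intro s
    induction s using Finset.induction_on with
    | empty =>
      exact ⟨_, by
        simpa using (IsSymbol.const (E := EuclideanSpace ℝ (Fin d)) (0 : ℂ)).mono
          (show (0 : ℝ) ≤ 2 by norm_num) (fun _ => le_rfl)⟩
    | insert i s hi ih =>
      obtain ⟨C, hC⟩ := ih
      obtain ⟨D, hD⟩ := isSymbol_coord i
      have h2 := hD.mul hD
      rw [show (1 : ℝ) + 1 = 2 by norm_num] at h2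
      simp only [Finset.sum_insert hi]
      exact ⟨_, h2.add hC⟩
  obtain ⟨C, hC⟩ := h Finset.univ
  refine ⟨C, ?_⟩
  convert hC using 2 with y
  rw [EuclideanSpace.norm_sq_eq]
  push_cast
  exact Finset.sum_congr rfl fun i _ => by
    rw [← Complex.ofReal_pow, Real.norm_eq_abs, sq_abs]; push_cast; ring

/-- The weight is `|y|²` plus a bump function that is `1` on the ball of radius `c / 2` and is
supported in the ball of radius `c`. -/
lemma exists_isWeight {c : ℝ} (hc : 0 < c) :
    ∃ w : EuclideanSpace ℝ (Fin d) → ℝ, IsWeight c w := by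
  let φ : ContDiffBump (0 : EuclideanSpace ℝ (Fin d)) := ⟨c / 2, c, by positivity, by linarith⟩
  refine ⟨fun y => ‖y‖ ^ 2 + φ y, ?_, ?_, ?_, ?_⟩
  · have : φ 0 = 1 := φ.one_of_mem_closedBall (by simpa using by positivity)
    simp [this]
  · intro y hy
    rw [φ.zero_of_le_dist (by simpa using hy), add_zero]
  · refine ⟨min 1 ((c / 2) ^ 2) / (1 + c / 2) ^ 2, by positivity, fun y => ?_⟩
    have h0 := φ.nonneg (x := y)
    rw [div_mul_eq_mul_div, div_le_iff₀ (by positivity)]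
    have hy := norm_nonneg y
    rcases le_total ‖y‖ (c / 2) with h | h
    · have h1 : φ y = 1 := φ.one_of_mem_closedBall (by simpa using h)
      rw [h1]
      have h2 : (1 + ‖y‖) ^ 2 ≤ (1 + c / 2) ^ 2 := by gcongr
      calc min 1 ((c / 2) ^ 2) * (1 + ‖y‖) ^ 2 ≤ 1 * (1 + c / 2) ^ 2 := by
            gcongr
            exact min_le_left _ _
        _ ≤ _ := by
            gcongr
            nlinarith [sq_nonneg ‖y‖]
    · calc min 1 ((c / 2) ^ 2) * (1 + ‖y‖) ^ 2 ≤ (c / 2) ^ 2 * (1 + ‖y‖) ^ 2 := by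
            gcongr
            exact min_le_right _ _
        _ = (c / 2 * (1 + ‖y‖)) ^ 2 := by ring
        _ ≤ (‖y‖ * (1 + c / 2)) ^ 2 := by
            gcongr 1
            nlinarith
        _ = ‖y‖ ^ 2 * (1 + c / 2) ^ 2 := by ring
        _ ≤ _ := by
            gcongr
            linarith
  · obtain ⟨C, hC⟩ := exists_isSymbol_norm_sq (d := d)
    obtain ⟨D, hD⟩ := exists_isSymbol_of_hasCompactSupport (f := fun y => (φ y : ℂ))
      (Complex.ofRealCLM.contDiff.comp φ.contDiff)
      (φ.hasCompactSupport.comp_left (g := ((↑) : ℝ → ℂ)) Complex.ofReal_zero) 2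
    exact ⟨_, by simpa using hC.add hD⟩

variable {c : ℝ} {w : EuclideanSpace ℝ (Fin d) → ℝ}

lemma IsWeight.pos (hw : IsWeight c w) (y : EuclideanSpace ℝ (Fin d)) : 0 < w y := by
  obtain ⟨κ, hκ, h⟩ := hw.lower
  exact lt_of_lt_of_le (by positivity) (h y)

lemma IsWeight.contDiff (hw : IsWeight c w) : ContDiff ℝ ∞ (fun y => (w y : ℂ)) :=
  hw.symbol.choose_spec.1

lemma IsWeight.continuous (hw : IsWeight c w) : Continuous w := by
  have := Complex.continuous_re.comp hw.contDiff.continuous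
  simpa [Function.comp_def] using this

lemma IsWeight.contDiff_cpow (hw : IsWeight c w) (μ : ℂ) :
    ContDiff ℝ ∞ (fun y => (w y : ℂ) ^ μ) := by
  have h1 : ∀ y, (w y : ℂ) ∈ Complex.slitPlane := fun y => by
    simpa using hw.pos y
  have h2 : ∀ y, (w y : ℂ) ^ μ = Complex.exp (Complex.log (w y) * μ) := fun y =>
    Complex.cpow_def_of_ne_zero (Complex.slitPlane_ne_zero (h1 y)) _
  simp only [h2]
  refine contDiff_iff_contDiffAt.2 fun y => ?_
  refine (((Complex.contDiffAt_log (h1 y)).restrict_scalars ℝ).comp y hw.contDiff.contDiffAt).mul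
    contDiffAt_const |>.cexp

lemma IsWeight.fderiv_cpow (hw : IsWeight c w) (μ : ℂ) (y : EuclideanSpace ℝ (Fin d)) :
    fderiv ℝ (fun y => (w y : ℂ) ^ μ) y =
      (w y : ℂ) ^ (μ - 1) • (μ • fderiv ℝ (fun y => (w y : ℂ)) y) := by
  have h1 : (w y : ℂ) ∈ Complex.slitPlane := by simpa using hw.pos y
  have h2 : HasDerivAt (fun z : ℂ => z ^ μ) (μ * (w y : ℂ) ^ (μ - 1)) (w y : ℂ) := by
    simpa using (hasDerivAt_id (w y : ℂ)).cpow_const (c := μ) h1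
  have h3 : HasFDerivAt (fun y => (w y : ℂ)) (fderiv ℝ (fun y => (w y : ℂ)) y) y :=
    (hw.contDiff.differentiable (by simp)).differentiableAt.hasFDerivAt
  have h4 := (h2.comp_hasFDerivAt (𝕜 := ℝ) y h3).fderiv
  rw [show (fun y => (w y : ℂ) ^ μ) = (fun z : ℂ => z ^ μ) ∘ (fun y => (w y : ℂ)) from rfl, h4,
    smul_smul, mul_comm]

lemma IsWeight.exists_norm_cpow_le (hw : IsWeight c w) (R : ℝ) :
    ∃ K : ℝ, ∀ μ : ℂ, ‖μ‖ ≤ R → ∀ y, ‖(w y : ℂ) ^ μ‖ ≤ K * (1 + ‖y‖) ^ (2 * μ.re) := by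
  obtain ⟨κ, hκ, hlow⟩ := hw.lower
  obtain ⟨C, hC⟩ := hw.symbol
  set M := max 1 (C 0) with hM
  set k := min 1 κ with hk
  have hk0 : 0 < k := lt_min one_pos hκ
  have hM1 : 1 ≤ M := le_max_left _ _
  have hk1 : k ≤ 1 := min_le_left _ _
  -- The two terms serve `0 ≤ Re μ` (upper bound on `w`) and `Re μ ≤ 0` (lower bound on `w`).
  refine ⟨M ^ R + k ^ (-R), fun μ hμ y => ?_⟩
  rw [Complex.norm_cpow_eq_rpow_re_of_pos (hw.pos y)]
  have hy : 0 < 1 + ‖y‖ := by positivity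
  have hre : |μ.re| ≤ R := (Complex.abs_re_le_norm μ).trans hμ
  have hup : w y ≤ M * (1 + ‖y‖) ^ 2 := by
    have := hC.norm_le y
    rw [Complex.norm_real, Real.norm_of_nonneg (hw.pos y).le] at this
    refine this.trans ?_
    rw [← Real.rpow_natCast]
    push_cast
    gcongr
    exact le_max_right _ _
  have hlo : k * (1 + ‖y‖) ^ 2 ≤ w y := le_trans (by gcongr; exact min_le_right _ _) (hlow y)
  have hsq : ((1 + ‖y‖) ^ 2) ^ μ.re = (1 + ‖y‖) ^ (2 * μ.re) := by
    rw [Real.rpow_mul hy.le]; norm_num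
  rw [add_mul]
  rcases le_total 0 μ.re with h | h
  · have h1 : w y ^ μ.re ≤ M ^ R * (1 + ‖y‖) ^ (2 * μ.re) := by
      calc w y ^ μ.re ≤ (M * (1 + ‖y‖) ^ 2) ^ μ.re :=
            Real.rpow_le_rpow (hw.pos y).le hup h
        _ = M ^ μ.re * (1 + ‖y‖) ^ (2 * μ.re) := by
            rw [Real.mul_rpow (by positivity) (by positivity), hsq]
        _ ≤ _ := by
            gcongr
            exact (le_abs_self _).trans hre
    have : 0 ≤ k ^ (-R) * (1 + ‖y‖) ^ (2 * μ.re) := by positivity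
    linarith
  · have h1 : w y ^ μ.re ≤ k ^ (-R) * (1 + ‖y‖) ^ (2 * μ.re) := by
      calc w y ^ μ.re ≤ (k * (1 + ‖y‖) ^ 2) ^ μ.re :=
            Real.rpow_le_rpow_of_nonpos (by positivity) hlo h
        _ = k ^ μ.re * (1 + ‖y‖) ^ (2 * μ.re) := by
            rw [Real.mul_rpow (by positivity) (by positivity), hsq]
        _ ≤ _ := by
            refine mul_le_mul_of_nonneg_right ?_ (by positivity)
            exact Real.rpow_le_rpow_of_exponent_ge hk0 hk1 (by linarith [neg_abs_le μ.re])
    have : 0 ≤ M ^ R * (1 + ‖y‖) ^ (2 * μ.re) := by positivity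
    linarith

/-- The power `w ^ μ` is a symbol of order `2 Re μ`, with constants that are locally uniform
in `μ`. -/
lemma IsWeight.exists_isSymbol_cpow (hw : IsWeight c w) (R : ℝ) :
    ∃ C, ∀ μ : ℂ, ‖μ‖ ≤ R → IsSymbol (fun y => (w y : ℂ) ^ μ) (2 * μ.re) C := by
  obtain ⟨D, hD⟩ := hw.symbol
  have key : ∀ n : ℕ, ∀ R : ℝ, ∃ K : ℝ, ∀ μ : ℂ, ‖μ‖ ≤ R → ∀ y,
      ‖iteratedFDeriv ℝ n (fun y => (w y : ℂ) ^ μ) y‖ ≤ K * (1 + ‖y‖) ^ (2 * μ.re - n) := by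
    intro n
    induction n using Nat.strong_induction_on with
    | _ n ih =>
    intro R
    rcases n with _ | n
    · simpa using hw.exists_norm_cpow_le R
    -- The derivative of `w ^ μ` involves `w ^ (μ - 1)`, whence the radius `R + 1`.
    have ih2 : ∀ i : ℕ, ∃ K : ℝ, i ≤ n → ∀ μ : ℂ, ‖μ‖ ≤ R + 1 → ∀ y,
        ‖iteratedFDeriv ℝ i (fun y => (w y : ℂ) ^ μ) y‖ ≤ K * (1 + ‖y‖) ^ (2 * μ.re - i) := by
      intro i
      by_cases hi : i ≤ n
      · obtain ⟨K, hK⟩ := ih i (by omega) (R + 1)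
        exact ⟨K, fun _ => hK⟩
      · exact ⟨0, fun h => absurd h hi⟩
    choose K hK using ih2
    refine ⟨∑ i ∈ Finset.range (n + 1), (n.choose i : ℝ) * K i * (R * D (n - i + 1)),
      fun μ hμ y => ?_⟩
    have hμ1 : ‖μ - 1‖ ≤ R + 1 := (norm_sub_le _ _).trans (by simpa using hμ)
    rw [← norm_iteratedFDeriv_fderiv]
    have hfd : fderiv ℝ (fun y => (w y : ℂ) ^ μ) = fun y =>
        (w y : ℂ) ^ (μ - 1) • (μ • fderiv ℝ (fun y => (w y : ℂ)) y) :=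
      funext fun y => hw.fderiv_cpow μ y
    rw [hfd]
    refine (norm_iteratedFDeriv_smul_le ((hw.contDiff_cpow _).of_le (m := (n : ℕ∞ω))
      (mod_cast le_top)) ((hD.fderiv.1.const_smul μ).of_le (mod_cast le_top)) y le_rfl).trans ?_
    rw [Finset.sum_mul]
    refine Finset.sum_le_sum fun i hi => ?_
    have hin : i ≤ n := Nat.lt_succ_iff.1 (Finset.mem_range.1 hi)
    have hy : 0 < 1 + ‖y‖ := by positivity
    have h1 := hK i hin (μ - 1) hμ1 y
    have h2 : ‖iteratedFDeriv ℝ (n - i) (fun y => μ • fderiv ℝ (fun y => (w y : ℂ)) y) y‖ ≤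
        R * (D (n - i + 1) * (1 + ‖y‖) ^ ((2 : ℝ) - 1 - (n - i : ℕ))) := by
      have hsm : ∀ k : ℕ, ContDiff ℝ k (fderiv ℝ fun y => (w y : ℂ)) :=
        fun k => hD.fderiv.1.of_le (mod_cast le_top)
      rw [iteratedFDeriv_const_smul_apply' (hsm (n - i)).contDiffAt, norm_smul]
      have := hD.fderiv.2 (n - i) y
      have hR : 0 ≤ R := (norm_nonneg μ).trans hμ
      gcongr
    have hK0 : 0 ≤ K i := by
      have := (norm_nonneg _).trans (hK i hin (μ - 1) hμ1 0)
      simpa using this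
    calc _ ≤ (n.choose i : ℝ) * (K i * (1 + ‖y‖) ^ (2 * (μ - 1).re - i)) *
          (R * (D (n - i + 1) * (1 + ‖y‖) ^ ((2 : ℝ) - 1 - (n - i : ℕ)))) := by gcongr
      _ = (n.choose i : ℝ) * K i * (R * D (n - i + 1)) *
          ((1 + ‖y‖) ^ (2 * (μ - 1).re - i) * (1 + ‖y‖) ^ ((2 : ℝ) - 1 - (n - i : ℕ))) := by ring
      _ = _ := by
          rw [← Real.rpow_add hy, Nat.cast_sub hin]
          congr 2
          simp only [Complex.sub_re, Complex.one_re]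
          push_cast
          ring
  choose C hC using fun n => key n R
  exact ⟨C, fun μ hμ => ⟨hw.contDiff_cpow μ, fun n y => hC n μ hμ y⟩⟩

end Weight

/-! ### The entire part -/

section Entire

lemma abs_log_le_add_inv {x : ℝ} (hx : 0 < x) : |Real.log x| ≤ x + x⁻¹ := by
  have h1 := Real.log_le_sub_one_of_pos hx
  have h2 := Real.log_le_sub_one_of_pos (inv_pos.2 hx)
  rw [Real.log_inv] at h2
  have := inv_pos.2 hx
  rw [abs_le]
  constructor <;> linarith

/-- `|x ^ (-ν / 2)|` is bounded, locally uniformly in `ν`, by a fixed combination of two powers. -/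
lemma norm_cpow_neg_half_le {x R : ℝ} (hx : 0 < x) {ν : ℂ} (hν : ‖ν‖ ≤ R) :
    ‖(x : ℂ) ^ (-ν / 2)‖ ≤ x ^ (R / 2) + x ^ (-R / 2) := by
  rw [Complex.norm_cpow_eq_rpow_re_of_pos hx]
  have hre : |ν.re| ≤ R := (Complex.abs_re_le_norm ν).trans hν
  have h1 : (-ν / 2).re = -ν.re / 2 := by simp
  rw [h1]
  have ha := neg_abs_le ν.re
  have hb := le_abs_self ν.re
  have hp := Real.rpow_nonneg hx.le (R / 2)
  have hq := Real.rpow_nonneg hx.le (-R / 2)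
  rcases le_total 1 x with h | h
  · have := Real.rpow_le_rpow_of_exponent_le h (show -ν.re / 2 ≤ R / 2 by linarith)
    linarith
  · have := Real.rpow_le_rpow_of_exponent_ge hx h (show -R / 2 ≤ -ν.re / 2 by linarith)
    linarith

lemma hasDerivAt_cpow_neg_half {x : ℝ} (hx : 0 < x) (ν : ℂ) :
    HasDerivAt (fun ν : ℂ => (x : ℂ) ^ (-ν / 2))
      (-(Real.log x / 2 : ℝ) * (x : ℂ) ^ (-ν / 2)) ν := by
  have hx0 : (x : ℂ) ≠ 0 := by exact_mod_cast hx.ne'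
  have h1 : HasDerivAt (fun ν : ℂ => -ν / 2) (-1 / 2) ν := ((hasDerivAt_id ν).neg).div_const 2
  have h2 := h1.const_cpow (c := (x : ℂ)) (Or.inl hx0)
  convert h2 using 1
  rw [← Complex.ofReal_log hx.le]
  push_cast
  ring

/-- The integral of `g w^{-ν/2}` is an entire function of `ν` as soon as it converges absolutely
for every `ν`. -/
lemma differentiable_integral_mul_cpow {X : Type*} [MeasurableSpace X] {μ : Measure X} {g : X → ℂ}
    {w : X → ℝ} (hpos : ∀ x, 0 < w x) (hw : Measurable w)
    (hint : ∀ ν : ℂ, Integrable (fun x => g x * (w x : ℂ) ^ (-ν / 2)) μ) :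
    Differentiable ℂ (fun ν : ℂ => ∫ x, g x * (w x : ℂ) ^ (-ν / 2) ∂μ) := by
  intro ν₀
  have hreal : ∀ a : ℝ, Integrable (fun x => ‖g x‖ * w x ^ a) μ := by
    intro a
    have := (hint (-2 * a)).norm
    refine this.congr (ae_of_all _ fun x => ?_)
    simp only [norm_mul, Complex.norm_cpow_eq_rpow_re_of_pos (hpos x)]
    congr 2
    simp
  set R := ‖ν₀‖ + 1
  have hmeas : ∀ ν : ℂ, AEStronglyMeasurable
      (fun x => g x * (-(Real.log (w x) / 2 : ℝ) * (w x : ℂ) ^ (-ν / 2))) μ := by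
    intro ν
    have h1 : AEStronglyMeasurable (fun x => (-(Real.log (w x) / 2 : ℝ) : ℂ)) μ := by
      have : Measurable fun x => (-(Real.log (w x) / 2 : ℝ) : ℂ) := by fun_prop
      exact this.aestronglyMeasurable
    refine (h1.mul (hint ν).aestronglyMeasurable).congr (ae_of_all _ fun x => ?_)
    simp only [Pi.mul_apply]
    ring
  -- The derivative in `ν` costs a factor `log w`, which is at most `w + w⁻¹`; all powers of `w` are
  -- integrable against `‖g‖`.
  have hb : Integrable (fun x => ‖g x‖ * ((w x + (w x)⁻¹) / 2 *
      (w x ^ (R / 2) + w x ^ (-R / 2)))) μ := by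
    have h := (((hreal (1 + R / 2)).add (hreal (-1 + R / 2))).add
      ((hreal (1 + -R / 2)).add (hreal (-1 + -R / 2)))).const_mul (1 / 2)
    refine h.congr (ae_of_all _ fun x => ?_)
    simp only [Pi.add_apply, Real.rpow_add (hpos x), Real.rpow_one, Real.rpow_neg_one]
    ring
  refine (hasDerivAt_integral_of_dominated_loc_of_deriv_le (Metric.ball_mem_nhds ν₀ one_pos)
    (F := fun ν x => g x * (w x : ℂ) ^ (-ν / 2))
    (F' := fun ν x => g x * (-(Real.log (w x) / 2 : ℝ) * (w x : ℂ) ^ (-ν / 2)))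
    (Eventually.of_forall fun ν => (hint ν).aestronglyMeasurable) (hint ν₀) (hmeas ν₀)
    (ae_of_all _ fun x ν hν => ?_) hb (ae_of_all _ fun x ν _ => ?_)).2.differentiableAt
  · have hν' : ‖ν‖ ≤ R := by
      have : ‖ν - ν₀‖ < 1 := by simpa [dist_eq_norm] using hν
      have h2 := norm_add_le (ν - ν₀) ν₀
      rw [sub_add_cancel] at h2
      simp only [R]; linarith
    rw [norm_mul, norm_mul, norm_neg, Complex.norm_real, Real.norm_eq_abs, abs_div, abs_two]
    have h1 := abs_log_le_add_inv (hpos x)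
    have h2 := norm_cpow_neg_half_le (hpos x) hν'
    have h3 := hpos x
    gcongr
  · exact (hasDerivAt_cpow_neg_half (hpos x) ν).const_mul (g x)

lemma differentiable_tsum_mul_cpow {ι : Type*} {g : ι → ℂ}
    {w : ι → ℝ} (hpos : ∀ x, 0 < w x)
    (hsum : ∀ ν : ℂ, Summable (fun x => ‖g x * (w x : ℂ) ^ (-ν / 2)‖)) :
    Differentiable ℂ (fun ν : ℂ => ∑' x, g x * (w x : ℂ) ^ (-ν / 2)) := by
  have hreal : ∀ a : ℝ, Summable (fun x => ‖g x‖ * w x ^ a) := by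
    intro a
    refine (hsum (-2 * a)).congr fun x => ?_
    simp only [norm_mul, Complex.norm_cpow_eq_rpow_re_of_pos (hpos x)]
    congr 2
    simp
  intro ν₀
  set R := ‖ν₀‖ + 1
  have h := Complex.differentiableOn_tsum_of_summable_norm
    (F := fun x (ν : ℂ) => g x * (w x : ℂ) ^ (-ν / 2))
    ((hreal (R / 2)).add (hreal (-R / 2))) (U := Metric.ball 0 R)
    (fun x ν _ => ((hasDerivAt_cpow_neg_half (hpos x) ν).const_mul
      (g x)).differentiableAt.differentiableWithinAt) Metric.isOpen_ball
    (fun x ν hν => by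
      have hν' : ‖ν‖ ≤ R := by simpa using (Metric.mem_ball.1 hν).le
      rw [norm_mul, ← mul_add]
      exact mul_le_mul_of_nonneg_left (norm_cpow_neg_half_le (hpos x) hν') (norm_nonneg _))
  exact h.differentiableAt (Metric.isOpen_ball.mem_nhds (by simp [R]))

variable {d : ℕ} {c : ℝ} {w : EuclideanSpace ℝ (Fin d) → ℝ}

/-- The cut-off summand `U(β y) P(y) |y|^{-ν}` with the singularity at the origin removed. -/
def cutTerm (U : SchwartzMap (EuclideanSpace ℝ (Fin d)) ℂ) (P : MvPolynomial (Fin d) ℂ)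
    (w : EuclideanSpace ℝ (Fin d) → ℝ) (β : ℝ) (ν : ℂ) (y : EuclideanSpace ℝ (Fin d)) : ℂ :=
  (U (β • y) * polyFun P y) * (w y : ℂ) ^ (-ν / 2)

variable (U : SchwartzMap (EuclideanSpace ℝ (Fin d)) ℂ) (P : MvPolynomial (Fin d) ℂ)

lemma exists_isSymbol_dilation_mul_polyFun {β : ℝ} (hβ : 0 < β) (a : ℝ) :
    ∃ C, IsSymbol (fun y => U (β • y) * polyFun P y) a C := by
  obtain ⟨M, D, hD⟩ := exists_isSymbol_polyFun P
  obtain ⟨C, hC⟩ := exists_isSymbol_dilation U hβ (a - M)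
  exact ⟨_, (hC.mul hD).mono (by linarith) fun _ => le_rfl⟩

lemma exists_isSymbol_cutTerm (hw : IsWeight c w) {β : ℝ} (hβ : 0 < β) (ν : ℂ) (a : ℝ) :
    ∃ C, IsSymbol (cutTerm U P w β ν) a C := by
  obtain ⟨D, hD⟩ := hw.exists_isSymbol_cpow ‖-ν / 2‖
  obtain ⟨C, hC⟩ := exists_isSymbol_dilation_mul_polyFun U P hβ (a - 2 * (-ν / 2).re)
  exact ⟨_, (hC.mul (hD _ le_rfl)).mono (by linarith) fun _ => le_rfl⟩

lemma IsSymbol.hasDecay {F : Type*} [NormedAddCommGroup F] [NormedSpace ℝ F]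
    {f : EuclideanSpace ℝ (Fin d) → F} {C : ℕ → ℝ}
    (hf : IsSymbol f (-(d + 1 : ℝ)) C) : HasDecay f :=
  ⟨hf.1, fun j => ⟨C j, fun y => (hf.2 j y).trans (by
    have := hf.const_nonneg j
    gcongr
    · simp
    · linarith [(Nat.cast_nonneg j : (0 : ℝ) ≤ j)])⟩⟩

lemma hasDecay_cutTerm (hw : IsWeight c w) {β : ℝ} (hβ : 0 < β) (ν : ℂ) :
    HasDecay (cutTerm U P w β ν) :=
  (exists_isSymbol_cutTerm U P hw hβ ν _).choose_spec.hasDecay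

/-- Differentiating often enough, the difference of two cut-off summands becomes integrable
uniformly in the cut-off, and small with `β`. -/
lemma exists_norm_iteratedFDeriv_cutTerm_sub_le (hw : IsWeight c w) (R : ℝ) :
    ∃ (N : ℕ) (K : ℝ), ∀ ν : ℂ, ‖ν‖ ≤ R → ∀ β β' : ℝ, 0 < β → β ≤ 1 → 0 < β' → β' ≤ 1 → ∀ y,
      ‖iteratedFDeriv ℝ N (fun y => cutTerm U P w β ν y - cutTerm U P w β' ν y) y‖ ≤
        ((β + β') * K) * (1 + ‖y‖) ^ (-(d + 1 : ℝ)) := by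
  obtain ⟨M, D, hD⟩ := exists_isSymbol_polyFun P
  obtain ⟨B, hB⟩ := hw.exists_isSymbol_cpow (R / 2)
  obtain ⟨C, hC⟩ := exists_isSymbol_dilation_sub U
  -- The difference is a symbol of order `1 + M - Re ν ≤ 1 + M + R`.
  set N := ⌈1 + M + R + (d + 1)⌉₊
  refine ⟨N, leibnizConst (leibnizConst C D) B N, fun ν hν β β' hβ hβ1 hβ' hβ1' y => ?_⟩
  have hν2 : ‖-ν / 2‖ ≤ R / 2 := by
    rw [norm_div, norm_neg, Complex.norm_ofNat]; linarith
  have h1 : IsSymbol (fun y => U (β • y) - U (β' • y)) 1 (fun j => (β + β') * C j) := by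
    have h := (hC β hβ hβ1).add (hC β' hβ' hβ1').neg
    refine IsSymbol.mono (a := 1) (C := fun j => β * C j + β' * C j) ?_ le_rfl
      (fun j => by rw [add_mul])
    convert h using 2
    ring
  have h2 := (h1.mul hD).mul (hB _ hν2)
  rw [leibnizConst_mul_left, leibnizConst_mul_left] at h2
  have h3 := h2.2 N y
  have hfun : (fun y => cutTerm U P w β ν y - cutTerm U P w β' ν y) =
      fun y => (U (β • y) - U (β' • y)) * polyFun P y * (w y : ℂ) ^ (-ν / 2) := by
    funext y
    simp only [cutTerm]
    ring
  rw [hfun]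
  refine h3.trans ?_
  refine mul_le_mul_of_nonneg_left ?_ (h2.const_nonneg N)
  refine Real.rpow_le_rpow_of_exponent_le (by simp) ?_
  have hre : |ν.re| ≤ R := (Complex.abs_re_le_norm ν).trans hν
  have hre2 : 2 * (-ν / 2).re = -ν.re := by simp; ring
  rw [hre2]
  have := Nat.le_ceil (1 + M + R + (d + 1))
  linarith [neg_abs_le ν.re]

variable (Λ : Submodule ℤ (EuclideanSpace ℝ (Fin d))) [DiscreteTopology Λ] [IsZLattice ℝ Λ]

lemma latticeDefect_sub {f g : EuclideanSpace ℝ (Fin d) → ℂ} (hf : HasDecay f) (hg : HasDecay g)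
    (x : EuclideanSpace ℝ (Fin d)) :
    latticeDefect Λ (fun y => f y - g y) x = latticeDefect Λ f x - latticeDefect Λ g x := by
  unfold latticeDefect
  rw [(hf.summable Λ x).tsum_sub (hg.summable Λ x), integral_sub hf.integrable hg.integrable,
    smul_sub]
  ring

lemma HasDecay.sub {f g : EuclideanSpace ℝ (Fin d) → ℂ} (hf : HasDecay f) (hg : HasDecay g) :
    HasDecay (fun y => f y - g y) := by
  refine ⟨hf.1.sub hg.1, fun j => ?_⟩
  obtain ⟨C, hC⟩ := hf.2 j
  obtain ⟨D, hD⟩ := hg.2 j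
  refine ⟨C + D, fun y => ?_⟩
  rw [fun_iteratedFDeriv_sub_apply (hf.1.of_le (mod_cast le_top)).contDiffAt
    (hg.1.of_le (mod_cast le_top)).contDiffAt, add_mul]
  exact (norm_sub_le _ _).trans (add_le_add (hC y) (hD y))

/-- The defects of the cut-off summands are Cauchy as the cut-off is removed, locally uniformly
in `ν`. -/
lemma exists_norm_latticeDefect_cutTerm_sub_le (hw : IsWeight c w) (R : ℝ) :
    ∃ K : ℝ, ∀ ν : ℂ, ‖ν‖ ≤ R → ∀ β β' : ℝ, 0 < β → β ≤ 1 → 0 < β' → β' ≤ 1 →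
      ‖latticeDefect Λ (cutTerm U P w β ν) 0 - latticeDefect Λ (cutTerm U P w β' ν) 0‖ ≤
        K * (β + β') := by
  obtain ⟨N, A, hA⟩ := exists_norm_iteratedFDeriv_cutTerm_sub_le U P hw R
  obtain ⟨K, hK0, hK⟩ := exists_norm_latticeDefect_le_of_iteratedFDeriv Λ N
  refine ⟨K * A, fun ν hν β β' hβ hβ1 hβ' hβ1' => ?_⟩
  have h1 := hasDecay_cutTerm U P hw hβ ν
  have h2 := hasDecay_cutTerm U P hw hβ' ν
  rw [← latticeDefect_sub Λ h1 h2]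
  refine (hK ℂ _ (h1.sub h2) _ (hA ν hν β β' hβ hβ1 hβ' hβ1') 0).trans (le_of_eq ?_)
  ring

lemma differentiable_latticeDefect_cutTerm (hw : IsWeight c w) {β : ℝ} (hβ : 0 < β) :
    Differentiable ℂ (fun ν => latticeDefect Λ (cutTerm U P w β ν) 0) := by
  unfold latticeDefect
  refine Differentiable.sub ?_ ?_
  · simp only [zero_add, cutTerm]
    refine differentiable_tsum_mul_cpow (ι := Λ)
      (g := fun z => U (β • (z : EuclideanSpace ℝ (Fin d))) * polyFun P z) (w := fun z => w z)
      (fun z => hw.pos z) fun ν => ?_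
    have := ((hasDecay_cutTerm U P hw hβ ν).summable Λ 0).norm
    simpa [cutTerm] using this
  · refine Differentiable.const_smul ?_ _
    exact differentiable_integral_mul_cpow (μ := volume) (fun y => hw.pos y)
      hw.continuous.measurable (fun ν => (hasDecay_cutTerm U P hw hβ ν).integrable)

/-- The defects of the cut-off summands converge to an entire function of `ν`. -/
lemma exists_differentiable_tendsto_latticeDefect (hw : IsWeight c w) :
    ∃ E : ℂ → ℂ, Differentiable ℂ E ∧
      ∀ ν, Tendsto (fun β => latticeDefect Λ (cutTerm U P w β ν) 0) (𝓝[>] 0) (𝓝 (E ν)) := by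
  set Φ : ℝ → ℂ → ℂ := fun β ν => latticeDefect Λ (cutTerm U P w β ν) 0 with hΦ
  have hcauchy : ∀ R : ℝ, UniformCauchySeqOn Φ (𝓝[>] (0 : ℝ)) (Metric.ball 0 R) := by
    intro R
    obtain ⟨K, hK⟩ := exists_norm_latticeDefect_cutTerm_sub_le U P Λ hw R
    intro u hu
    obtain ⟨ε, hε, hεu⟩ := Metric.mem_uniformity_dist.1 hu
    set δ := ε / (2 * (|K| + 1)) with hδ
    have hδ0 : 0 < δ := by positivity
    have hev : ∀ᶠ β : ℝ in 𝓝[>] 0, 0 < β ∧ β ≤ 1 ∧ β < δ := by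
      filter_upwards [Ioo_mem_nhdsGT (show (0 : ℝ) < min 1 δ by positivity)] with β hβ
      exact ⟨hβ.1, hβ.2.le.trans (min_le_left _ _), hβ.2.trans_le (min_le_right _ _)⟩
    filter_upwards [hev.prod_mk hev] with m ⟨⟨h1, h2, h3⟩, ⟨h4, h5, h6⟩⟩ ν hν
    refine hεu ?_
    rw [dist_eq_norm]
    refine (hK ν (by simpa using (Metric.mem_ball.1 hν).le) m.1 m.2 h1 h2 h4 h5).trans_lt ?_
    have h7 : m.1 + m.2 < 2 * δ := by linarith
    calc K * (m.1 + m.2) ≤ (|K| + 1) * (m.1 + m.2) := by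
          gcongr
          linarith [le_abs_self K]
      _ < (|K| + 1) * (2 * δ) := by gcongr
      _ = ε := by rw [hδ]; field_simp
  have hpt : ∀ ν, ∃ e, Tendsto (fun β => Φ β ν) (𝓝[>] 0) (𝓝 e) := fun ν =>
    cauchy_map_iff_exists_tendsto.1 ((hcauchy (‖ν‖ + 1)).cauchy_map (by simp))
  choose E hE using hpt
  refine ⟨E, fun ν => ?_, hE⟩
  have h1 : TendstoUniformlyOn Φ E (𝓝[>] 0) (Metric.ball 0 (‖ν‖ + 1)) :=
    (hcauchy _).tendstoUniformlyOn_of_tendsto fun ν _ => hE ν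
  have h2 := h1.tendstoLocallyUniformlyOn.differentiableOn
    (by
      filter_upwards [self_mem_nhdsWithin] with β hβ
      exact (differentiable_latticeDefect_cutTerm U P Λ hw hβ).differentiableOn)
    Metric.isOpen_ball
  exact h2.differentiableAt (Metric.isOpen_ball.mem_nhds (by simp))

end Entire

/-! ### Polar coordinates for homogeneous functions -/

section Polar

open Set

variable {d : ℕ}

/-- The integral over the unit sphere with respect to surface measure. -/
def sphereIntegral (q : EuclideanSpace ℝ (Fin d) → ℂ) : ℂ :=
  ∫ x : Metric.sphere (0 : EuclideanSpace ℝ (Fin d)) 1, q x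
    ∂(volume : Measure (EuclideanSpace ℝ (Fin d))).toSphere

/-- Positive homogeneity of degree `k`. -/
def IsHomogeneousFun (k : ℕ) (q : EuclideanSpace ℝ (Fin d) → ℂ) : Prop :=
  ∀ (r : ℝ) (y : EuclideanSpace ℝ (Fin d)), 0 < r → q (r • y) = (r : ℂ) ^ k * q y

/-- Both sides are products of integrals, so no integrability is required. -/
lemma integral_norm_mul_of_isHomogeneousFun (hd : 0 < d) {k : ℕ}
    {q : EuclideanSpace ℝ (Fin d) → ℂ} (hq : IsHomogeneousFun k q) (f : ℝ → ℂ) :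
    ∫ y : EuclideanSpace ℝ (Fin d), f ‖y‖ * q y =
      sphereIntegral q * ∫ r in Ioi (0 : ℝ), (r : ℂ) ^ (k + (d - 1)) * f r := by
  have : Nonempty (Fin d) := ⟨⟨0, hd⟩⟩
  have hdim : Module.finrank ℝ (EuclideanSpace ℝ (Fin d)) = d := by simp
  set μ := (volume : Measure (EuclideanSpace ℝ (Fin d)))
  calc ∫ y : EuclideanSpace ℝ (Fin d), f ‖y‖ * q y
      = ∫ y : ({(0)}ᶜ : Set (EuclideanSpace ℝ (Fin d))), f ‖y.1‖ * q y.1 ∂(μ.comap (↑)) := by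
        rw [integral_subtype_comap (measurableSet_singleton _).compl fun x => f ‖x‖ * q x,
          restrict_compl_singleton]
    _ = ∫ x : Metric.sphere (0 : EuclideanSpace ℝ (Fin d)) 1 × Ioi (0 : ℝ),
          q x.1 * ((x.2.1 : ℂ) ^ k * f x.2) ∂μ.toSphere.prod (.volumeIoiPow (d - 1)) := by
        have h := μ.measurePreserving_homeomorphUnitSphereProd.integral_comp
          (Homeomorph.measurableEmbedding _)
          (fun x : Metric.sphere (0 : EuclideanSpace ℝ (Fin d)) 1 × Ioi (0 : ℝ) =>
            q x.1 * ((x.2.1 : ℂ) ^ k * f x.2))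
        rw [hdim] at h
        rw [← h]
        refine integral_congr_ae (ae_of_all _ fun y => ?_)
        have hy : (0 : ℝ) < ‖(y : EuclideanSpace ℝ (Fin d))‖ := norm_pos_iff.2 y.2
        simp only [homeomorphUnitSphereProd_apply_snd_coe, homeomorphUnitSphereProd_apply_fst_coe]
        rw [hq _ _ (inv_pos.2 hy)]
        have : (‖(y : EuclideanSpace ℝ (Fin d))‖ : ℂ) ≠ 0 := by exact_mod_cast hy.ne'
        have h1 : (‖(y : EuclideanSpace ℝ (Fin d))‖ : ℂ)⁻¹ ^ k *
            (‖(y : EuclideanSpace ℝ (Fin d))‖ : ℂ) ^ k = 1 := by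
          rw [← mul_pow, inv_mul_cancel₀ this, one_pow]
        push_cast
        linear_combination (-(f ‖(y : EuclideanSpace ℝ (Fin d))‖ * q y)) * h1
    _ = sphereIntegral q * ∫ x : Ioi (0 : ℝ), ((x.1 : ℂ) ^ k * f x) ∂.volumeIoiPow (d - 1) :=
        integral_prod_mul (fun x : Metric.sphere (0 : EuclideanSpace ℝ (Fin d)) 1 => q x)
          (fun x : Ioi (0 : ℝ) => (x.1 : ℂ) ^ k * f x)
    _ = _ := by
      congr 1
      simp only [Measure.volumeIoiPow, ENNReal.ofReal]
      rw [integral_withDensity_eq_integral_smul,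
        integral_subtype_comap measurableSet_Ioi
          fun a => Real.toNNReal (a ^ (d - 1)) • ((a : ℂ) ^ k * f a),
        setIntegral_congr_fun measurableSet_Ioi fun x hx => ?_]
      · rw [NNReal.smul_def, Real.coe_toNNReal _ (pow_nonneg hx.out.le _), Complex.real_smul]
        push_cast
        ring
      · exact (measurable_subtype_coe.pow_const _).real_toNNReal

lemma measurableSet_norm_mem {A : Set ℝ} (hA : MeasurableSet A) :
    MeasurableSet {y : EuclideanSpace ℝ (Fin d) | ‖y‖ ∈ A} := measurable_norm hA

lemma setIntegral_quotPow_of_isHomogeneousFun (hd : 0 < d) {k : ℕ}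
    {q : EuclideanSpace ℝ (Fin d) → ℂ} (hq : IsHomogeneousFun k q) (ν : ℂ) {A : Set ℝ}
    (hA : MeasurableSet A) (hA0 : A ⊆ Ioi 0) :
    ∫ y in {y : EuclideanSpace ℝ (Fin d) | ‖y‖ ∈ A}, quotPow ν q y =
      sphereIntegral q * ∫ r in A, (r : ℂ) ^ ((k : ℂ) + d - 1 - ν) := by
  rw [← integral_indicator (measurableSet_norm_mem hA)]
  have h1 : ∀ y : EuclideanSpace ℝ (Fin d),
      ({y : EuclideanSpace ℝ (Fin d) | ‖y‖ ∈ A}.indicator (quotPow ν q)) y =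
        (A.indicator (fun r : ℝ => ((r : ℂ) ^ ν)⁻¹)) ‖y‖ * q y := by
    intro y
    by_cases hy : ‖y‖ ∈ A
    · rw [indicator_of_mem (by exact hy), indicator_of_mem hy, quotPow]
      ring
    · rw [indicator_of_notMem (by exact hy), indicator_of_notMem hy, zero_mul]
  simp only [h1]
  rw [integral_norm_mul_of_isHomogeneousFun hd hq]
  congr 1
  have h2 : ∀ r : ℝ, (r : ℂ) ^ (k + (d - 1)) * A.indicator (fun r : ℝ => ((r : ℂ) ^ ν)⁻¹) r =
      A.indicator (fun r : ℝ => (r : ℂ) ^ ((k : ℂ) + d - 1 - ν)) r := by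
    intro r
    by_cases hr : r ∈ A
    · rw [indicator_of_mem hr, indicator_of_mem hr]
      have hr0 : (r : ℂ) ≠ 0 := by exact_mod_cast (hA0 hr : 0 < r).ne'
      rw [Complex.cpow_sub _ _ hr0, ← div_eq_mul_inv, ← Complex.cpow_natCast]
      push_cast [Nat.cast_sub hd]
      congr 2
      ring
    · rw [indicator_of_notMem hr, indicator_of_notMem hr, mul_zero]
  simp only [h2]
  rw [setIntegral_indicator hA, inter_eq_self_of_subset_right hA0]

lemma integrableOn_norm_rpow (hd : 0 < d) (a : ℝ) {A : Set ℝ} (hA : MeasurableSet A)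
    (hA0 : A ⊆ Ioi 0) (h : IntegrableOn (fun r : ℝ => r ^ (a + d - 1)) A) :
    IntegrableOn (fun y : EuclideanSpace ℝ (Fin d) => ‖y‖ ^ a) {y | ‖y‖ ∈ A} := by
  have : Nonempty (Fin d) := ⟨⟨0, hd⟩⟩
  rw [← integrable_indicator_iff (measurableSet_norm_mem hA)]
  have h1 : {y : EuclideanSpace ℝ (Fin d) | ‖y‖ ∈ A}.indicator (fun y => ‖y‖ ^ a) =
      fun y => (A.indicator fun r : ℝ => r ^ a) ‖y‖ := by
    funext y
    by_cases hy : ‖y‖ ∈ A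
    · rw [indicator_of_mem (by exact hy), indicator_of_mem hy]
    · rw [indicator_of_notMem (by exact hy), indicator_of_notMem hy]
  rw [h1, integrable_fun_norm_addHaar]
  have h2 : ∀ r : ℝ, r ^ (Module.finrank ℝ (EuclideanSpace ℝ (Fin d)) - 1) •
      (A.indicator fun r : ℝ => r ^ a) r = A.indicator (fun r : ℝ => r ^ (a + d - 1)) r := by
    intro r
    by_cases hr : r ∈ A
    · rw [indicator_of_mem hr, indicator_of_mem hr]
      have hr0 : 0 < r := hA0 hr
      rw [smul_eq_mul, ← Real.rpow_natCast, ← Real.rpow_add hr0]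
      congr 1
      simp only [finrank_euclideanSpace, Fintype.card_fin]
      push_cast [Nat.cast_sub hd]
      ring
    · rw [indicator_of_notMem hr, indicator_of_notMem hr, smul_zero]
  simp only [h2]
  exact ((integrable_indicator_iff hA).2 h).integrableOn

lemma measurable_quotPow (ν : ℂ) {g : EuclideanSpace ℝ (Fin d) → ℂ} (hg : Measurable g) :
    Measurable (quotPow ν g) := by
  unfold quotPow
  exact hg.div ((Complex.measurable_ofReal.comp measurable_norm).pow_const ν)

lemma norm_quotPow_le {ν : ℂ} {g : EuclideanSpace ℝ (Fin d) → ℂ}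
    {y : EuclideanSpace ℝ (Fin d)} (hy : 0 < ‖y‖) {M : ℝ} {N : ℕ} (h : ‖g y‖ ≤ M * ‖y‖ ^ N) :
    ‖quotPow ν g y‖ ≤ M * ‖y‖ ^ ((N : ℝ) - ν.re) := by
  rw [quotPow, norm_div, Complex.norm_cpow_eq_rpow_re_of_pos hy, Real.rpow_sub hy,
    Real.rpow_natCast, ← mul_div_assoc]
  gcongr

lemma integrableOn_quotPow_of_norm_le (hd : 0 < d) (ν : ℂ) (N : ℕ) {A : Set ℝ}
    (hA : MeasurableSet A) (hA0 : A ⊆ Ioi 0)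
    (h : IntegrableOn (fun r : ℝ => r ^ ((N : ℝ) - ν.re + d - 1)) A)
    {g : EuclideanSpace ℝ (Fin d) → ℂ} (hg : Measurable g) {M : ℝ}
    (hM : ∀ y, ‖y‖ ∈ A → ‖g y‖ ≤ M * ‖y‖ ^ N) :
    IntegrableOn (quotPow ν g) {y | ‖y‖ ∈ A} := by
  refine ((integrableOn_norm_rpow hd _ hA hA0 h).const_mul M).mono'
    (measurable_quotPow ν hg).aestronglyMeasurable ?_
  filter_upwards [ae_restrict_mem (measurableSet_norm_mem hA)] with y hy
  exact norm_quotPow_le (hA0 hy) (hM y hy)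

lemma norm_setIntegral_quotPow_le (hd : 0 < d) (ν : ℂ) (N : ℕ) {A : Set ℝ}
    (hA : MeasurableSet A) (hA0 : A ⊆ Ioi 0)
    (h : IntegrableOn (fun r : ℝ => r ^ ((N : ℝ) - ν.re + d - 1)) A)
    {g : EuclideanSpace ℝ (Fin d) → ℂ} {M : ℝ}
    (hM : ∀ y, ‖y‖ ∈ A → ‖g y‖ ≤ M * ‖y‖ ^ N) :
    ‖∫ y in {y | ‖y‖ ∈ A}, quotPow ν g y‖ ≤
      M * ∫ y in {y : EuclideanSpace ℝ (Fin d) | ‖y‖ ∈ A}, ‖y‖ ^ ((N : ℝ) - ν.re) := by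
  rw [← integral_const_mul]
  refine norm_integral_le_of_norm_le ((integrableOn_norm_rpow hd _ hA hA0 h).const_mul M) ?_
  filter_upwards [ae_restrict_mem (measurableSet_norm_mem hA)] with y hy
  exact norm_quotPow_le (hA0 hy) (hM y hy)

lemma IsHomogeneousFun.exists_norm_le {k : ℕ} {q : EuclideanSpace ℝ (Fin d) → ℂ}
    (hq : IsHomogeneousFun k q) (hc : Continuous q) :
    ∃ M : ℝ, 0 ≤ M ∧ ∀ y, 0 < ‖y‖ → ‖q y‖ ≤ M * ‖y‖ ^ k := by
  obtain ⟨M, hM⟩ := (isCompact_sphere (0 : EuclideanSpace ℝ (Fin d)) 1).exists_bound_of_continuousOn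
    hc.continuousOn
  refine ⟨max M 0, le_max_right _ _, fun y hy => ?_⟩
  have h1 : y = ‖y‖ • (‖y‖⁻¹ • y) := by rw [smul_smul, mul_inv_cancel₀ hy.ne', one_smul]
  have h2 : ‖‖y‖⁻¹ • y‖ = 1 := by
    rw [norm_smul, norm_inv, norm_norm, inv_mul_cancel₀ hy.ne']
  have h3 := hM (‖y‖⁻¹ • y) (by simpa using h2)
  have h4 : ‖q y‖ = ‖y‖ ^ k * ‖q (‖y‖⁻¹ • y)‖ := by
    conv_lhs => rw [h1]
    rw [hq _ _ hy, norm_mul, norm_pow, Complex.norm_real, norm_norm]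
  rw [h4, mul_comm]
  gcongr
  exact h3.trans (le_max_left _ _)

end Polar

/-! ### The radial primitive -/

section Radial

open Set

/-- The primitive `∫^x r^{k + d - 1 - ν} dr`, without constant term: the logarithm in the
exceptional case `ν = d + k`. -/
def radialPrim (d k : ℕ) (ν : ℂ) (x : ℝ) : ℂ :=
  open Classical in
  if ν = d + k then (Real.log x : ℂ) else (x : ℂ) ^ ((k : ℂ) + d - ν) / ((k : ℂ) + d - ν)

variable {d k : ℕ} {ν : ℂ}

lemma radialPrim_of_ne (h : ν ≠ d + k) (x : ℝ) :
    radialPrim d k ν x = (x : ℂ) ^ ((k : ℂ) + d - ν) / ((k : ℂ) + d - ν) := by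
  rw [radialPrim, if_neg h]

lemma radialPrim_of_eq (h : ν = d + k) (x : ℝ) : radialPrim d k ν x = Real.log x := by
  rw [radialPrim, if_pos h]

lemma integral_Ici_cpow_eq_neg_radialPrim (hν : (k : ℝ) + d < ν.re) {x : ℝ} (hx : 0 < x) :
    ∫ r in Ici x, (r : ℂ) ^ ((k : ℂ) + d - 1 - ν) = -radialPrim d k ν x := by
  have hne : ν ≠ d + k := by
    rintro rfl
    simp only [Complex.add_re, Complex.natCast_re] at hν
    linarith
  rw [integral_Ici_eq_integral_Ioi, integral_Ioi_cpow_of_lt _ hx, radialPrim_of_ne hne]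
  · rw [show (k : ℂ) + d - 1 - ν + 1 = (k : ℂ) + d - ν by ring, neg_div]
  · simp
    linarith

lemma integral_Ico_cpow_eq_radialPrim_sub {x y : ℝ} (hx : 0 < x) (hxy : x ≤ y) :
    ∫ r in Ico x y, (r : ℂ) ^ ((k : ℂ) + d - 1 - ν) = radialPrim d k ν y - radialPrim d k ν x := by
  have h0 : (0 : ℝ) ∉ uIcc x y := by
    rw [uIcc_of_le hxy]
    exact fun h => absurd h.1 (not_le.2 hx)
  rw [integral_Ico_eq_integral_Ioc, ← intervalIntegral.integral_of_le hxy]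
  by_cases h : ν = d + k
  · rw [radialPrim_of_eq h, radialPrim_of_eq h, h]
    have h1 : ∀ r : ℝ, (r : ℂ) ^ ((k : ℂ) + d - 1 - (d + k)) = ((r⁻¹ : ℝ) : ℂ) := by
      intro r
      rw [show (k : ℂ) + d - 1 - (d + k) = -1 by ring, Complex.cpow_neg_one]
      simp
    simp only [h1]
    rw [intervalIntegral.integral_ofReal, integral_inv h0,
      Real.log_div (hx.trans_le hxy).ne' hx.ne']
    push_cast
    ring
  · have hne : (k : ℂ) + d - 1 - ν ≠ -1 := by
      intro h2
      apply h
      linear_combination -h2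
    rw [integral_cpow (Or.inr ⟨hne, h0⟩), radialPrim_of_ne h, radialPrim_of_ne h]
    rw [show (k : ℂ) + d - 1 - ν + 1 = (k : ℂ) + d - ν by ring]
    ring

lemma integral_Ioo_cpow_eq_radialPrim (hν : ν.re < (k : ℝ) + d) {x : ℝ} (hx : 0 < x) :
    ∫ r in Ioo 0 x, (r : ℂ) ^ ((k : ℂ) + d - 1 - ν) = radialPrim d k ν x := by
  have hne : ν ≠ d + k := by
    rintro rfl
    simp only [Complex.add_re, Complex.natCast_re] at hν
    linarith
  have hne' : (k : ℂ) + d - ν ≠ 0 := fun h => hne (by linear_combination -h)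
  rw [← integral_Ioc_eq_integral_Ioo, ← intervalIntegral.integral_of_le hx.le,
    integral_cpow (Or.inl (by simp; linarith)), radialPrim_of_ne hne]
  rw [show (k : ℂ) + d - 1 - ν + 1 = (k : ℂ) + d - ν by ring, Complex.ofReal_zero,
    Complex.zero_cpow hne', sub_zero]

lemma integrableOn_rpow_Ico (a : ℝ) {x y : ℝ} (hx : 0 < x) :
    IntegrableOn (fun r : ℝ => r ^ a) (Ico x y) := by
  refine IntegrableOn.mono_set (t := Icc x y) ?_ Ico_subset_Icc_self
  refine ContinuousOn.integrableOn_Icc fun r hr => ?_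
  exact (Real.continuousAt_rpow_const _ _ (Or.inl (hx.trans_le hr.1).ne')).continuousWithinAt

lemma integrableOn_rpow_Ioo {a : ℝ} (ha : -1 < a) {x : ℝ} (hx : 0 < x) :
    IntegrableOn (fun r : ℝ => r ^ a) (Ioo 0 x) :=
  (intervalIntegral.integrableOn_Ioo_rpow_iff hx).2 ha

lemma tendsto_radialPrim_add (h : ν ≠ d + k) {x : ℝ} (hx : 0 < x) :
    Tendsto (fun s : ℝ => radialPrim d k (ν + s) x) (𝓝[>] 0) (𝓝 (radialPrim d k ν x)) := by
  have hne : (k : ℂ) + d - ν ≠ 0 := fun h2 => h (by linear_combination -h2)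
  have hx0 : (x : ℂ) ≠ 0 := by exact_mod_cast hx.ne'
  have h1 : ContinuousAt (fun z : ℂ => (x : ℂ) ^ ((k : ℂ) + d - z) / ((k : ℂ) + d - z)) ν :=
    ((continuousAt_const.sub continuousAt_id).const_cpow (Or.inl hx0)).div
      (continuousAt_const.sub continuousAt_id) hne
  have h2 : Tendsto (fun s : ℝ => ν + (s : ℂ)) (𝓝[>] 0) (𝓝 ν) := by
    have : Continuous fun s : ℝ => ν + (s : ℂ) := by fun_prop
    simpa using (this.tendsto 0).mono_left nhdsWithin_le_nhds
  have h3 : ∀ᶠ z : ℂ in 𝓝 ν, z ≠ (d : ℂ) + k := isOpen_ne.mem_nhds h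
  rw [radialPrim_of_ne h]
  refine (h1.tendsto.comp h2).congr' ?_
  filter_upwards [h2.eventually h3] with s hs
  rw [radialPrim_of_ne hs]; rfl

end Radial

/-! ### The Hadamard finite part -/

section Taylor

variable {d : ℕ}

lemma isHomogeneousFun_taylorTerm (k : ℕ) (g : EuclideanSpace ℝ (Fin d) → ℂ) :
    IsHomogeneousFun k (taylorTerm k g) := by
  intro r y _
  have h := (iteratedFDeriv ℝ k g 0).map_smul_univ (fun _ => r) (fun _ => y)
  simp only [Finset.prod_const, Finset.card_univ, Fintype.card_fin, Complex.real_smul] at h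
  rw [taylorTerm, taylorTerm, h]
  push_cast
  ring

lemma continuous_taylorTerm (k : ℕ) (g : EuclideanSpace ℝ (Fin d) → ℂ) :
    Continuous (taylorTerm k g) := by
  unfold taylorTerm
  exact ((iteratedFDeriv ℝ k g 0).cont.comp (continuous_pi fun _ => continuous_id)).div_const _

lemma norm_taylorTerm_le (k : ℕ) (g : EuclideanSpace ℝ (Fin d) → ℂ)
    (y : EuclideanSpace ℝ (Fin d)) :
    ‖taylorTerm k g y‖ ≤ ‖iteratedFDeriv ℝ k g 0‖ * ‖y‖ ^ k := by
  rw [taylorTerm, norm_div, Complex.norm_natCast]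
  have h := (iteratedFDeriv ℝ k g 0).le_opNorm (fun _ => y)
  simp only [Finset.prod_const, Finset.card_univ, Fintype.card_fin] at h
  refine (div_le_self (norm_nonneg _) ?_).trans h
  exact_mod_cast Nat.one_le_iff_ne_zero.2 (Nat.factorial_ne_zero k)

lemma taylorTerm_add {f g : EuclideanSpace ℝ (Fin d) → ℂ} (hf : ContDiff ℝ ∞ f)
    (hg : ContDiff ℝ ∞ g) (k : ℕ) (y : EuclideanSpace ℝ (Fin d)) :
    taylorTerm k (fun y => f y + g y) y = taylorTerm k f y + taylorTerm k g y := by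
  rw [taylorTerm, fun_iteratedFDeriv_add_apply (hf.of_le (mod_cast le_top)).contDiffAt
    (hg.of_le (mod_cast le_top)).contDiffAt]
  simp only [taylorTerm, add_apply, add_div]

lemma taylorTerm_sum {ι : Type*} (s : Finset ι) {f : ι → EuclideanSpace ℝ (Fin d) → ℂ}
    (hf : ∀ i ∈ s, ContDiff ℝ ∞ (f i)) (k : ℕ) (y : EuclideanSpace ℝ (Fin d)) :
    taylorTerm k (fun y => ∑ i ∈ s, f i y) y = ∑ i ∈ s, taylorTerm k (f i) y := by
  classical
  induction s using Finset.induction_on with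
  | empty =>
    simp only [Finset.sum_empty, taylorTerm]
    have : iteratedFDeriv ℝ k (fun _ : EuclideanSpace ℝ (Fin d) => (0 : ℂ)) = 0 := by
      exact iteratedFDeriv_fun_zero (𝕜 := ℝ) (E := EuclideanSpace ℝ (Fin d)) (F := ℂ) (n := k)
    simp [this]
  | insert i s hi ih =>
    simp only [Finset.sum_insert hi]
    rw [taylorTerm_add (hf i (Finset.mem_insert_self i s))
      (ContDiff.sum fun j hj => hf j (Finset.mem_insert_of_mem hj)),
      ih fun j hj => hf j (Finset.mem_insert_of_mem hj)]

/-- Taylor's theorem at the origin, with a bound on the remainder. -/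
lemma norm_sub_sum_taylorTerm_le {g : EuclideanSpace ℝ (Fin d) → ℂ} (hg : ContDiff ℝ ∞ g) (N : ℕ)
    {c M : ℝ} (hM : ∀ x, ‖x‖ ≤ c → ‖iteratedFDeriv ℝ N g x‖ ≤ M)
    {y : EuclideanSpace ℝ (Fin d)} (hy : ‖y‖ ≤ c) :
    ‖g y - ∑ k ∈ Finset.range N, taylorTerm k g y‖ ≤ M * ‖y‖ ^ N := by
  rcases N with _ | n
  · simpa using hM y hy
  have h := map_add_eq_sum_add_integral_iteratedFDeriv (f := g) (x := 0) (y := y) (n := n)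
    (fun t _ => (hg.of_le (by exact_mod_cast le_top)).contDiffAt)
  simp only [zero_add] at h
  have hsum : ∑ k ∈ Finset.range (n + 1), taylorTerm k g y =
      ∑ k ∈ Finset.range (n + 1), ((k.factorial : ℝ)⁻¹) • (iteratedFDeriv ℝ k g 0 fun _ => y) := by
    refine Finset.sum_congr rfl fun k _ => ?_
    rw [taylorTerm, Complex.real_smul, div_eq_inv_mul]
    push_cast
    rfl
  rw [hsum, h, add_sub_cancel_left, norm_smul]
  have hc : 0 ≤ c := (norm_nonneg y).trans hy
  have hint : ‖∫ t in (0 : ℝ)..1, (1 - t) ^ n • iteratedFDeriv ℝ (n + 1) g (t • y) fun _ => y‖ ≤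
      M * ‖y‖ ^ (n + 1) * |(1 : ℝ) - 0| := by
    refine intervalIntegral.norm_integral_le_of_norm_le_const fun t ht => ?_
    rw [Set.uIoc_of_le zero_le_one] at ht
    have h1 := (iteratedFDeriv ℝ (n + 1) g (t • y)).le_opNorm (fun _ => y)
    simp only [Finset.prod_const, Finset.card_univ, Fintype.card_fin] at h1
    have h2 : ‖t • y‖ ≤ c := by
      rw [norm_smul, Real.norm_of_nonneg ht.1.le]
      nlinarith [norm_nonneg y, ht.2]
    have h3 : ‖(1 - t) ^ n‖ ≤ 1 := by
      rw [norm_pow, Real.norm_of_nonneg (by linarith [ht.2])]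
      exact pow_le_one₀ (by linarith [ht.2]) (by linarith [ht.1])
    rw [norm_smul]
    calc _ ≤ 1 * (M * ‖y‖ ^ (n + 1)) := by
          gcongr
          exact h1.trans (by gcongr; exact hM _ h2)
      _ = _ := one_mul _
  have hf : ‖((n.factorial : ℝ)⁻¹)‖ ≤ 1 := by
    rw [norm_inv, Real.norm_natCast]
    exact inv_le_one_of_one_le₀ (mod_cast Nat.one_le_iff_ne_zero.2 (Nat.factorial_ne_zero n))
  calc _ ≤ 1 * (M * ‖y‖ ^ (n + 1) * |(1 : ℝ) - 0|) := by gcongr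
    _ = _ := by simp

/-- A smooth homogeneous function is its own Taylor term. -/
lemma taylorTerm_of_forall_smul {k j : ℕ} {f : EuclideanSpace ℝ (Fin d) → ℂ}
    (hf : ContDiff ℝ ∞ f) (hhom : ∀ (t : ℝ) y, f (t • y) = (t : ℂ) ^ j * f y)
    (y : EuclideanSpace ℝ (Fin d)) :
    taylorTerm k f y = if k = j then f y else 0 := by
  let L : ℝ →L[ℝ] EuclideanSpace ℝ (Fin d) := (ContinuousLinearMap.id ℝ ℝ).smulRight y
  have h1 : iteratedDeriv k (fun t : ℝ => f (t • y)) 0 = iteratedFDeriv ℝ k f 0 fun _ => y := by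
    rw [iteratedDeriv_eq_iteratedFDeriv]
    have := L.iteratedFDeriv_comp_right (i := k) (n := ∞) hf 0 (by exact_mod_cast le_top)
    have h2 : (f ∘ L) = fun t : ℝ => f (t • y) := rfl
    rw [h2] at this
    rw [this]
    simp [L]
  have h2 : (fun t : ℝ => f (t • y)) = fun t : ℝ => (t ^ j) • f y := by
    funext t
    rw [hhom, Complex.real_smul]
    push_cast
    rfl
  rw [taylorTerm, ← h1, h2, iteratedDeriv_smul_const (by fun_prop), iteratedDeriv_fun_pow_zero]
  split_ifs with h
  · subst h
    rw [Complex.real_smul, Complex.ofReal_natCast, mul_div_cancel_left₀]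
    exact_mod_cast Nat.factorial_ne_zero k
  · simp

lemma polyFun_smul_of_isHomogeneous {j : ℕ} {Q : MvPolynomial (Fin d) ℂ} (hQ : Q.IsHomogeneous j)
    (t : ℝ) (y : EuclideanSpace ℝ (Fin d)) : polyFun Q (t • y) = (t : ℂ) ^ j * polyFun Q y := by
  rw [polyFun, polyFun, MvPolynomial.eval_eq, MvPolynomial.eval_eq, Finset.mul_sum]
  refine Finset.sum_congr rfl fun s hs => ?_
  have hdeg : ∑ i ∈ s.support, s i = j := by
    have h := hQ (MvPolynomial.mem_support_iff.1 hs)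
    have h2 : Finsupp.degree s = j := by rw [Finsupp.degree_eq_weight_one]; exact h
    exact h2
  simp only [PiLp.smul_apply, smul_eq_mul, Complex.ofReal_mul, mul_pow, Finset.prod_mul_distrib]
  rw [Finset.prod_pow_eq_pow_sum, hdeg]
  ring

lemma polyFun_eq_sum_homogeneousComponent (P : MvPolynomial (Fin d) ℂ)
    (y : EuclideanSpace ℝ (Fin d)) : polyFun P y =
      ∑ i ∈ Finset.range (P.totalDegree + 1),
        polyFun (MvPolynomial.homogeneousComponent i P) y := by
  conv_lhs => rw [← MvPolynomial.sum_homogeneousComponent P]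
  simp [polyFun]

lemma taylorTerm_polyFun (P : MvPolynomial (Fin d) ℂ) (k : ℕ) :
    taylorTerm k (polyFun P) = polyFun (MvPolynomial.homogeneousComponent k P) := by
  funext y
  have h1 : polyFun P = fun y => ∑ i ∈ Finset.range (P.totalDegree + 1),
        polyFun (MvPolynomial.homogeneousComponent i P) y :=
    funext fun y => polyFun_eq_sum_homogeneousComponent P y
  rw [h1, taylorTerm_sum _ (fun i _ => contDiff_polyFun _)]
  have h2 : ∀ i, taylorTerm k (polyFun (MvPolynomial.homogeneousComponent i P)) y =
      if k = i then polyFun (MvPolynomial.homogeneousComponent i P) y else 0 := fun i =>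
    taylorTerm_of_forall_smul (contDiff_polyFun _)
      (polyFun_smul_of_isHomogeneous (MvPolynomial.homogeneousComponent_isHomogeneous i P)) y
  simp only [h2, Finset.sum_ite_eq, Finset.mem_range]
  split_ifs with h
  · rfl
  · rw [MvPolynomial.homogeneousComponent_eq_zero k P (by omega)]
    simp [polyFun]

end Taylor

section Hadamard

open Set

variable {d : ℕ}

/-- The number of counterterms of the finite part: `k < hadamardOrder d ν` if and only if
`k ≤ Re ν - d`. -/
def hadamardOrder (d : ℕ) (ν : ℂ) : ℕ := (⌊ν.re - d⌋ + 1).toNat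

lemma le_of_lt_hadamardOrder {ν : ℂ} {k : ℕ} (h : k < hadamardOrder d ν) :
    (k : ℝ) + d ≤ ν.re := by
  have h1 : (k : ℤ) ≤ ⌊ν.re - d⌋ := by
    unfold hadamardOrder at h
    omega
  have := Int.le_floor.1 h1
  push_cast at this
  linarith

lemma lt_of_hadamardOrder_le {ν : ℂ} {k : ℕ} (h : hadamardOrder d ν ≤ k) :
    ν.re < (k : ℝ) + d := by
  have h1 : ⌊ν.re - d⌋ < (k : ℤ) := by
    unfold hadamardOrder at h
    omega
  have := Int.floor_lt.1 h1
  push_cast at this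
  linarith

/-- The counterterms in polar coordinates. In the exceptional case the integral ends at radius one,
where the logarithmic primitive is zero; in the other cases the primitive is zero at infinity, after
the Abel regularisation if `Re ν = d + k`. -/
lemma hadamardCounterterm_eq (hd : 0 < d) (ν : ℂ) {ε : ℝ} (hε : 0 < ε) (hε1 : ε ≤ 1)
    (g : EuclideanSpace ℝ (Fin d) → ℂ) :
    hadamardCounterterm ν ε g = -∑ k ∈ Finset.range (hadamardOrder d ν),
      sphereIntegral (taylorTerm k g) * radialPrim d k ν ε := by
  rw [hadamardCounterterm, ← Finset.sum_neg_distrib]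
  refine Finset.sum_congr rfl fun k hk => ?_
  have hk2 := le_of_lt_hadamardOrder (Finset.mem_range.1 hk)
  have hhom := isHomogeneousFun_taylorTerm k g
  split_ifs with h
  · have h1 := setIntegral_quotPow_of_isHomogeneousFun hd hhom ν (A := Ico ε 1) measurableSet_Ico
      (fun r hr => hε.trans_le hr.1)
    refine h1.trans ?_
    rw [integral_Ico_cpow_eq_radialPrim_sub hε hε1, radialPrim_of_eq h, radialPrim_of_eq h,
      Real.log_one]
    push_cast
    ring
  · have h1 : Tendsto (fun s : ℝ =>
        ∫ y in {y : EuclideanSpace ℝ (Fin d) | ε ≤ ‖y‖}, quotPow (ν + s) (taylorTerm k g) y)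
        (𝓝[>] 0) (𝓝 (-(sphereIntegral (taylorTerm k g) * radialPrim d k ν ε))) := by
      have h2 := ((tendsto_radialPrim_add h hε).const_mul
        (sphereIntegral (taylorTerm k g))).neg
      refine h2.congr' ?_
      filter_upwards [self_mem_nhdsWithin] with s hs
      have h3 := setIntegral_quotPow_of_isHomogeneousFun hd hhom (ν + s) (A := Ici ε)
        measurableSet_Ici (fun r hr => hε.trans_le hr)
      rw [integral_Ici_cpow_eq_neg_radialPrim _ hε] at h3
      · refine Eq.trans ?_ h3.symm
        ring
      · simp only [Complex.add_re, Complex.ofReal_re]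
        have : 0 < s := hs
        linarith
    exact h1.limUnder_eq

/-- The part of the finite part that comes from the ball of radius `c`: the Taylor remainder is
integrated, and the Taylor terms contribute the finite parts of their radial integrals. -/
def hadamardLocal (c : ℝ) (ν : ℂ) (g : EuclideanSpace ℝ (Fin d) → ℂ) : ℂ :=
  (∫ y in {y : EuclideanSpace ℝ (Fin d) | ‖y‖ ∈ Ioo 0 c},
      quotPow ν (fun y => g y - ∑ k ∈ Finset.range (hadamardOrder d ν), taylorTerm k g y) y)
    + ∑ k ∈ Finset.range (hadamardOrder d ν),
        sphereIntegral (taylorTerm k g) * radialPrim d k ν c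

lemma continuous_taylorRemainder {g : EuclideanSpace ℝ (Fin d) → ℂ} (hg : ContDiff ℝ ∞ g) (N : ℕ) :
    Continuous fun y => g y - ∑ k ∈ Finset.range N, taylorTerm k g y :=
  hg.continuous.sub (continuous_finsetSum _ fun k _ => continuous_taylorTerm k g)

lemma exists_norm_iteratedFDeriv_le_on_ball {g : EuclideanSpace ℝ (Fin d) → ℂ}
    (hg : ContDiff ℝ ∞ g) (N : ℕ) (c : ℝ) :
    ∃ M : ℝ, ∀ x, ‖x‖ ≤ c → ‖iteratedFDeriv ℝ N g x‖ ≤ M := by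
  have h1 : Continuous (iteratedFDeriv ℝ N g) :=
    hg.continuous_iteratedFDeriv (by exact_mod_cast le_top)
  obtain ⟨M, hM⟩ := (isCompact_closedBall
    (0 : EuclideanSpace ℝ (Fin d)) c).exists_bound_of_continuousOn h1.continuousOn
  exact ⟨M, fun x hx => hM x (by simpa using hx)⟩

lemma integrableOn_radial_hadamardOrder (ν : ℂ) {c : ℝ} (hc : 0 < c) {N : ℕ}
    (hN : hadamardOrder d ν ≤ N) :
    IntegrableOn (fun r : ℝ => r ^ ((N : ℝ) - ν.re + d - 1)) (Ioo 0 c) := by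
  refine integrableOn_rpow_Ioo ?_ hc
  linarith [lt_of_hadamardOrder_le hN]

lemma integrableOn_quotPow_taylorRemainder (hd : 0 < d) (ν : ℂ) {c : ℝ} (hc : 0 < c)
    {g : EuclideanSpace ℝ (Fin d) → ℂ} (hg : ContDiff ℝ ∞ g) :
    IntegrableOn (quotPow ν (fun y => g y -
      ∑ k ∈ Finset.range (hadamardOrder d ν), taylorTerm k g y)) {y | ‖y‖ ∈ Ioo 0 c} := by
  obtain ⟨M, hM⟩ := exists_norm_iteratedFDeriv_le_on_ball hg (hadamardOrder d ν) c
  exact integrableOn_quotPow_of_norm_le hd ν (hadamardOrder d ν) measurableSet_Ioo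
    (fun r hr => hr.1)
    (integrableOn_radial_hadamardOrder ν hc le_rfl) (continuous_taylorRemainder hg _).measurable
    (fun y hy => norm_sub_sum_taylorTerm_le hg _ hM hy.2.le)

lemma integrableOn_quotPow_Ico_of_isHomogeneousFun (hd : 0 < d) (ν : ℂ) {ε c : ℝ} (hε : 0 < ε)
    {k : ℕ} {q : EuclideanSpace ℝ (Fin d) → ℂ} (hq : IsHomogeneousFun k q) (hqc : Continuous q) :
    IntegrableOn (quotPow ν q) {y | ‖y‖ ∈ Ico ε c} := by
  obtain ⟨M, hM0, hM⟩ := hq.exists_norm_le hqc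
  exact integrableOn_quotPow_of_norm_le hd ν k measurableSet_Ico (fun r hr => hε.trans_le hr.1)
    (integrableOn_rpow_Ico _ hε) hqc.measurable (fun y hy => hM y (hε.trans_le hy.1))

lemma quotPow_sub_sum (ν : ℂ) (g : EuclideanSpace ℝ (Fin d) → ℂ)
    {ι : Type*} (s : Finset ι) (q : ι → EuclideanSpace ℝ (Fin d) → ℂ)
    (y : EuclideanSpace ℝ (Fin d)) :
    quotPow ν (fun y => g y - ∑ k ∈ s, q k y) y = quotPow ν g y - ∑ k ∈ s, quotPow ν (q k) y := by
  simp only [quotPow, sub_div, Finset.sum_div]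

/-- The finite part exists, and splits into the absolutely convergent integral outside the ball of
radius `c` and a local part. -/
theorem tendsto_hadamardTruncated (hd : 0 < d) (ν : ℂ) {c : ℝ} (hc : 0 < c)
    {g : EuclideanSpace ℝ (Fin d) → ℂ} (hg : ContDiff ℝ ∞ g)
    (hint : ∀ ε : ℝ, 0 < ε → IntegrableOn (quotPow ν g) {y | ε ≤ ‖y‖}) :
    Tendsto (hadamardTruncated ν g) (𝓝[>] 0)
      (𝓝 ((∫ y in {y | c ≤ ‖y‖}, quotPow ν g y) + hadamardLocal c ν g)) := by
  set N := hadamardOrder d ν with hN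
  set h := quotPow ν (fun y => g y - ∑ k ∈ Finset.range N, taylorTerm k g y) with hh
  have hI := integrableOn_quotPow_taylorRemainder hd ν hc hg
  have hlim : Tendsto (fun ε : ℝ => ∫ y in {y : EuclideanSpace ℝ (Fin d) | ‖y‖ ∈ Ico ε c}, h y)
      (𝓝[>] 0) (𝓝 (∫ y in {y : EuclideanSpace ℝ (Fin d) | ‖y‖ ∈ Ioo 0 c}, h y)) := by
    have hI2 := (integrable_indicator_iff (measurableSet_norm_mem measurableSet_Ioo)).2 hI
    simp only [← integral_indicator (measurableSet_norm_mem (d := d)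
      (measurableSet_Ico (a := _) (b := c))),
      ← integral_indicator (measurableSet_norm_mem (d := d) (measurableSet_Ioo (a := 0) (b := c)))]
    have hhm : Measurable h := measurable_quotPow ν (continuous_taylorRemainder hg N).measurable
    refine tendsto_integral_filter_of_dominated_convergence
      (fun y => ‖{y : EuclideanSpace ℝ (Fin d) | ‖y‖ ∈ Ioo 0 c}.indicator h y‖) ?_ ?_ hI2.norm ?_
    · exact Eventually.of_forall fun ε =>
        (hhm.indicator (measurableSet_norm_mem measurableSet_Ico)).aestronglyMeasurable
    · filter_upwards [self_mem_nhdsWithin] with ε hε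
      refine ae_of_all _ fun y => ?_
      by_cases hy : ‖y‖ ∈ Ico ε c
      · have hy2 : ‖y‖ ∈ Ioo 0 c := ⟨lt_of_lt_of_le hε hy.1, hy.2⟩
        rw [indicator_of_mem (by exact hy), indicator_of_mem (by exact hy2)]
      · rw [indicator_of_notMem (by exact hy), norm_zero]
        positivity
    · refine ae_of_all _ fun y => ?_
      refine tendsto_const_nhds.congr' ?_
      by_cases hy : 0 < ‖y‖
      · filter_upwards [Ioo_mem_nhdsGT hy] with ε hε
        by_cases hyc : ‖y‖ < c
        · rw [indicator_of_mem (show y ∈ {y | ‖y‖ ∈ Ico ε c} from ⟨hε.2.le, hyc⟩),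
            indicator_of_mem (show y ∈ {y | ‖y‖ ∈ Ioo 0 c} from ⟨hy, hyc⟩)]
        · rw [indicator_of_notMem (show y ∉ {y | ‖y‖ ∈ Ico ε c} from fun h => hyc h.2),
            indicator_of_notMem (show y ∉ {y | ‖y‖ ∈ Ioo 0 c} from fun h => hyc h.2)]
      · filter_upwards [self_mem_nhdsWithin] with ε hε
        rw [indicator_of_notMem (show y ∉ {y | ‖y‖ ∈ Ico ε c} from
            fun h => hy (lt_of_lt_of_le hε h.1)),
          indicator_of_notMem (show y ∉ {y | ‖y‖ ∈ Ioo 0 c} from fun h => hy h.1)]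
  have hlim2 := (hlim.const_add
    (∫ y in {y : EuclideanSpace ℝ (Fin d) | c ≤ ‖y‖}, quotPow ν g y)).add_const
    (∑ k ∈ Finset.range N, sphereIntegral (taylorTerm k g) * radialPrim d k ν c)
  rw [add_assoc] at hlim2
  refine hlim2.congr' ?_
  filter_upwards [Ioo_mem_nhdsGT (show (0 : ℝ) < min 1 c by positivity)] with ε hε
  have hε0 : 0 < ε := hε.1
  have hε1 : ε ≤ 1 := hε.2.le.trans (min_le_left _ _)
  have hεc : ε ≤ c := hε.2.le.trans (min_le_right _ _)
  rw [hadamardTruncated, hadamardCounterterm_eq hd ν hε0 hε1 g]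
  have hset : {y : EuclideanSpace ℝ (Fin d) | ε ≤ ‖y‖} =
      {y | ‖y‖ ∈ Ico ε c} ∪ {y | c ≤ ‖y‖} := by
    ext y
    simp only [mem_ofPred_eq, mem_union, mem_Ico]
    constructor
    · intro h
      rcases lt_or_ge ‖y‖ c with h2 | h2
      · exact Or.inl ⟨h, h2⟩
      · exact Or.inr h2
    · rintro (h | h)
      · exact h.1
      · exact hεc.trans h
  have hdisj : Disjoint {y : EuclideanSpace ℝ (Fin d) | ‖y‖ ∈ Ico ε c} {y | c ≤ ‖y‖} :=
    Set.disjoint_left.2 fun y h1 h2 => absurd h1.2 (not_lt.2 h2)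
  have hgI : IntegrableOn (quotPow ν g) {y | ‖y‖ ∈ Ico ε c} :=
    (hint ε hε0).mono_set fun y hy => hy.1
  rw [hset, setIntegral_union hdisj (measurableSet_norm_mem measurableSet_Ici) hgI (hint c hc)]
  have hsplit : ∫ y in {y : EuclideanSpace ℝ (Fin d) | ‖y‖ ∈ Ico ε c}, h y =
      (∫ y in {y : EuclideanSpace ℝ (Fin d) | ‖y‖ ∈ Ico ε c}, quotPow ν g y) -
      ∑ k ∈ Finset.range N, sphereIntegral (taylorTerm k g) *
        (radialPrim d k ν c - radialPrim d k ν ε) := by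
    have hTI : ∀ k ∈ Finset.range N, Integrable (quotPow ν (taylorTerm k g))
        (volume.restrict {y : EuclideanSpace ℝ (Fin d) | ‖y‖ ∈ Ico ε c}) := fun k _ =>
      integrableOn_quotPow_Ico_of_isHomogeneousFun hd ν hε0 (isHomogeneousFun_taylorTerm k g)
        (continuous_taylorTerm k g)
    simp only [hh, quotPow_sub_sum]
    rw [integral_sub hgI (integrable_finsetSum _ hTI), integral_finsetSum _ hTI]
    congr 1
    refine Finset.sum_congr rfl fun k _ => ?_
    rw [setIntegral_quotPow_of_isHomogeneousFun hd (isHomogeneousFun_taylorTerm k g) ν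
      measurableSet_Ico (fun r hr => hε0.trans_le hr.1),
      integral_Ico_cpow_eq_radialPrim_sub hε0 hεc]
  rw [hsplit]
  simp only [mul_sub, Finset.sum_sub_distrib]
  ring

end Hadamard

/-! ### The local part of the finite part -/

section HadamardLocal

open Set

variable {d : ℕ}

lemma sphereIntegral_add {f g : EuclideanSpace ℝ (Fin d) → ℂ} (hf : Continuous f)
    (hg : Continuous g) :
    sphereIntegral (fun y => f y + g y) = sphereIntegral f + sphereIntegral g := by
  have h : ∀ q : EuclideanSpace ℝ (Fin d) → ℂ, Continuous q → Integrable
      (fun x : Metric.sphere (0 : EuclideanSpace ℝ (Fin d)) 1 => q x)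
      (volume : Measure (EuclideanSpace ℝ (Fin d))).toSphere := fun q hq =>
    (hq.comp continuous_subtype_val).integrable_of_hasCompactSupport
      (HasCompactSupport.of_compactSpace _)
  exact integral_add (h f hf) (h g hg)

lemma norm_sphereIntegral_le {q : EuclideanSpace ℝ (Fin d) → ℂ} {M : ℝ}
    (hM : ∀ y, ‖y‖ = 1 → ‖q y‖ ≤ M) :
    ‖sphereIntegral q‖ ≤
      M * (volume : Measure (EuclideanSpace ℝ (Fin d))).toSphere.real Set.univ :=
  norm_integral_le_of_norm_le_const (ae_of_all _ fun x => hM _ (by simp))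

lemma quotPow_add (ν : ℂ) (f g : EuclideanSpace ℝ (Fin d) → ℂ) (y : EuclideanSpace ℝ (Fin d)) :
    quotPow ν (fun y => f y + g y) y = quotPow ν f y + quotPow ν g y := by
  simp only [quotPow, add_div]

lemma hadamardLocal_add (hd : 0 < d) (ν : ℂ) {c : ℝ} (hc : 0 < c)
    {f g : EuclideanSpace ℝ (Fin d) → ℂ} (hf : ContDiff ℝ ∞ f) (hg : ContDiff ℝ ∞ g) :
    hadamardLocal c ν (fun y => f y + g y) = hadamardLocal c ν f + hadamardLocal c ν g := by
  have hT : ∀ k, taylorTerm k (fun y => f y + g y) = fun y => taylorTerm k f y + taylorTerm k g y :=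
    fun k => funext fun y => taylorTerm_add hf hg k y
  have hfun : (fun y => (f y + g y) - ∑ k ∈ Finset.range (hadamardOrder d ν),
        taylorTerm k (fun y => f y + g y) y) =
      fun y => (f y - ∑ k ∈ Finset.range (hadamardOrder d ν), taylorTerm k f y) +
        (g y - ∑ k ∈ Finset.range (hadamardOrder d ν), taylorTerm k g y) := by
    funext y
    simp only [hT, Finset.sum_add_distrib]
    ring
  unfold hadamardLocal
  rw [hfun]
  simp only [quotPow_add]
  rw [integral_add (integrableOn_quotPow_taylorRemainder hd ν hc hf)
    (integrableOn_quotPow_taylorRemainder hd ν hc hg)]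
  simp only [hT, sphereIntegral_add (continuous_taylorTerm _ f) (continuous_taylorTerm _ g),
    add_mul, Finset.sum_add_distrib]
  ring

/-- The local part is continuous in the derivatives on the ball. -/
lemma exists_norm_hadamardLocal_le (hd : 0 < d) (ν : ℂ) {c : ℝ} (hc : 0 < c) :
    ∃ K : ℝ, ∀ g : EuclideanSpace ℝ (Fin d) → ℂ, ContDiff ℝ ∞ g → ∀ M : ℝ,
      (∀ j ≤ hadamardOrder d ν, ∀ y, ‖y‖ ≤ c → ‖iteratedFDeriv ℝ j g y‖ ≤ M) →
      ‖hadamardLocal c ν g‖ ≤ M * K := by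
  set N := hadamardOrder d ν
  refine ⟨(∫ y in {y : EuclideanSpace ℝ (Fin d) | ‖y‖ ∈ Ioo 0 c}, ‖y‖ ^ ((N : ℝ) - ν.re)) +
    ∑ k ∈ Finset.range N, (volume : Measure (EuclideanSpace ℝ (Fin d))).toSphere.real Set.univ *
      ‖radialPrim d k ν c‖, fun g hg M hM => ?_⟩
  unfold hadamardLocal
  rw [mul_add, Finset.mul_sum]
  refine (norm_add_le _ _).trans (add_le_add ?_ ((norm_sum_le _ _).trans
    (Finset.sum_le_sum fun k hk => ?_)))
  · exact norm_setIntegral_quotPow_le hd ν N measurableSet_Ioo (fun r hr => hr.1)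
      (integrableOn_radial_hadamardOrder ν hc le_rfl)
      (fun y hy => norm_sub_sum_taylorTerm_le hg _ (hM N le_rfl) hy.2.le)
  · rw [norm_mul, ← mul_assoc]
    refine mul_le_mul_of_nonneg_right (norm_sphereIntegral_le fun y hy => ?_) (norm_nonneg _)
    refine (norm_taylorTerm_le k g y).trans ?_
    rw [hy, one_pow, mul_one]
    exact hM k (Finset.mem_range.1 hk).le 0 (by simpa using hc.le)

/-- The surface integral of the homogeneous component of degree `k` of `P`. -/
def polySphereIntegral (P : MvPolynomial (Fin d) ℂ) (k : ℕ) : ℂ :=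
  sphereIntegral (polyFun (MvPolynomial.homogeneousComponent k P))

lemma polySphereIntegral_eq_zero {P : MvPolynomial (Fin d) ℂ} {k : ℕ} (h : P.totalDegree < k) :
    polySphereIntegral P k = 0 := by
  rw [polySphereIntegral, MvPolynomial.homogeneousComponent_eq_zero k P h]
  simp [sphereIntegral, polyFun]

lemma polyFun_eq_sum_of_lt {P : MvPolynomial (Fin d) ℂ} {n : ℕ} (hn : P.totalDegree < n)
    (y : EuclideanSpace ℝ (Fin d)) : polyFun P y =
      ∑ i ∈ Finset.range n, polyFun (MvPolynomial.homogeneousComponent i P) y := by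
  rw [polyFun_eq_sum_homogeneousComponent]
  refine Finset.sum_subset (Finset.range_subset_range.2 hn) fun i _ hi => ?_
  rw [MvPolynomial.homogeneousComponent_eq_zero i P (by simpa using hi)]
  simp [polyFun]

lemma isHomogeneousFun_polyFun {k : ℕ} {Q : MvPolynomial (Fin d) ℂ} (hQ : Q.IsHomogeneous k) :
    IsHomogeneousFun k (polyFun Q) := fun r y _ => polyFun_smul_of_isHomogeneous hQ r y

lemma continuous_polyFun (Q : MvPolynomial (Fin d) ℂ) : Continuous (polyFun Q) :=
  (contDiff_polyFun Q (n := 0)).continuous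

/-- For a polynomial, the terms of degree below the order are counterterms and the others are
integrated directly; the result is the same radial primitive in both cases. -/
lemma hadamardLocal_polyFun (hd : 0 < d) (ν : ℂ) {c : ℝ} (hc : 0 < c)
    (P : MvPolynomial (Fin d) ℂ) :
    hadamardLocal c ν (polyFun P) =
      ∑ k ∈ Finset.range (P.totalDegree + 1), polySphereIntegral P k * radialPrim d k ν c := by
  set N := hadamardOrder d ν with hN
  set n := max N (P.totalDegree + 1) with hn
  have hNn : N ≤ n := le_max_left _ _
  have hsum : ∑ k ∈ Finset.range (P.totalDegree + 1), polySphereIntegral P k * radialPrim d k ν c =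
      ∑ k ∈ Finset.range n, polySphereIntegral P k * radialPrim d k ν c := by
    refine Finset.sum_subset (Finset.range_subset_range.2 (le_max_right _ _)) fun i _ hi => ?_
    rw [polySphereIntegral_eq_zero (by simpa using hi), zero_mul]
  have hfun : ∀ y, quotPow ν (fun y => polyFun P y -
      ∑ k ∈ Finset.range N, taylorTerm k (polyFun P) y) y =
      ∑ k ∈ Finset.Ico N n, quotPow ν (polyFun (MvPolynomial.homogeneousComponent k P)) y := by
    intro y
    simp only [quotPow, ← Finset.sum_div]
    congr 1
    rw [Finset.sum_Ico_eq_sub _ hNn, ← polyFun_eq_sum_of_lt (by omega)]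
    simp only [taylorTerm_polyFun]
  have hhom : ∀ k, IsHomogeneousFun k (polyFun (MvPolynomial.homogeneousComponent k P)) := fun k =>
    isHomogeneousFun_polyFun (MvPolynomial.homogeneousComponent_isHomogeneous k P)
  have hint : ∀ k ∈ Finset.Ico N n,
      Integrable (quotPow ν (polyFun (MvPolynomial.homogeneousComponent k P)))
        (volume.restrict {y : EuclideanSpace ℝ (Fin d) | ‖y‖ ∈ Ioo 0 c}) := by
    intro k hk
    obtain ⟨M, hM0, hM⟩ := (hhom k).exists_norm_le (continuous_polyFun _)
    exact integrableOn_quotPow_of_norm_le hd ν k measurableSet_Ioo (fun r hr => hr.1)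
      (integrableOn_radial_hadamardOrder ν hc (Finset.mem_Ico.1 hk).1)
      (continuous_polyFun _).measurable (fun y hy => hM y hy.1)
  rw [hsum, hadamardLocal]
  simp only [← hN, hfun]
  rw [integral_finsetSum _ hint, ← Finset.sum_range_add_sum_Ico _ hNn, add_comm]
  congr 1
  · exact Finset.sum_congr rfl fun k _ => by rw [taylorTerm_polyFun, polySphereIntegral]
  · refine Finset.sum_congr rfl fun k hk => ?_
    rw [setIntegral_quotPow_of_isHomogeneousFun hd (hhom k) ν measurableSet_Ioo (fun r hr => hr.1),
      integral_Ioo_cpow_eq_radialPrim (lt_of_hadamardOrder_le (Finset.mem_Ico.1 hk).1) hc,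
      polySphereIntegral]

end HadamardLocal

/-! ### Removing the cut-off -/

section Regularised

open Set

variable {d : ℕ} (U : SchwartzMap (EuclideanSpace ℝ (Fin d)) ℂ) (P : MvPolynomial (Fin d) ℂ)
  {c : ℝ} {w : EuclideanSpace ℝ (Fin d) → ℝ}

/-- The local part of the finite part converges to its value at the polynomial. -/
lemma tendsto_hadamardLocal_dilation (hd : 0 < d) (ν : ℂ) (hc : 0 < c) (hU : U 0 = 1) :
    Tendsto (fun β : ℝ => hadamardLocal c ν (fun y => U (β • y) * polyFun P y)) (𝓝[>] 0)
      (𝓝 (∑ k ∈ Finset.range (P.totalDegree + 1),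
        polySphereIntegral P k * radialPrim d k ν c)) := by
  rw [← hadamardLocal_polyFun hd ν hc]
  obtain ⟨K, hK⟩ := exists_norm_hadamardLocal_le hd ν hc
  obtain ⟨M, D, hD⟩ := exists_isSymbol_polyFun P
  obtain ⟨C, hC⟩ := exists_isSymbol_dilation_sub U
  set N := hadamardOrder d ν
  set B := ∑ j ∈ Finset.range (N + 1), leibnizConst C D j * (1 + c) ^ (|1 + M|) with hB
  rw [tendsto_iff_norm_sub_tendsto_zero]
  have hlim : Tendsto (fun β : ℝ => β * B * K) (𝓝[>] 0) (𝓝 0) := by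
    have : Continuous fun β : ℝ => β * B * K := by fun_prop
    simpa using (this.tendsto 0).mono_left nhdsWithin_le_nhds
  refine squeeze_zero' (Eventually.of_forall fun _ => norm_nonneg _) ?_ hlim
  filter_upwards [Ioo_mem_nhdsGT one_pos] with β hβ
  have hs := (hC β hβ.1 hβ.2.le).mul hD
  rw [leibnizConst_mul_left] at hs
  have hpos : ∀ j, 0 ≤ leibnizConst C D j := by
    have := (hC 1 one_pos le_rfl).mul hD
    simp only [one_mul] at this
    exact this.const_nonneg
  have hfun : (fun y => U (β • y) * polyFun P y) =
      fun y => (U (β • y) - U 0) * polyFun P y + polyFun P y := by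
    funext y
    rw [hU]; ring
  rw [hfun, hadamardLocal_add hd ν hc hs.1 (contDiff_polyFun P), add_sub_cancel_right]
  refine hK _ hs.1 _ fun j hj y hy => (hs.2 j y).trans ?_
  have h1 : (1 + ‖y‖) ^ (1 + M - j) ≤ (1 + c) ^ |1 + M| := by
    have h0 := norm_nonneg y
    calc (1 + ‖y‖) ^ (1 + M - j) ≤ (1 + ‖y‖) ^ |1 + M| := by
          refine Real.rpow_le_rpow_of_exponent_le (by linarith) ?_
          have : (0 : ℝ) ≤ j := Nat.cast_nonneg j
          linarith [le_abs_self (1 + M)]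
      _ ≤ _ := by gcongr
  rw [mul_assoc]
  refine mul_le_mul_of_nonneg_left ?_ hβ.1.le
  calc leibnizConst C D j * (1 + ‖y‖) ^ (1 + M - j)
      ≤ leibnizConst C D j * (1 + c) ^ |1 + M| := mul_le_mul_of_nonneg_left h1 (hpos j)
    _ ≤ B := Finset.single_le_sum (f := fun j => leibnizConst C D j * (1 + c) ^ |1 + M|)
        (fun i _ => mul_nonneg (hpos i) (by positivity)) (Finset.mem_range.2 (by omega))

lemma quotPow_eq_mul_weight (hc : 0 < c) (hw : IsWeight c w) (ν : ℂ)
    (g : EuclideanSpace ℝ (Fin d) → ℂ) {y : EuclideanSpace ℝ (Fin d)} (hy : c ≤ ‖y‖) :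
    quotPow ν g y = g y * (w y : ℂ) ^ (-ν / 2) := by
  have hpos : 0 < ‖y‖ := hc.trans_le hy
  have hne : (‖y‖ : ℂ) ≠ 0 := by exact_mod_cast hpos.ne'
  have h1 : ((w y : ℝ) : ℂ) = (‖y‖ : ℂ) ^ (2 : ℕ) := by
    rw [hw.eq_norm_sq y hy]; push_cast; rfl
  have harg : (‖y‖ : ℂ).arg = 0 := Complex.arg_ofReal_of_nonneg hpos.le
  rw [quotPow, h1, ← Complex.cpow_nat_mul']
  · rw [show ((2 : ℕ) : ℂ) * (-ν / 2) = -ν by push_cast; ring, Complex.cpow_neg, div_eq_mul_inv]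
  · rw [harg]; simpa using Real.pi_pos
  · rw [harg]; simpa using Real.pi_pos.le

lemma integrableOn_quotPow_dilation {β : ℝ} (hβ : 0 < β) (ν : ℂ) {ε : ℝ} (hε : 0 < ε) :
    IntegrableOn (quotPow ν (fun y => U (β • y) * polyFun P y))
      {y : EuclideanSpace ℝ (Fin d) | ε ≤ ‖y‖} := by
  obtain ⟨w, hw⟩ := exists_isWeight (d := d) hε
  refine (hasDecay_cutTerm U P hw hβ ν).integrable.integrableOn.congr_fun (fun y hy => ?_)
    (measurableSet_norm_mem measurableSet_Ici)
  exact (quotPow_eq_mul_weight hε hw ν (fun y => U (β • y) * polyFun P y) hy).symm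

variable (Λ : Submodule ℤ (EuclideanSpace ℝ (Fin d))) [DiscreteTopology Λ] [IsZLattice ℝ Λ]

omit [IsZLattice ℝ Λ] in
lemma exists_le_norm_of_mem_lattice :
    ∃ c : ℝ, 0 < c ∧ ∀ z ∈ Λ, z ≠ 0 → c ≤ ‖z‖ := by
  have h := Metric.isOpen_iff.1 (isOpen_discrete ({0} : Set Λ)) 0 rfl
  obtain ⟨c, hc, hb⟩ := h
  refine ⟨c, hc, fun z hz hz0 => ?_⟩
  by_contra hlt
  have : (⟨z, hz⟩ : Λ) ∈ Metric.ball (0 : Λ) c := by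
    rw [mem_ball_zero_iff]
    exact not_le.1 hlt
  have h2 := hb this
  exact hz0 (by simpa using congrArg Subtype.val (show (⟨z, hz⟩ : Λ) = 0 from h2))

/-- The index set of the Dirichlet series as the complement of zero in the lattice. -/
def nonzeroLatticeEquiv :
    {z : EuclideanSpace ℝ (Fin d) // z ∈ Λ ∧ z ≠ 0} ≃ {z : Λ // z ≠ 0} where
  toFun z := ⟨⟨z.1, z.2.1⟩, fun h => z.2.2 (congrArg Subtype.val h)⟩
  invFun z := ⟨z.1, z.1.2, fun h => z.2 (Subtype.ext h)⟩
  left_inv _ := rfl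
  right_inv _ := rfl

variable {Λ}

lemma summable_quotPow_dilation (hc : 0 < c) (hcΛ : ∀ z ∈ Λ, z ≠ 0 → c ≤ ‖z‖)
    (hw : IsWeight c w) {β : ℝ} (hβ : 0 < β) (ν : ℂ) :
    Summable (fun z : {z : EuclideanSpace ℝ (Fin d) // z ∈ Λ ∧ z ≠ 0} =>
      quotPow ν (fun z => U (β • z) * polyFun P z) z) := by
  have h := ((hasDecay_cutTerm U P hw hβ ν).summable Λ 0)
  simp only [zero_add] at h
  have h2 := (h.subtype {z : Λ | z ≠ 0})
  have h3 := (nonzeroLatticeEquiv Λ).summable_iff.2 h2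
  refine h3.congr fun z => ?_
  exact (quotPow_eq_mul_weight hc hw ν (fun y => U (β • y) * polyFun P y)
    (hcΛ z.1 z.2.1 z.2.2)).symm

lemma tsum_quotPow_dilation (hc : 0 < c) (hcΛ : ∀ z ∈ Λ, z ≠ 0 → c ≤ ‖z‖)
    (hw : IsWeight c w) {β : ℝ} (hβ : 0 < β) (ν : ℂ) :
    ∑' z : {z : EuclideanSpace ℝ (Fin d) // z ∈ Λ ∧ z ≠ 0},
      quotPow ν (fun z => U (β • z) * polyFun P z) z =
    ∑' z : Λ, cutTerm U P w β ν (0 + z) - cutTerm U P w β ν 0 := by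
  have h := ((hasDecay_cutTerm U P hw hβ ν).summable Λ 0)
  have h1 := h.sum_add_tsum_subtype_compl {0}
  simp only [zero_add, Finset.sum_singleton, ZeroMemClass.coe_zero] at h1 ⊢
  rw [← h1, add_sub_cancel_left]
  have h2 : ∑' z : {z : Λ // z ≠ 0}, cutTerm U P w β ν z =
      ∑' z : {z : Λ // z ∉ ({0} : Finset Λ)}, cutTerm U P w β ν z := by
    refine (Equiv.subtypeEquivRight (p := fun z : Λ => z ≠ 0)
      (q := fun z => z ∉ ({0} : Finset Λ)) (by simp)).tsum_eq
      (fun z : {z : Λ // z ∉ ({0} : Finset Λ)} => cutTerm U P w β ν z)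
  rw [← h2, ← (nonzeroLatticeEquiv Λ).tsum_eq]
  refine tsum_congr fun z => ?_
  exact (quotPow_eq_mul_weight hc hw ν _ (hcΛ z.1 z.2.1 z.2.2))

lemma tendsto_hadamardTruncated_dilation (hd : 0 < d) (hc : 0 < c) {β : ℝ} (hβ : 0 < β) (ν : ℂ) :
    Tendsto (hadamardTruncated ν (fun y => U (β • y) * polyFun P y)) (𝓝[>] 0)
      (𝓝 ((∫ y in {y : EuclideanSpace ℝ (Fin d) | c ≤ ‖y‖},
        quotPow ν (fun y => U (β • y) * polyFun P y) y) +
        hadamardLocal c ν (fun y => U (β • y) * polyFun P y))) :=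
  tendsto_hadamardTruncated hd ν hc
    (exists_isSymbol_dilation_mul_polyFun U P hβ 0).choose_spec.1
    (fun _ hε => integrableOn_quotPow_dilation U P hβ ν hε)

lemma hadamardIntegral_dilation (hd : 0 < d) (hc : 0 < c) {β : ℝ} (hβ : 0 < β) (ν : ℂ) :
    hadamardIntegral ν (fun y => U (β • y) * polyFun P y) =
      (∫ y in {y : EuclideanSpace ℝ (Fin d) | c ≤ ‖y‖},
        quotPow ν (fun y => U (β • y) * polyFun P y) y) +
        hadamardLocal c ν (fun y => U (β • y) * polyFun P y) :=
  (tendsto_hadamardTruncated_dilation U P hd hc hβ ν).limUnder_eq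

/-- The Hadamard sum-integral as a lattice defect plus terms from the ball of radius `c`. -/
lemma hadamardSumIntegral_dilation (hd : 0 < d) (hc : 0 < c) (hcΛ : ∀ z ∈ Λ, z ≠ 0 → c ≤ ‖z‖)
    (hw : IsWeight c w) {β : ℝ} (hβ : 0 < β) (ν : ℂ) :
    hadamardSumIntegral Λ ν (fun y => U (β • y) * polyFun P y) =
      latticeDefect Λ (cutTerm U P w β ν) 0 - cutTerm U P w β ν 0 +
        (ZLattice.covolume Λ : ℂ)⁻¹ *
          ((∫ y in Metric.ball (0 : EuclideanSpace ℝ (Fin d)) c, cutTerm U P w β ν y) -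
            hadamardLocal c ν (fun y => U (β • y) * polyFun P y)) := by
  have hI := (hasDecay_cutTerm U P hw hβ ν).integrable
  have h1 : ∫ y in {y : EuclideanSpace ℝ (Fin d) | c ≤ ‖y‖},
      quotPow ν (fun y => U (β • y) * polyFun P y) y =
      (∫ y, cutTerm U P w β ν y) -
        ∫ y in Metric.ball (0 : EuclideanSpace ℝ (Fin d)) c, cutTerm U P w β ν y := by
    have hcompl : {y : EuclideanSpace ℝ (Fin d) | c ≤ ‖y‖} = (Metric.ball 0 c)ᶜ := by
      ext y; simp
    rw [eq_sub_iff_add_eq, ← integral_add_compl (measurableSet_ball (x := 0) (ε := c)) hI, hcompl,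
      add_comm]
    congr 1
    refine setIntegral_congr_fun measurableSet_ball.compl fun y hy => ?_
    exact quotPow_eq_mul_weight hc hw ν _ (by simpa using hy)
  rw [hadamardSumIntegral, tsum_quotPow_dilation U P hc hcΛ hw hβ ν,
    hadamardIntegral_dilation U P hd hc hβ ν, h1, latticeDefect, Complex.real_smul]
  push_cast
  ring

lemma tendsto_integral_ball_cutTerm (hw : IsWeight c w) (hU : U 0 = 1) (ν : ℂ) :
    Tendsto (fun β : ℝ => ∫ y in Metric.ball (0 : EuclideanSpace ℝ (Fin d)) c,
      cutTerm U P w β ν y) (𝓝[>] 0)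
      (𝓝 (∫ y in Metric.ball (0 : EuclideanSpace ℝ (Fin d)) c,
        polyFun P y * (w y : ℂ) ^ (-ν / 2))) := by
  obtain ⟨C, hC⟩ := U.exists_isSymbol 0
  have hcont : Continuous fun y => polyFun P y * (w y : ℂ) ^ (-ν / 2) :=
    (continuous_polyFun P).mul (hw.contDiff_cpow _).continuous
  have hI : IntegrableOn (fun y => polyFun P y * (w y : ℂ) ^ (-ν / 2)) (Metric.ball 0 c) :=
    (hcont.continuousOn.integrableOn_compact (isCompact_closedBall 0 c)).mono_set
      Metric.ball_subset_closedBall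
  refine tendsto_integral_filter_of_dominated_convergence
    (fun y => C 0 * ‖polyFun P y * (w y : ℂ) ^ (-ν / 2)‖) ?_ ?_ (hI.norm.const_mul _) ?_
  · refine Eventually.of_forall fun β => Continuous.aestronglyMeasurable ?_
    exact ((U.continuous.comp (continuous_const_smul β)).mul (continuous_polyFun P)).mul
      (hw.contDiff_cpow _).continuous
  · refine Eventually.of_forall fun β => ae_of_all _ fun y => ?_
    rw [cutTerm, mul_assoc, norm_mul]
    gcongr
    simpa using hC.norm_le (β • y)
  · refine ae_of_all _ fun y => ?_
    have h1 : Continuous fun β : ℝ => U (β • y) :=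
      U.continuous.comp (continuous_id.smul continuous_const)
    have h2 : Tendsto (fun β : ℝ => U (β • y)) (𝓝[>] 0) (𝓝 1) := by
      have := (h1.tendsto 0).mono_left (nhdsWithin_le_nhds (s := Ioi 0))
      simpa [hU] using this
    have := (h2.mul_const (polyFun P y)).mul_const ((w y : ℂ) ^ (-ν / 2))
    simpa [cutTerm] using this

/-- The regularised sum-integral, as the limit of the cut-off ones, is an entire function minus
finitely many explicit radial primitives. -/
theorem exists_differentiable_tendsto_hadamardSumIntegral (hd : 0 < d) (hc : 0 < c)
    (hcΛ : ∀ z ∈ Λ, z ≠ 0 → c ≤ ‖z‖) (hU : U 0 = 1) :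
    ∃ H : ℂ → ℂ, Differentiable ℂ H ∧ ∀ ν : ℂ,
      Tendsto (fun β : ℝ => hadamardSumIntegral Λ ν (fun y => U (β • y) * polyFun P y)) (𝓝[>] 0)
        (𝓝 (H ν - (ZLattice.covolume Λ : ℂ)⁻¹ * ∑ k ∈ Finset.range (P.totalDegree + 1),
          polySphereIntegral P k * radialPrim d k ν c)) := by
  obtain ⟨w, hw⟩ := exists_isWeight (d := d) hc
  obtain ⟨E, hE, hEt⟩ := exists_differentiable_tendsto_latticeDefect U P Λ hw
  refine ⟨fun ν => E ν - polyFun P 0 + (ZLattice.covolume Λ : ℂ)⁻¹ *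
    ∫ y in Metric.ball (0 : EuclideanSpace ℝ (Fin d)) c, polyFun P y * (w y : ℂ) ^ (-ν / 2), ?_,
    fun ν => ?_⟩
  · refine (hE.sub_const _).add (Differentiable.const_mul ?_ _)
    refine differentiable_integral_mul_cpow (fun y => hw.pos y) hw.continuous.measurable fun ν => ?_
    have hcont : Continuous fun y => polyFun P y * (w y : ℂ) ^ (-ν / 2) :=
      (continuous_polyFun P).mul (hw.contDiff_cpow _).continuous
    exact (hcont.continuousOn.integrableOn_compact (isCompact_closedBall 0 c)).mono_set
      Metric.ball_subset_closedBall
  · have h0 : ∀ β : ℝ, cutTerm U P w β ν 0 = polyFun P 0 := by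
      intro β
      simp [cutTerm, hU, hw.map_zero]
    have h := ((hEt ν).sub_const (polyFun P 0)).add
      (((tendsto_integral_ball_cutTerm U P hw hU ν).sub
        (tendsto_hadamardLocal_dilation U P hd ν hc hU)).const_mul (ZLattice.covolume Λ : ℂ)⁻¹)
    rw [mul_sub, ← add_sub_assoc] at h
    refine h.congr' ?_
    filter_upwards [self_mem_nhdsWithin] with β hβ
    rw [hadamardSumIntegral_dilation U P hd hc hcΛ hw hβ ν, h0]

end Regularised

/-! ### Spherical integrals of polynomials and powers of the Laplacian -/

section Pizzetti

open Set

variable {d : ℕ}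

/-- The Laplacian on complex polynomials. -/
def polyLaplacian (d : ℕ) : MvPolynomial (Fin d) ℂ →ₗ[ℂ] MvPolynomial (Fin d) ℂ :=
  ∑ i, (MvPolynomial.pderiv i).toLinearMap ∘ₗ (MvPolynomial.pderiv i).toLinearMap

lemma polyLaplacian_apply (P : MvPolynomial (Fin d) ℂ) :
    polyLaplacian d P = ∑ i, MvPolynomial.pderiv i (MvPolynomial.pderiv i P) := by
  simp [polyLaplacian]

lemma polyFun_sum {ι : Type*} (s : Finset ι) (p : ι → MvPolynomial (Fin d) ℂ)
    (y : EuclideanSpace ℝ (Fin d)) : polyFun (∑ i ∈ s, p i) y = ∑ i ∈ s, polyFun (p i) y := by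
  simp [polyFun]

lemma differentiable_polyFun (P : MvPolynomial (Fin d) ℂ) : Differentiable ℝ (polyFun P) :=
  (contDiff_polyFun P (n := 1)).differentiable one_ne_zero

lemma fderiv_polyFun_single (P : MvPolynomial (Fin d) ℂ) (i : Fin d)
    (y : EuclideanSpace ℝ (Fin d)) :
    fderiv ℝ (polyFun P) y (EuclideanSpace.single i 1) =
      polyFun (MvPolynomial.pderiv i P) y := by
  induction P using MvPolynomial.induction_on with
  | C a => rw [polyFun_C]; simp [polyFun]
  | add p q hp hq =>
    rw [polyFun_add, fderiv_fun_add (differentiable_polyFun p y) (differentiable_polyFun q y),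
      map_add, polyFun_add, add_apply, hp, hq]
  | mul_X p j hp =>
    have hX : HasFDerivAt (polyFun (MvPolynomial.X j : MvPolynomial (Fin d) ℂ))
        (Complex.ofRealCLM.comp (EuclideanSpace.proj j : EuclideanSpace ℝ (Fin d) →L[ℝ] ℝ)) y := by
      rw [polyFun_X]
      exact (Complex.ofRealCLM.comp
        (EuclideanSpace.proj j : EuclideanSpace ℝ (Fin d) →L[ℝ] ℝ)).hasFDerivAt
    rw [polyFun_mul, fderiv_fun_mul (differentiable_polyFun p y) (differentiable_polyFun _ y),
      hX.fderiv, MvPolynomial.pderiv_mul, polyFun_add, polyFun_mul, polyFun_mul]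
    simp only [add_apply, smul_apply, hp, smul_eq_mul, ContinuousLinearMap.comp_apply,
      Complex.ofRealCLM_apply, PiLp.proj_apply, MvPolynomial.pderiv_X]
    rcases eq_or_ne i j with rfl | hij
    · simp [polyFun]
      ring
    · simp [polyFun, hij.symm]
      ring

lemma laplacian_polyFun (P : MvPolynomial (Fin d) ℂ) :
    Laplacian.laplacian (polyFun P) = polyFun (polyLaplacian d P) := by
  rw [InnerProductSpace.laplacian_eq_iteratedFDeriv_orthonormalBasis _
    (EuclideanSpace.basisFun (Fin d) ℝ)]
  funext y
  rw [polyLaplacian_apply, polyFun_sum]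
  refine Finset.sum_congr rfl fun i _ => ?_
  rw [iteratedFDeriv_two_apply, ← fderiv_polyFun_single]
  have h : polyFun (MvPolynomial.pderiv i P) =
      fun y => fderiv ℝ (polyFun P) y (EuclideanSpace.single i 1) :=
    funext fun y => (fderiv_polyFun_single P i y).symm
  have hd' : DifferentiableAt ℝ (fderiv ℝ (polyFun P)) y :=
    ((contDiff_polyFun P (n := 2)).fderiv_right (m := 1) (by norm_num)).differentiable
      one_ne_zero y
  rw [h, fderiv_clm_apply hd' (differentiableAt_const _)]
  simp

lemma polyLaplaceAtZero_eq (P : MvPolynomial (Fin d) ℂ) (j : ℕ) :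
    polyLaplaceAtZero P j = polyFun ((polyLaplacian d ^ j) P) 0 := by
  have h : ∀ (j : ℕ) (P : MvPolynomial (Fin d) ℂ),
      (Laplacian.laplacian : (EuclideanSpace ℝ (Fin d) → ℂ) → _)^[j] (polyFun P) =
        polyFun ((polyLaplacian d ^ j) P) := by
    intro j
    induction j with
    | zero => intro P; simp
    | succ j ih =>
      intro P
      rw [Function.iterate_succ_apply, laplacian_polyFun, ih, pow_succ, Module.End.mul_apply]
  rw [polyLaplaceAtZero, h]

lemma isHomogeneous_polyLaplacian {Q : MvPolynomial (Fin d) ℂ} {k : ℕ} (hQ : Q.IsHomogeneous k) :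
    (polyLaplacian d Q).IsHomogeneous (k - 2) := by
  rw [polyLaplacian_apply]
  exact MvPolynomial.IsHomogeneous.sum _ _ _ fun i _ => hQ.pderiv.pderiv

lemma polyLaplacian_eq_zero {Q : MvPolynomial (Fin d) ℂ} {k : ℕ} (hQ : Q.IsHomogeneous k)
    (hk : k < 2) : polyLaplacian d Q = 0 := by
  rw [polyLaplacian_apply]
  refine Finset.sum_eq_zero fun i _ => ?_
  have h : (MvPolynomial.pderiv i Q).IsHomogeneous 0 := by
    have := hQ.pderiv (i := i)
    rwa [show k - 1 = 0 by omega] at this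
  rw [MvPolynomial.totalDegree_eq_zero_iff_eq_C.1
    ((MvPolynomial.totalDegree_zero_iff_isHomogeneous _).2 h), MvPolynomial.pderiv_C]

lemma polyFun_zero_of_isHomogeneous {Q : MvPolynomial (Fin d) ℂ} {k : ℕ} (hQ : Q.IsHomogeneous k)
    (hk : k ≠ 0) : polyFun Q 0 = 0 := by
  have := polyFun_smul_of_isHomogeneous hQ 0 0
  simpa [hk] using this

lemma polyFun_polyLaplacian_pow_zero {j k : ℕ} (hjk : k ≠ 2 * j) {Q : MvPolynomial (Fin d) ℂ}
    (hQ : Q.IsHomogeneous k) : polyFun ((polyLaplacian d ^ j) Q) 0 = 0 := by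
  induction j generalizing k Q with
  | zero => simpa using polyFun_zero_of_isHomogeneous hQ (by omega)
  | succ j ih =>
    rw [pow_succ, Module.End.mul_apply]
    rcases lt_or_ge k 2 with hk | hk
    · rw [polyLaplacian_eq_zero hQ hk, map_zero]
      simp [polyFun]
    · exact ih (by omega) (isHomogeneous_polyLaplacian hQ)

/-- Each Laplacian lowers the degree by two, so only the homogeneous component of degree `2j`
contributes to `Δ^j P (0)`. -/
lemma polyLaplaceAtZero_eq_homogeneousComponent (P : MvPolynomial (Fin d) ℂ) (j : ℕ) :
    polyLaplaceAtZero P j =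
      polyFun ((polyLaplacian d ^ j) (MvPolynomial.homogeneousComponent (2 * j) P)) 0 := by
  rw [polyLaplaceAtZero_eq]
  conv_lhs => rw [← MvPolynomial.sum_homogeneousComponent P, map_sum, polyFun_sum]
  refine Finset.sum_eq_single _ (fun k _ hk => polyFun_polyLaplacian_pow_zero hk
    (MvPolynomial.homogeneousComponent_isHomogeneous k P)) fun hj => ?_
  rw [MvPolynomial.homogeneousComponent_eq_zero _ P (by simpa using hj), map_zero]
  simp [polyFun]

/-- The Gaussian weight as a function of the radius. -/
def gaussianRadial (r : ℝ) : ℂ := (Real.exp (-(1 / 2) * r ^ 2) : ℝ)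

/-- The integral of a polynomial against the Gaussian weight. -/
def gaussianIntegral (Q : MvPolynomial (Fin d) ℂ) : ℂ :=
  ∫ y : EuclideanSpace ℝ (Fin d), gaussianRadial ‖y‖ * polyFun Q y

lemma hasFDerivAt_gaussianRadial_norm (y : EuclideanSpace ℝ (Fin d)) :
    HasFDerivAt (fun y : EuclideanSpace ℝ (Fin d) => gaussianRadial ‖y‖)
      (Complex.ofRealCLM.comp (Real.exp (-(1 / 2) * ‖y‖ ^ 2) •
        ((-(1 / 2) : ℝ) • (2 • innerSL ℝ y)))) y := by
  exact Complex.ofRealCLM.hasFDerivAt.comp y 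
    ((hasStrictFDerivAt_norm_sq y).hasFDerivAt.const_mul (-(1 / 2))).exp

lemma fderiv_gaussianRadial_single (y : EuclideanSpace ℝ (Fin d)) (i : Fin d) :
    fderiv ℝ (fun y : EuclideanSpace ℝ (Fin d) => gaussianRadial ‖y‖) y
      (EuclideanSpace.single i 1) = -((y i : ℂ) * gaussianRadial ‖y‖) := by
  rw [(hasFDerivAt_gaussianRadial_norm y).fderiv]
  simp [gaussianRadial, EuclideanSpace.inner_single_right]
  ring

/-- The Gaussian weight decays faster than any power. -/
lemma exists_norm_gaussianRadial_le (n : ℕ) :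
    ∃ K : ℝ, 0 ≤ K ∧ ∀ r : ℝ, 0 ≤ r → ‖gaussianRadial r‖ ≤ K * (1 + r) ^ (-(n : ℝ)) := by
  refine ⟨Real.exp (1 / 2) * (n.factorial * 4 ^ n), by positivity, fun r hr => ?_⟩
  have h0 : (0 : ℝ) < 1 + r := by linarith
  have h1 := Real.pow_div_factorial_le_exp ((1 + r) / 4) (by positivity) n
  -- The exponents differ by `(r - 1/4) ^ 2 / 2` plus a positive constant.
  have h2 : Real.exp (-(1 / 2) * r ^ 2) ≤ Real.exp (1 / 2) * Real.exp (-((1 + r) / 4)) := by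
    rw [← Real.exp_add, Real.exp_le_exp]
    nlinarith [sq_nonneg (r - 1 / 4)]
  rw [gaussianRadial, Complex.norm_real, Real.norm_of_nonneg (Real.exp_pos _).le]
  refine h2.trans ?_
  rw [mul_assoc, Real.rpow_neg h0.le, Real.rpow_natCast, Real.exp_neg]
  refine mul_le_mul_of_nonneg_left ?_ (Real.exp_pos _).le
  rw [← div_eq_mul_inv, inv_le_comm₀ (Real.exp_pos _) (by positivity), inv_div]
  refine le_trans (le_of_eq ?_) h1
  rw [div_pow]
  field_simp

lemma continuous_gaussianRadial : Continuous gaussianRadial := by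
  unfold gaussianRadial
  fun_prop

lemma integrable_gaussianRadial_mul (Q : MvPolynomial (Fin d) ℂ) :
    Integrable fun y : EuclideanSpace ℝ (Fin d) => gaussianRadial ‖y‖ * polyFun Q y := by
  obtain ⟨C, hC0, hC⟩ := exists_norm_polyFun_le Q
  obtain ⟨K, hK0, hK⟩ := exists_norm_gaussianRadial_le (Q.totalDegree + (d + 1))
  have hint : Integrable fun y : EuclideanSpace ℝ (Fin d) =>
      K * C * (1 + ‖y‖) ^ (-((d : ℝ) + 1)) :=
    (integrable_one_add_norm (by simp)).const_mul _
  refine hint.mono' ((continuous_gaussianRadial.comp continuous_norm).mul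
    (continuous_polyFun Q)).aestronglyMeasurable (ae_of_all _ fun y => ?_)
  have h0 : (0 : ℝ) < 1 + ‖y‖ := by positivity
  rw [norm_mul]
  refine (mul_le_mul (hK _ (norm_nonneg y)) (hC y) (norm_nonneg _) (by positivity)).trans
    (le_of_eq ?_)
  rw [← Real.rpow_natCast (1 + ‖y‖) Q.totalDegree, mul_mul_mul_comm, ← Real.rpow_add h0]
  congr 2
  push_cast
  ring

/-- Integration by parts against the Gaussian weight. -/
lemma gaussianIntegral_pderiv (Q : MvPolynomial (Fin d) ℂ) (i : Fin d) :
    gaussianIntegral (MvPolynomial.pderiv i Q) = gaussianIntegral (MvPolynomial.X i * Q) := by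
  have h1 : ∀ y, gaussianRadial ‖y‖ * polyFun (MvPolynomial.pderiv i Q) y =
      gaussianRadial ‖y‖ * fderiv ℝ (polyFun Q) y (EuclideanSpace.single i 1) := fun y => by
    rw [fderiv_polyFun_single]
  have h2 : ∀ y, gaussianRadial ‖y‖ * polyFun (MvPolynomial.X i * Q) y =
      -(fderiv ℝ (fun y : EuclideanSpace ℝ (Fin d) => gaussianRadial ‖y‖) y
        (EuclideanSpace.single i 1) * polyFun Q y) := fun y => by
    rw [fderiv_gaussianRadial_single, polyFun_mul, polyFun_X]
    ring
  rw [gaussianIntegral, gaussianIntegral]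
  have i1 := integrable_gaussianRadial_mul (MvPolynomial.pderiv i Q)
  have i2 := (integrable_gaussianRadial_mul (MvPolynomial.X i * Q)).neg
  simp only [h1] at i1 ⊢
  simp only [Pi.neg_def, h2, neg_neg] at i2 ⊢
  rw [integral_neg]
  exact integral_mul_fderiv_eq_neg_fderiv_mul_of_integrable i2 i1 (integrable_gaussianRadial_mul Q)
    (fun y _ => (hasFDerivAt_gaussianRadial_norm y).differentiableAt)
    (fun y _ => differentiable_polyFun Q y)

lemma gaussianIntegral_sum {ι : Type*} (s : Finset ι) (p : ι → MvPolynomial (Fin d) ℂ) :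
    gaussianIntegral (∑ i ∈ s, p i) = ∑ i ∈ s, gaussianIntegral (p i) := by
  simp only [gaussianIntegral, polyFun_sum, Finset.mul_sum]
  exact integral_finsetSum _ fun i _ => integrable_gaussianRadial_mul (p i)

/-- By Euler's identity, the Laplacian acts on Gaussian integrals as the degree. -/
lemma gaussianIntegral_polyLaplacian {Q : MvPolynomial (Fin d) ℂ} {k : ℕ}
    (hQ : Q.IsHomogeneous k) :
    gaussianIntegral (polyLaplacian d Q) = k * gaussianIntegral Q := by
  rw [polyLaplacian_apply, gaussianIntegral_sum]
  simp only [gaussianIntegral_pderiv]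
  rw [← gaussianIntegral_sum, hQ.sum_X_mul_pderiv, gaussianIntegral, gaussianIntegral,
    ← integral_const_mul]
  refine integral_congr_ae (ae_of_all _ fun y => ?_)
  simp only [polyFun, nsmul_eq_mul, map_mul, map_natCast]
  ring

/-- The moments of the Gaussian weight on the half-line. -/
def gaussianMoment (n : ℕ) : ℂ := ∫ r in Ioi (0 : ℝ), (r : ℂ) ^ n * gaussianRadial r

lemma gaussianMoment_eq (n : ℕ) : gaussianMoment n =
    (((1 / 2 : ℝ) ^ (-((n : ℝ) + 1) / 2) * (1 / 2) * Real.Gamma (((n : ℝ) + 1) / 2) : ℝ) : ℂ) := by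
  rw [← integral_rpow_mul_exp_neg_mul_rpow two_pos
    (by linarith [Nat.cast_nonneg (α := ℝ) n]) (by norm_num), ← integral_complex_ofReal]
  refine setIntegral_congr_fun measurableSet_Ioi fun r _ => ?_
  simp only [gaussianRadial, Real.rpow_natCast, Real.rpow_ofNat]
  push_cast
  ring_nf

lemma gaussianMoment_ne_zero (n : ℕ) : gaussianMoment n ≠ 0 := by
  rw [gaussianMoment_eq, Complex.ofReal_ne_zero]
  have := Real.Gamma_pos_of_pos (show (0 : ℝ) < ((n : ℝ) + 1) / 2 by positivity)
  positivity

lemma gaussianMoment_add_two (n : ℕ) : gaussianMoment (n + 2) = (n + 1) * gaussianMoment n := by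
  rw [gaussianMoment_eq, gaussianMoment_eq]
  have h1 : (((n + 2 : ℕ) : ℝ) + 1) / 2 = ((n : ℝ) + 1) / 2 + 1 := by push_cast; ring
  have h2 : -(((n + 2 : ℕ) : ℝ) + 1) / 2 = -((n : ℝ) + 1) / 2 - 1 := by push_cast; ring
  rw [h1, h2, Real.Gamma_add_one (by positivity), Real.rpow_sub_one (by norm_num)]
  push_cast
  ring

lemma gaussianIntegral_of_isHomogeneous (hd : 0 < d) {Q : MvPolynomial (Fin d) ℂ} {k : ℕ}
    (hQ : Q.IsHomogeneous k) :
    gaussianIntegral Q = sphereIntegral (polyFun Q) * gaussianMoment (k + (d - 1)) :=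
  integral_norm_mul_of_isHomogeneousFun hd (isHomogeneousFun_polyFun hQ) gaussianRadial

/-- Comparing the Gaussian integrals of `ΔQ` and `Q` in polar coordinates, where two moments differ
by the factor `k + d`. -/
lemma sphereIntegral_polyLaplacian (hd : 0 < d) {Q : MvPolynomial (Fin d) ℂ} {k : ℕ}
    (hQ : Q.IsHomogeneous (k + 2)) :
    sphereIntegral (polyFun (polyLaplacian d Q)) =
      (k + 2) * (k + d) * sphereIntegral (polyFun Q) := by
  have h := gaussianIntegral_polyLaplacian hQ
  rw [gaussianIntegral_of_isHomogeneous hd (isHomogeneous_polyLaplacian hQ),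
    gaussianIntegral_of_isHomogeneous hd hQ, Nat.add_sub_cancel,
    show k + 2 + (d - 1) = k + (d - 1) + 2 by omega, gaussianMoment_add_two] at h
  refine mul_right_cancel₀ (gaussianMoment_ne_zero (k + (d - 1))) (h.trans ?_)
  push_cast [Nat.cast_sub hd]
  ring

/-- The coefficient of `Δ^j Q (0)` in the mean of `Q` over the unit sphere. -/
def pizzettiCoeff (d j : ℕ) : ℂ :=
  (ascPochhammer ℂ j).eval (1 / 2) /
    (((2 * j).factorial : ℂ) * (ascPochhammer ℂ j).eval ((d : ℂ) / 2))

lemma ascPochhammer_eval_ne_zero (j : ℕ) {x : ℝ} (hx : 0 < x) :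
    (ascPochhammer ℂ j).eval (x : ℂ) ≠ 0 := by
  induction j with
  | zero => simp
  | succ j ih =>
    rw [ascPochhammer_succ_eval]
    exact mul_ne_zero ih (by exact_mod_cast (show x + j ≠ 0 by positivity))

lemma ascPochhammer_eval_half_ne_zero (hd : 0 < d) (j : ℕ) :
    (ascPochhammer ℂ j).eval ((d : ℂ) / 2) ≠ 0 := by
  have h := ascPochhammer_eval_ne_zero j (show (0 : ℝ) < (d : ℝ) / 2 by positivity)
  push_cast at h
  exact h

lemma pizzettiCoeff_ne_zero (hd : 0 < d) (j : ℕ) : pizzettiCoeff d j ≠ 0 := by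
  refine div_ne_zero ?_ (mul_ne_zero (by exact_mod_cast Nat.factorial_ne_zero _)
    (ascPochhammer_eval_half_ne_zero hd j))
  simpa using ascPochhammer_eval_half_ne_zero one_pos j

lemma pizzettiCoeff_succ (hd : 0 < d) (j : ℕ) :
    pizzettiCoeff d j = ((2 * j : ℕ) + 2) * ((2 * j : ℕ) + d) * pizzettiCoeff d (j + 1) := by
  have h1 : ((2 * j).factorial : ℂ) ≠ 0 := by exact_mod_cast Nat.factorial_ne_zero _
  have h2 := ascPochhammer_eval_half_ne_zero hd j
  have h3 : (d : ℂ) / 2 + j ≠ 0 := by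
    have : (((d : ℝ) / 2 + j : ℝ) : ℂ) ≠ 0 := Complex.ofReal_ne_zero.2 (by positivity)
    push_cast at this
    exact this
  have h4 : (2 * (j : ℂ) + 1 + 1) ≠ 0 := by exact_mod_cast (show 2 * j + 1 + 1 ≠ 0 by omega)
  have h5 : (2 * (j : ℂ) + 1) ≠ 0 := by exact_mod_cast (show 2 * j + 1 ≠ 0 by omega)
  rw [pizzettiCoeff, pizzettiCoeff, ascPochhammer_succ_eval, ascPochhammer_succ_eval,
    show 2 * (j + 1) = 2 * j + 1 + 1 by ring, Nat.factorial_succ, Nat.factorial_succ]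
  push_cast
  rw [eq_comm, ← mul_div_assoc, div_eq_div_iff (by simp [*]) (by simp [*])]
  ring

/-- **Pizzetti's formula** for a homogeneous polynomial. -/
lemma sphereIntegral_polyFun_eq (hd : 0 < d) (j : ℕ) {Q : MvPolynomial (Fin d) ℂ}
    (hQ : Q.IsHomogeneous (2 * j)) :
    sphereIntegral (polyFun Q) =
      (((volume : Measure (EuclideanSpace ℝ (Fin d))).toSphere.real univ : ℝ) : ℂ) *
        pizzettiCoeff d j * polyFun ((polyLaplacian d ^ j) Q) 0 := by
  induction j generalizing Q with
  | zero =>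
    have h : ∀ y, polyFun Q y = polyFun Q 0 := fun y => by
      have := polyFun_smul_of_isHomogeneous hQ 0 y
      simpa using this.symm
    simp only [sphereIntegral, h, integral_const]
    simp [pizzettiCoeff]
  | succ j ih =>
    have hL : (polyLaplacian d Q).IsHomogeneous (2 * j) := isHomogeneous_polyLaplacian hQ
    have h := sphereIntegral_polyLaplacian hd (k := 2 * j) hQ
    rw [ih hL, pizzettiCoeff_succ hd] at h
    have h0 : (((2 * j : ℕ) : ℂ) + 2) * ((2 * j : ℕ) + d) ≠ 0 := by
      exact_mod_cast (show (2 * j + 2) * (2 * j + d) ≠ 0 by positivity)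
    refine mul_left_cancel₀ h0 (h.symm.trans ?_)
    rw [pow_succ, Module.End.mul_apply]
    ring

lemma polySphereIntegral_two_mul (hd : 0 < d) (P : MvPolynomial (Fin d) ℂ) (j : ℕ) :
    polySphereIntegral P (2 * j) =
      (((volume : Measure (EuclideanSpace ℝ (Fin d))).toSphere.real univ : ℝ) : ℂ) *
        pizzettiCoeff d j * polyLaplaceAtZero P j := by
  rw [polySphereIntegral, sphereIntegral_polyFun_eq hd j
    (MvPolynomial.homogeneousComponent_isHomogeneous _ P),
    polyLaplaceAtZero_eq_homogeneousComponent]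

/-- The surface integral of an odd polynomial is zero by reflection. -/
lemma polySphereIntegral_of_odd (hd : 0 < d) (P : MvPolynomial (Fin d) ℂ) {k : ℕ} (hk : Odd k) :
    polySphereIntegral P k = 0 := by
  have hQ := MvPolynomial.homogeneousComponent_isHomogeneous k P
  have h := gaussianIntegral_of_isHomogeneous hd hQ
  have h0 : gaussianIntegral (MvPolynomial.homogeneousComponent k P) = 0 := by
    rw [← self_eq_neg, gaussianIntegral]
    conv_lhs => rw [← integral_neg_eq_self]
    rw [← integral_neg]
    refine integral_congr_ae (ae_of_all _ fun y => ?_)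
    have := polyFun_smul_of_isHomogeneous hQ (-1) y
    rw [neg_one_smul] at this
    simp only [norm_neg, this]
    push_cast
    rw [hk.neg_one_pow]
    ring
  rw [h0] at h
  exact (mul_eq_zero.1 h.symm).resolve_right (gaussianMoment_ne_zero _)

end Pizzetti

/-! ### The half-plane of absolute convergence -/

section AbsoluteConvergence

open Set

variable {d : ℕ} {c : ℝ}

lemma exists_norm_quotPow_polyFun_le (Q : MvPolynomial (Fin d) ℂ) (hc : 0 < c) (ν : ℂ) :
    ∃ K : ℝ, ∀ y : EuclideanSpace ℝ (Fin d), c ≤ ‖y‖ →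
      ‖quotPow ν (polyFun Q) y‖ ≤ K * (1 + ‖y‖) ^ (-(ν.re - Q.totalDegree)) := by
  obtain ⟨w, hw⟩ := exists_isWeight (d := d) hc
  obtain ⟨C, hC0, hC⟩ := exists_norm_polyFun_le Q
  obtain ⟨K, hK⟩ := hw.exists_norm_cpow_le ‖-ν / 2‖
  refine ⟨C * K, fun y hy => ?_⟩
  have h0 : (0 : ℝ) < 1 + ‖y‖ := by positivity
  rw [quotPow_eq_mul_weight hc hw ν _ hy, norm_mul]
  refine (mul_le_mul (hC y) (hK _ le_rfl y) (norm_nonneg _) (by positivity)).trans (le_of_eq ?_)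
  rw [← Real.rpow_natCast, mul_mul_mul_comm, ← Real.rpow_add h0]
  congr 2
  simp
  ring

lemma integrableOn_quotPow_polyFun {Q : MvPolynomial (Fin d) ℂ} (hc : 0 < c) {ν : ℂ}
    (hν : (d : ℝ) + Q.totalDegree < ν.re) :
    IntegrableOn (quotPow ν (polyFun Q)) {y : EuclideanSpace ℝ (Fin d) | c ≤ ‖y‖} := by
  obtain ⟨K, hK⟩ := exists_norm_quotPow_polyFun_le Q hc ν
  have hint : Integrable fun y : EuclideanSpace ℝ (Fin d) =>
      K * (1 + ‖y‖) ^ (-(ν.re - Q.totalDegree)) :=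
    (integrable_one_add_norm (by simp; linarith)).const_mul _
  refine hint.integrableOn.mono'
    (measurable_quotPow ν (continuous_polyFun Q).measurable).aestronglyMeasurable ?_
  exact (ae_restrict_iff' (measurableSet_norm_mem measurableSet_Ici)).2 (ae_of_all _ hK)

lemma summable_norm_quotPow_polyFun {Λ : Submodule ℤ (EuclideanSpace ℝ (Fin d))}
    [DiscreteTopology Λ] [IsZLattice ℝ Λ] {Q : MvPolynomial (Fin d) ℂ} (hc : 0 < c)
    (hcΛ : ∀ z ∈ Λ, z ≠ 0 → c ≤ ‖z‖) {ν : ℂ} (hν : (d : ℝ) + Q.totalDegree < ν.re) :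
    Summable (fun z : {z : EuclideanSpace ℝ (Fin d) // z ∈ Λ ∧ z ≠ 0} =>
      ‖quotPow ν (polyFun Q) z‖) := by
  obtain ⟨K, hK⟩ := exists_norm_quotPow_polyFun_le Q hc ν
  have h1 := ((summable_one_add_norm_rpow Λ (r := ν.re - Q.totalDegree) (by linarith)).subtype
    {z : Λ | z ≠ 0}).mul_left K
  exact Summable.of_nonneg_of_le (fun _ => norm_nonneg _)
    (fun z => hK _ (hcΛ z.1 z.2.1 z.2.2)) ((nonzeroLatticeEquiv Λ).summable_iff.2 h1)

/-- Beyond the abscissa of convergence, the integral over the exterior of the ball is opposite to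
the finite part over the ball. -/
lemma setIntegral_quotPow_polyFun (hd : 0 < d) (P : MvPolynomial (Fin d) ℂ) (hc : 0 < c) {ν : ℂ}
    (hν : (d : ℝ) + P.totalDegree < ν.re) :
    ∫ y in {y : EuclideanSpace ℝ (Fin d) | c ≤ ‖y‖}, quotPow ν (polyFun P) y =
      -∑ k ∈ Finset.range (P.totalDegree + 1), polySphereIntegral P k * radialPrim d k ν c := by
  have hfun : ∀ y, quotPow ν (polyFun P) y = ∑ k ∈ Finset.range (P.totalDegree + 1),
      quotPow ν (polyFun (MvPolynomial.homogeneousComponent k P)) y := fun y => by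
    simp only [quotPow, ← Finset.sum_div]
    rw [polyFun_eq_sum_homogeneousComponent]
  have hk : ∀ k ∈ Finset.range (P.totalDegree + 1), (d : ℝ) + k < ν.re := fun k hk => by
    have : (k : ℝ) ≤ P.totalDegree := by exact_mod_cast Nat.lt_succ_iff.1 (Finset.mem_range.1 hk)
    linarith
  have hhom := fun k => MvPolynomial.homogeneousComponent_isHomogeneous k P
  simp only [hfun]
  rw [integral_finsetSum, ← Finset.sum_neg_distrib]
  · refine Finset.sum_congr rfl fun k hk' => ?_
    have := setIntegral_quotPow_of_isHomogeneousFun hd (isHomogeneousFun_polyFun (hhom k)) ν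
      measurableSet_Ici (fun r hr => hc.trans_le hr : Ici c ⊆ Ioi 0)
    rw [integral_Ici_cpow_eq_neg_radialPrim (by linarith [hk k hk']) hc, mul_neg] at this
    exact this
  · intro k hk'
    refine integrableOn_quotPow_polyFun hc (lt_of_le_of_lt ?_ (hk k hk'))
    have : ((MvPolynomial.homogeneousComponent k P).totalDegree : ℝ) ≤ k := by
      exact_mod_cast (hhom k).totalDegree_le
    linarith

variable (U : SchwartzMap (EuclideanSpace ℝ (Fin d)) ℂ)

lemma exists_norm_quotPow_dilation_le :
    ∃ C : ℝ, 0 ≤ C ∧ ∀ (g : EuclideanSpace ℝ (Fin d) → ℂ) (ν : ℂ) (β : ℝ) (y),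
      ‖quotPow ν (fun y => U (β • y) * g y) y‖ ≤ C * ‖quotPow ν g y‖ := by
  obtain ⟨C, hC⟩ := U.exists_isSymbol 0
  have hU : ∀ y, ‖U y‖ ≤ C 0 := fun y => by simpa using hC.norm_le y
  refine ⟨C 0, (norm_nonneg _).trans (hU 0), fun g ν β y => ?_⟩
  rw [quotPow, quotPow, mul_div_assoc, norm_mul]
  exact mul_le_mul_of_nonneg_right (hU _) (norm_nonneg _)

variable {U}

lemma tendsto_quotPow_dilation (hU : U 0 = 1) (g : EuclideanSpace ℝ (Fin d) → ℂ) (ν : ℂ)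
    (y : EuclideanSpace ℝ (Fin d)) :
    Tendsto (fun β : ℝ => quotPow ν (fun y => U (β • y) * g y) y) (𝓝[>] 0)
      (𝓝 (quotPow ν g y)) := by
  have h1 : Continuous fun β : ℝ => quotPow ν (fun y => U (β • y) * g y) y :=
    ((U.continuous.comp (continuous_id.smul continuous_const)).mul continuous_const).div_const _
  simpa [quotPow, hU] using (h1.tendsto 0).mono_left (nhdsWithin_le_nhds (s := Ioi 0))

/-- In the half-plane of absolute convergence, the regularised sum-integral is the Dirichlet series:
the finite-part integrals tend to zero. -/
theorem tendsto_hadamardSumIntegral_of_lt_re {Λ : Submodule ℤ (EuclideanSpace ℝ (Fin d))}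
    [DiscreteTopology Λ] [IsZLattice ℝ Λ] (hd : 0 < d) (hU : U 0 = 1)
    {P : MvPolynomial (Fin d) ℂ} {ν : ℂ} (hν : (d : ℝ) + P.totalDegree < ν.re) :
    Tendsto (fun β : ℝ => hadamardSumIntegral Λ ν (fun y => U (β • y) * polyFun P y)) (𝓝[>] 0)
      (𝓝 (∑' z : {z : EuclideanSpace ℝ (Fin d) // z ∈ Λ ∧ z ≠ 0}, quotPow ν (polyFun P) z)) := by
  obtain ⟨c, hc, hcΛ⟩ := exists_le_norm_of_mem_lattice Λ
  obtain ⟨C, hC0, hC⟩ := exists_norm_quotPow_dilation_le U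
  have h1 : Tendsto (fun β : ℝ => ∑' z : {z : EuclideanSpace ℝ (Fin d) // z ∈ Λ ∧ z ≠ 0},
      quotPow ν (fun y => U (β • y) * polyFun P y) z) (𝓝[>] 0)
      (𝓝 (∑' z : {z : EuclideanSpace ℝ (Fin d) // z ∈ Λ ∧ z ≠ 0}, quotPow ν (polyFun P) z)) :=
    tendsto_tsum_of_dominated_convergence
      ((summable_norm_quotPow_polyFun hc hcΛ hν).mul_left C)
      (fun z => tendsto_quotPow_dilation hU _ ν z)
      (Eventually.of_forall fun β z => hC _ ν β z)
  have h2 : Tendsto (fun β : ℝ => ∫ y in {y : EuclideanSpace ℝ (Fin d) | c ≤ ‖y‖},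
      quotPow ν (fun y => U (β • y) * polyFun P y) y) (𝓝[>] 0)
      (𝓝 (∫ y in {y : EuclideanSpace ℝ (Fin d) | c ≤ ‖y‖}, quotPow ν (polyFun P) y)) := by
    refine tendsto_integral_filter_of_dominated_convergence
      (fun y => C * ‖quotPow ν (polyFun P) y‖) (Eventually.of_forall fun β => ?_)
      (Eventually.of_forall fun β => ae_of_all _ fun y => hC _ ν β y)
      ((integrableOn_quotPow_polyFun hc hν).norm.const_mul C)
      (ae_of_all _ fun y => tendsto_quotPow_dilation hU _ ν y)
    exact (measurable_quotPow ν ((U.continuous.comp (continuous_const_smul β)).mul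
      (continuous_polyFun P)).measurable).aestronglyMeasurable
  -- The limits of the exterior and of the local part of the finite-part integral cancel.
  have h3 := h1.sub ((h2.add (tendsto_hadamardLocal_dilation U P hd ν hc hU)).const_mul
    (1 / (ZLattice.covolume Λ : ℂ)))
  rw [setIntegral_quotPow_polyFun hd P hc hν, neg_add_cancel, mul_zero, sub_zero] at h3
  refine h3.congr' ?_
  filter_upwards [self_mem_nhdsWithin] with β hβ
  rw [hadamardSumIntegral, hadamardIntegral_dilation U P hd hc hβ ν]

end AbsoluteConvergence

/-! ### Poles of the radial primitives -/

section Poles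

variable {d k : ℕ} {c : ℝ}

lemma analyticAt_cpow_sub (hc : 0 < c) (a ν : ℂ) :
    AnalyticAt ℂ (fun ν : ℂ => (c : ℂ) ^ (a - ν)) ν :=
  analyticAt_const.cpow (analyticAt_const.sub analyticAt_id)
    (Or.inl (by simpa using hc))

lemma analyticAt_radialPrim (hc : 0 < c) {ν : ℂ} (h : ν ≠ d + k) :
    AnalyticAt ℂ (fun ν => radialPrim d k ν c) ν := by
  have hne : (k : ℂ) + d - ν ≠ 0 := fun h2 => h (by linear_combination -h2)
  refine ((analyticAt_cpow_sub hc ((k : ℂ) + d) ν).div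
    (analyticAt_const.sub analyticAt_id) hne).congr ?_
  filter_upwards [isOpen_ne.mem_nhds h] with z hz
  exact (radialPrim_of_ne hz c).symm

lemma radialPrim_eventuallyEq :
    (fun ν : ℂ => (c : ℂ) ^ ((k : ℂ) + d - ν) / ((k : ℂ) + d - ν)) =ᶠ[𝓝[≠] ((d : ℂ) + k)]
      fun ν => radialPrim d k ν c := by
  filter_upwards [self_mem_nhdsWithin] with z hz
  exact (radialPrim_of_ne hz c).symm

lemma meromorphicAt_radialPrim (hc : 0 < c) (ν : ℂ) :
    MeromorphicAt (fun ν => radialPrim d k ν c) ν := by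
  by_cases h : ν = d + k
  · rw [h]
    exact (((analyticAt_cpow_sub hc ((k : ℂ) + d) _).meromorphicAt.div
      (analyticAt_const.sub analyticAt_id).meromorphicAt)).congr radialPrim_eventuallyEq
  · exact (analyticAt_radialPrim hc h).meromorphicAt

lemma tendsto_sub_mul_radialPrim (hc : 0 < c) (i : ℕ) :
    Tendsto (fun ν : ℂ => (ν - (d + k)) * radialPrim d i ν c) (𝓝[≠] ((d : ℂ) + k))
      (𝓝 (if i = k then -1 else 0)) := by
  split_ifs with h
  · subst h
    have h1 : Tendsto (fun ν : ℂ => -(c : ℂ) ^ ((i : ℂ) + d - ν)) (𝓝[≠] ((d : ℂ) + i))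
        (𝓝 (-1)) := by
      have := (analyticAt_cpow_sub hc ((i : ℂ) + d) (d + i)).continuousAt.tendsto.neg
      rw [show (i : ℂ) + d - (d + i) = 0 by ring, Complex.cpow_zero] at this
      exact this.mono_left nhdsWithin_le_nhds
    refine h1.congr' ?_
    filter_upwards [self_mem_nhdsWithin] with z hz
    rw [radialPrim_of_ne hz]
    have hne : (i : ℂ) + d - z ≠ 0 := fun h2 => hz (show z = d + i by linear_combination -h2)
    field_simp
    ring
  · have hne : (d : ℂ) + k ≠ d + i := fun h2 => h (by exact_mod_cast (add_left_cancel h2).symm)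
    have h1 : ContinuousAt (fun ν : ℂ => (ν - (d + k)) * radialPrim d i ν c) ((d : ℂ) + k) :=
      (continuousAt_id.sub continuousAt_const).mul (analyticAt_radialPrim hc hne).continuousAt
    have := h1.tendsto
    rw [sub_self, zero_mul] at this
    exact this.mono_left nhdsWithin_le_nhds

variable {H : ℂ → ℂ} {p : ℕ → ℂ} {n : ℕ}

lemma analyticAt_sub_sum_radialPrim (hH : Differentiable ℂ H) (hc : 0 < c) (a : ℂ) {ν : ℂ}
    (h : ∀ k : ℕ, ν = d + k → p k = 0) :
    AnalyticAt ℂ (fun ν => H ν - a * ∑ k ∈ Finset.range n, p k * radialPrim d k ν c) ν := by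
  refine (hH.analyticAt ν).sub (analyticAt_const.mul (Finset.analyticAt_fun_sum _ fun k _ => ?_))
  by_cases hk : ν = d + k
  · simp only [h k hk, zero_mul]
    exact analyticAt_const
  · exact analyticAt_const.mul (analyticAt_radialPrim hc hk)

lemma meromorphicAt_sub_sum_radialPrim (hH : Differentiable ℂ H) (hc : 0 < c) (a ν : ℂ) :
    MeromorphicAt (fun ν => H ν - a * ∑ k ∈ Finset.range n, p k * radialPrim d k ν c) ν := by
  refine (hH.analyticAt ν).meromorphicAt.sub ((MeromorphicAt.const a ν).mul
    (MeromorphicAt.fun_sum fun k _ => ?_))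
  exact (MeromorphicAt.const _ ν).mul (meromorphicAt_radialPrim hc ν)

/-- Only the radial primitive of degree `k` contributes to the residue at `d + k`; the hypothesis
`hp` covers the degrees that are absent from the sum. -/
lemma tendsto_mul_sub_sum_radialPrim (hH : Differentiable ℂ H) (hc : 0 < c) (a : ℂ)
    (hp : ∀ k, n ≤ k → p k = 0) (k : ℕ) :
    Tendsto (fun ν : ℂ => (ν - (d + k)) *
        (H ν - a * ∑ k ∈ Finset.range n, p k * radialPrim d k ν c))
      (𝓝[≠] ((d : ℂ) + k)) (𝓝 (a * p k)) := by
  have h1 : Tendsto (fun ν : ℂ => (ν - (d + k)) * H ν) (𝓝[≠] ((d : ℂ) + k)) (𝓝 0) := by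
    have : Continuous fun ν : ℂ => (ν - (d + k)) * H ν :=
      (continuous_id.sub continuous_const).mul hH.continuous
    simpa using (this.tendsto (d + k)).mono_left nhdsWithin_le_nhds
  have h2 := tendsto_finsetSum (Finset.range n) fun i (_ : i ∈ Finset.range n) =>
    (tendsto_sub_mul_radialPrim (d := d) (k := k) hc i).const_mul (p i)
  have h3 : ∑ i ∈ Finset.range n, p i * (if i = k then (-1 : ℂ) else 0) = -p k := by
    rw [Finset.sum_eq_single k (fun i _ hi => by simp [hi])
      fun hk => by simp [hp k (by simpa using hk)]]
    simp
  rw [h3] at h2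
  have h4 := h1.sub (h2.const_mul a)
  rw [zero_sub, mul_neg, neg_neg] at h4
  refine h4.congr fun ν => ?_
  rw [mul_sub, Finset.mul_sum, Finset.mul_sum, Finset.mul_sum]
  congr 1
  exact Finset.sum_congr rfl fun i _ => by ring

/-- A nonzero residue makes the pole simple. -/
lemma meromorphicOrderAt_eq_neg_one_of_tendsto {f : ℂ → ℂ} {x r : ℂ} (hf : MeromorphicAt f x)
    (hr : r ≠ 0) (h : Tendsto (fun z => (z - x) * f z) (𝓝[≠] x) (𝓝 r)) :
    meromorphicOrderAt f x = -1 := by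
  have hsub : MeromorphicAt (fun z : ℂ => z - x) x :=
    (analyticAt_id.sub analyticAt_const).meromorphicAt
  have h1 : meromorphicOrderAt (fun z : ℂ => z - x) x = 1 :=
    (meromorphicOrderAt_eq_int_iff (n := 1) hsub).2
      ⟨fun _ => 1, analyticAt_const, one_ne_zero, Eventually.of_forall fun z => by simp⟩
  have h2 : meromorphicOrderAt ((fun z : ℂ => z - x) * f) x = 0 :=
    (tendsto_ne_zero_iff_meromorphicOrderAt_eq_zero (hsub.mul hf)).1 ⟨r, hr, h⟩
  rw [meromorphicOrderAt_mul hsub hf, h1] at h2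
  cases hm : meromorphicOrderAt f x with
  | top => rw [hm] at h2; simp at h2
  | coe m =>
    rw [hm] at h2
    have h3 : (1 : ℤ) + m = 0 := by exact_mod_cast h2
    have : m = -1 := by omega
    rw [this]
    rfl

end Poles

/-! ### The cut-off as a dilated Schwartz function -/

section Cutoff

variable {d : ℕ} {χ : EuclideanSpace ℝ (Fin d) → ℝ}

/-- The cut-off functions are the dilations of the Fourier transform of the profile, which is one at
the origin because the profile has unit mass. -/
lemma IsMollifierProfile.exists_schwartzMap (hχ : IsMollifierProfile χ) :
    ∃ U : SchwartzMap (EuclideanSpace ℝ (Fin d)) ℂ, U 0 = 1 ∧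
      ∀ β : ℝ, 0 < β → ∀ y, smoothCutoff χ β y = U (β • y) := by
  have hcs : HasCompactSupport χ := HasCompactSupport.of_support_subset_isCompact
    (isCompact_closedBall 0 1)
    ((subset_tsupport χ).trans (hχ.tsupport_subset.trans Metric.ball_subset_closedBall))
  have hcs' : HasCompactSupport fun x => (χ x : ℂ) :=
    hcs.comp_left (g := fun r : ℝ => (r : ℂ)) Complex.ofReal_zero
  have hsm : ContDiff ℝ ∞ fun x => (χ x : ℂ) := Complex.ofRealCLM.contDiff.comp hχ.smooth
  have hU : ∀ y, FourierTransform.fourier (hcs'.toSchwartzMap hsm) y =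
      ∫ v, Complex.exp (↑(-2 * Real.pi * inner ℝ v y) * Complex.I) • (χ v : ℂ) := fun y => by
    rw [SchwartzMap.fourier_coe, Real.fourier_eq']
    rfl
  refine ⟨FourierTransform.fourier (hcs'.toSchwartzMap hsm), ?_, fun β hβ y => ?_⟩
  · rw [hU]
    simp only [inner_zero_right, mul_zero, Complex.ofReal_zero, zero_mul, Complex.exp_zero,
      one_smul]
    rw [integral_complex_ofReal, hχ.integral_eq_one, Complex.ofReal_one]
  · rw [hU, smoothCutoff, Real.fourier_eq']
    have h := Measure.integral_comp_smul (volume : Measure (EuclideanSpace ℝ (Fin d)))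
      (fun v => Complex.exp (↑(-2 * Real.pi * inner ℝ v (β • y)) * Complex.I) • (χ v : ℂ)) β⁻¹
    rw [finrank_euclideanSpace_fin, inv_pow, inv_inv, abs_of_pos (pow_pos hβ d)] at h
    rw [← inv_smul_eq_iff₀ (pow_pos hβ d).ne'] at h
    rw [← h, ← integral_smul]
    refine integral_congr_ae (ae_of_all _ fun v => ?_)
    simp only [mollifier, inner_smul_left, inner_smul_right, smul_eq_mul, Complex.real_smul,
      conj_trivial]
    rw [mul_inv_cancel_left₀ hβ.ne']
    push_cast
    ring

end Cutoff

end

theorem mainTheorem7 {d : ℕ} (hd : 0 < d)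
    (Λ : Submodule ℤ (EuclideanSpace ℝ (Fin d))) [DiscreteTopology Λ] [IsZLattice ℝ Λ]
    (χ : EuclideanSpace ℝ (Fin d) → ℝ) (hχ : IsMollifierProfile χ)
    (P : MvPolynomial (Fin d) ℂ) (m : ℕ) (hP : P.totalDegree = m) :
    -- for every `β > 0`, the Hadamard sum-integral of the cut-off function is well defined
    (∀ (ν : ℂ) (β : ℝ), 0 < β →
      Summable (fun z : {z : EuclideanSpace ℝ (Fin d) // z ∈ Λ ∧ z ≠ 0} =>
        quotPow ν (fun z => smoothCutoff χ β z * polyFun P z) z) ∧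
      (∀ ε : ℝ, 0 < ε → IntegrableOn (quotPow ν (fun z => smoothCutoff χ β z * polyFun P z))
        {y : EuclideanSpace ℝ (Fin d) | ε ≤ ‖y‖}) ∧
      Tendsto (hadamardTruncated ν (fun z => smoothCutoff χ β z * polyFun P z)) (𝓝[>] 0)
        (𝓝 (hadamardIntegral ν (fun z => smoothCutoff χ β z * polyFun P z)))) ∧
    -- the limit `β ↓ 0` exists for every `ν`
    (∀ ν : ℂ, Tendsto
      (fun β : ℝ => hadamardSumIntegral Λ ν (fun z => smoothCutoff χ β z * polyFun P z))
      (𝓝[>] 0) (𝓝 (regularisedSumIntegral Λ χ P ν))) ∧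
    -- it is equal to the absolutely convergent Dirichlet series if `Re ν > d + m`
    (∀ ν : ℂ, (d : ℝ) + m < ν.re →
      Summable (fun z : {z : EuclideanSpace ℝ (Fin d) // z ∈ Λ ∧ z ≠ 0} =>
        quotPow ν (polyFun P) z) ∧
      regularisedSumIntegral Λ χ P ν =
        ∑' z : {z : EuclideanSpace ℝ (Fin d) // z ∈ Λ ∧ z ≠ 0}, quotPow ν (polyFun P) z) ∧
    -- it is meromorphic on `ℂ`
    MeromorphicOn (regularisedSumIntegral Λ χ P) Set.univ ∧
    -- it is holomorphic except at the points `d + 2k` with `Δ^k P(0) ≠ 0`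
    (∀ ν : ℂ, (∀ k : ℕ, ν = d + 2 * k → polyLaplaceAtZero P k = 0) →
      AnalyticAt ℂ (regularisedSumIntegral Λ χ P) ν) ∧
    -- which are simple poles
    (∀ k : ℕ, polyLaplaceAtZero P k ≠ 0 →
      meromorphicOrderAt (regularisedSumIntegral Λ χ P) (d + 2 * k) = -1) ∧
    -- with the stated residues
    (∀ k : ℕ, Tendsto
      (fun ν : ℂ => (ν - (d + 2 * k)) * regularisedSumIntegral Λ χ P ν)
      (𝓝[≠] ((d : ℂ) + 2 * k)) (𝓝 (sumIntegralResidue Λ P k))) := by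
  obtain ⟨U, hU0, hU⟩ := hχ.exists_schwartzMap
  obtain ⟨c, hc, hcΛ⟩ := exists_le_norm_of_mem_lattice Λ
  obtain ⟨w, hw⟩ := exists_isWeight (d := d) hc
  obtain ⟨H, hH, hlim⟩ := exists_differentiable_tendsto_hadamardSumIntegral U P hd hc hcΛ hU0
  subst hP
  have hcut : ∀ β : ℝ, 0 < β → (fun z => smoothCutoff χ β z * polyFun P z) =
      fun z => U (β • z) * polyFun P z := fun β hβ => funext fun z => by rw [hU β hβ]
  have hcongr : ∀ ν : ℂ,
      (fun β : ℝ => hadamardSumIntegral Λ ν (fun z => U (β • z) * polyFun P z)) =ᶠ[𝓝[>] 0]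
        fun β : ℝ => hadamardSumIntegral Λ ν (fun z => smoothCutoff χ β z * polyFun P z) :=
    fun ν => by
      filter_upwards [self_mem_nhdsWithin] with β hβ
      rw [hcut β hβ]
  have hF : regularisedSumIntegral Λ χ P = fun ν => H ν - (ZLattice.covolume Λ : ℂ)⁻¹ *
      ∑ k ∈ Finset.range (P.totalDegree + 1), polySphereIntegral P k * radialPrim d k ν c :=
    funext fun ν => ((hlim ν).congr' (hcongr ν)).limUnder_eq
  have hp : ∀ k, P.totalDegree + 1 ≤ k → polySphereIntegral P k = 0 := fun k hk =>
    polySphereIntegral_eq_zero hk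
  have hresidue : ∀ k : ℕ, sumIntegralResidue Λ P k =
      (ZLattice.covolume Λ : ℂ)⁻¹ * polySphereIntegral P (2 * k) := fun k => by
    rw [polySphereIntegral_two_mul hd, sumIntegralResidue, pizzettiCoeff]
    ring
  have htendsto : ∀ k : ℕ, Tendsto
      (fun ν : ℂ => (ν - (d + 2 * k)) * regularisedSumIntegral Λ χ P ν)
      (𝓝[≠] ((d : ℂ) + 2 * k)) (𝓝 (sumIntegralResidue Λ P k)) := fun k => by
    have h := tendsto_mul_sub_sum_radialPrim (d := d) hH hc (ZLattice.covolume Λ : ℂ)⁻¹ hp (2 * k)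
    push_cast at h
    rw [hresidue, hF]
    exact h
  have hmero : ∀ ν, MeromorphicAt (regularisedSumIntegral Λ χ P) ν := fun ν => by
    rw [hF]
    exact meromorphicAt_sub_sum_radialPrim hH hc _ ν
  refine ⟨fun ν β hβ => ?_, fun ν => ?_, fun ν hν => ?_, fun ν _ => hmero ν, fun ν hν => ?_,
    fun k hk => ?_, htendsto⟩
  · rw [hcut β hβ]
    refine ⟨summable_quotPow_dilation U P hc hcΛ hw hβ ν,
      fun ε hε => integrableOn_quotPow_dilation U P hβ ν hε, ?_⟩
    rw [hadamardIntegral_dilation U P hd hc hβ ν]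
    exact tendsto_hadamardTruncated_dilation U P hd hc hβ ν
  · rw [hF]
    exact (hlim ν).congr' (hcongr ν)
  · exact ⟨(summable_norm_quotPow_polyFun hc hcΛ hν).of_norm,
      ((tendsto_hadamardSumIntegral_of_lt_re hd hU0 hν).congr' (hcongr ν)).limUnder_eq⟩
  · rw [hF]
    refine analyticAt_sub_sum_radialPrim hH hc _ fun k hk => ?_
    rcases Nat.even_or_odd' k with ⟨j, rfl | rfl⟩
    · rw [polySphereIntegral_two_mul hd, hν j (by rw [hk]; push_cast; ring), mul_zero]
    · exact polySphereIntegral_of_odd hd P ⟨j, rfl⟩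
  · refine meromorphicOrderAt_eq_neg_one_of_tendsto (hmero _) ?_ (htendsto k)
    have : Nonempty (Fin d) := ⟨⟨0, hd⟩⟩
    have hω : (volume : Measure (EuclideanSpace ℝ (Fin d))).toSphere.real Set.univ ≠ 0 := by
      rw [Measure.toSphere_real_apply_univ]
      refine mul_ne_zero (by simpa using hd.ne') ?_
      exact (ENNReal.toReal_pos (Metric.measure_ball_pos _ _ one_pos).ne'
        measure_ball_lt_top.ne).ne'
    rw [hresidue, polySphereIntegral_two_mul hd]
    exact mul_ne_zero (inv_ne_zero (Complex.ofReal_ne_zero.2 (ZLattice.covolume_ne_zero Λ)))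
      (mul_ne_zero (mul_ne_zero (by exact_mod_cast hω) (pizzettiCoeff_ne_zero hd k)) hk)
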